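/- Let $k$ be a field and let $R$ be a functor from commutative $k$-algebras to (small) dg-categories such that each $R(B)$ is a $B$-linear dg-category and each $R(B)\to R(B')$ is a dg-functor semilinear over $B\to B'$. Assume the representability hypotheses (REPR): (1) the functor $B\mapsto \mathrm{ob}(R(B))$ is representable by a $k$-scheme $\mathrm{ob}(R)$; (2) for every $i\in\mathbb Z$ the functor $R^i$ is represented by a vector bundle of finite rank on $\mathrm{ob}(R)\times \mathrm{ob}(R)$, i.e. for every $(x,y):\mathrm{Spec}\,B\to \mathrm{ob}(R)\times\mathrm{ob}(R)$ the module of sections $R(B)^i(x,y)$ is a finitely generated projective $B$-module, and $B'\otimes_B R(B)^i(x,y)\to R(B')^i(x|_{B'},y|_{B'})$ is an isomorphism for every morphism $B\to B'$. For a dg-category $\mathcal A$ let $NC(\mathcal A)$ be its coherent nerve: an $n$-simplex consists of objects $X_0,\dots,X_n$ and, for every sequence $0\le i_0\le\dots\le i_m\le n$ with $m\ge 1$, of an element $\alpha(i_0,\dots,i_m)\in\mathcal A^{1-m}(X_{i_0},X_{i_m})$, such that $\alpha(i,i)=1_{X_i}$, $\alpha(i_0,\dots,i_m)=0$ if $m\ge2$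 and two consecutive indices are equal, and $$d\,\alpha(i_0,\dots,i_m)=\sum_{0<j<m}(-1)^{m-1-j}\bigl(\alpha(i_j,\dots,i_m)\circ\alpha(i_0,\dots,i_j)-\alpha(i_0,\dots,\widehat{i_j},\dots,i_m)\bigr);$$ a monotone map $f$ acts by $(f^*\alpha)(i_0,\dots,i_m)=\alpha(f(i_0),\dots,f(i_m))$. Let $NC^*(\mathcal A)\subset NC(\mathcal A)$ be the simplicial subset of the simplices all of whose $\alpha(i,j)$, $i\le j$, are equivalences (closed of degree $0$ and invertible up to homotopy). Put $X(B)=NC^*(R(B))$, a functor from commutative $k$-algebras to simplicial sets, and let $\mathrm{Match}_{\Lambda^n_l}(X)(B)$ be the set of maps from the horn $\Lambda^n_l$ to $X(B)$, i.e. (for $n\geq 2$) of families $(f_j)_{j\ne l}$ in $X_{n-1}(B)$ with $\partial_i f_j=\partial_{j-1}f_i$ for $i<j$, $i,j\neq l$. Then $X$ satisfies the Grothendieck–Pridham condition $G.P_{n,l}$ for all $n\ge 2$ and $0\le l\le n$: the restriction morphism $X_n\to \mathrm{Match}_{\Lambda^n_l}(X)$ is smooth and surjective, in the sense that for every commutative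 $k$-algebra $B$ and every $B$-point of $\mathrm{Match}_{\Lambda^n_l}(X)$, the fibre product $\mathrm{Spec}\,B\times_{\mathrm{Match}_{\Lambda^n_l}(X)}X_n$ is represented by a scheme that is smooth and surjective over $\mathrm{Spec}\,B$. -/

import Mathlib

open CategoryTheory AlgebraicGeometry Opposite Simplicial

universe u

/-- A (small) differential graded category over a commutative ring `B`, with cohomological
grading: `d` has degree `+1`, `comp g f` is `g ∘ f`, and
`d (g ∘ f) = d g ∘ f + (-1) ^ |g| g ∘ d f`.  Degrees are related by propositional equalities. -/
structure DGCategory (B : Type u) [CommRing B] where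
  Obj : Type u
  Hom : Obj → Obj → ℤ → Type u
  [addCommGroup : ∀ x y i, AddCommGroup (Hom x y i)]
  [module : ∀ x y i, Module B (Hom x y i)]
  d : ∀ {x y : Obj} (i j : ℤ), i + 1 = j → (Hom x y i →ₗ[B] Hom x y j)
  id : ∀ x : Obj, Hom x x 0
  comp : ∀ {x y z : Obj} (i j l : ℤ), i + j = l → (Hom y z i →ₗ[B] Hom x y j →ₗ[B] Hom x z l)
  d_d : ∀ {x y : Obj} (i j l : ℤ) (hij : i + 1 = j) (hjl : j + 1 = l) (f : Hom x y i),
    d j l hjl (d i j hij f) = 0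
  leibniz : ∀ {x y z : Obj} (i i' j j' l l' : ℤ) (hi : i + 1 = i') (hj : j + 1 = j')
    (hl : l + 1 = l') (h : i + j = l) (h₁ : i' + j = l') (h₂ : i + j' = l')
    (g : Hom y z i) (f : Hom x y j),
    d l l' hl (comp i j l h g f) =
      comp i' j l' h₁ (d i i' hi g) f + i.negOnePow • comp i j' l' h₂ g (d j j' hj f)
  comp_id : ∀ {x y : Obj} (i : ℤ) (f : Hom x y i), comp i 0 i (add_zero i) f (id x) = f
  id_comp : ∀ {x y : Obj} (i : ℤ) (f : Hom x y i), comp 0 i i (zero_add i) (id y) f = f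
  assoc : ∀ {w x y z : Obj} (i j l ij jl ijl : ℤ) (hij : i + j = ij) (hjl : j + l = jl)
    (h₁ : ij + l = ijl) (h₂ : i + jl = ijl)
    (h : Hom y z i) (g : Hom x y j) (f : Hom w x l),
    comp ij l ijl h₁ (comp i j ij hij h g) f = comp i jl ijl h₂ h (comp j l jl hjl g f)

attribute [instance] DGCategory.addCommGroup DGCategory.module

namespace DGCategory

variable {B : Type u} [CommRing B] (A : DGCategory B)

/-- A morphism `f` of degree `0` is an equivalence if it is closed and is invertible up to
homotopy, that is, if it is invertible in the category `H⁰(A)`. -/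
def IsEquivalence {x y : A.Obj} (f : A.Hom x y 0) : Prop :=
  A.d 0 1 (zero_add 1) f = 0 ∧
  ∃ a : A.Hom y x 0, A.d 0 1 (zero_add 1) a = 0 ∧
    (∃ h : A.Hom y y (-1), A.comp 0 0 0 (add_zero 0) f a = A.id y + A.d (-1) 0 (by norm_num) h) ∧
    (∃ g : A.Hom x x (-1), A.comp 0 0 0 (add_zero 0) a f = A.id x + A.d (-1) 0 (by norm_num) g)

end DGCategory

/-- The sequence with first term `a`, intermediate terms `l` and last term `b`. -/
def fullSeq {n : ℕ} (a : Fin (n + 1)) (l : List (Fin (n + 1))) (b : Fin (n + 1)) :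
    List (Fin (n + 1)) :=
  a :: (l ++ [b])

/-- The sequence `a, l, b` is weakly increasing. -/
def IsMonotoneSeq {n : ℕ} (a : Fin (n + 1)) (l : List (Fin (n + 1))) (b : Fin (n + 1)) : Prop :=
  (fullSeq a l b).Pairwise (· ≤ ·)

/-- Two consecutive terms of the sequence `a, l, b` are equal. -/
def IsDegenerateSeq {n : ℕ} (a : Fin (n + 1)) (l : List (Fin (n + 1))) (b : Fin (n + 1)) : Prop :=
  ¬ (fullSeq a l b).IsChain (· ≠ ·)

section Sequences

variable {n : ℕ} {a b : Fin (n + 1)} {l : List (Fin (n + 1))}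

theorem isMonotoneSeq_pair (h : a ≤ b) : IsMonotoneSeq a [] b := by
  simpa [IsMonotoneSeq, fullSeq] using h

theorem IsMonotoneSeq.erase (h : IsMonotoneSeq a l b) (j : ℕ) :
    IsMonotoneSeq a (l.eraseIdx j) b :=
  List.Pairwise.sublist (((List.eraseIdx_sublist l j).append_right [b]).cons_cons a) h

theorem fullSeq_split (j : Fin l.length) :
    fullSeq a l b = (a :: l.take j) ++ l[j] :: (l.drop (j + 1) ++ [b]) := by
  have h : l.take j ++ l[j] :: l.drop (j + 1) = l := by simp
  conv_lhs => rw [fullSeq, ← h]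
  simp only [List.append_assoc, List.cons_append]

theorem IsMonotoneSeq.left (h : IsMonotoneSeq a l b) (j : Fin l.length) :
    IsMonotoneSeq a (l.take j) l[j] := by
  rw [IsMonotoneSeq, fullSeq_split j] at h
  refine List.Pairwise.sublist ?_ h
  have : fullSeq a (l.take j) l[j] = (a :: l.take j) ++ [l[j]] := by simp [fullSeq]
  rw [this]
  exact List.Sublist.append_left (by simp) _

theorem IsMonotoneSeq.right (h : IsMonotoneSeq a l b) (j : Fin l.length) :
    IsMonotoneSeq l[j] (l.drop (j + 1)) b := by
  rw [IsMonotoneSeq, fullSeq_split j] at h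
  exact (List.pairwise_append.1 h).2.1

theorem IsMonotoneSeq.map {m : ℕ} (f : Fin (n + 1) →o Fin (m + 1)) (h : IsMonotoneSeq a l b) :
    IsMonotoneSeq (f a) (l.map f) (f b) := by
  have : fullSeq (f a) (l.map f) (f b) = (fullSeq a l b).map f := by simp [fullSeq]
  rw [IsMonotoneSeq, this, List.pairwise_map]
  exact List.Pairwise.imp (fun h => f.monotone h) h

theorem IsDegenerateSeq.map {m : ℕ} (f : Fin (n + 1) →o Fin (m + 1)) (h : IsDegenerateSeq a l b) :
    IsDegenerateSeq (f a) (l.map f) (f b) := by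
  have : fullSeq (f a) (l.map f) (f b) = (fullSeq a l b).map f := by simp [fullSeq]
  rw [IsDegenerateSeq, this, List.isChain_map]
  exact fun h' => h (List.IsChain.imp (fun x y hxy e => hxy (congrArg f e)) h')

end Sequences

/-- An `n`-simplex of the coherent nerve of the dg-category `A`, that is, a strictly unitary weak
functor from the linearization of the poset `{0 < ⋯ < n}` to `A`.  It consists of objects
`X₀, …, Xₙ` and, for every weakly increasing sequence `i₀ ≤ ⋯ ≤ i_k` in `{0, …, n}` with `k ≥ 1`,
of an element `α(i₀, …, i_k)` of `A^{1-k}(X_{i₀}, X_{i_k})`.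

The sequence `i₀, …, i_k` is encoded by its first term `a = i₀`, the list `l = [i₁, …, i_{k-1}]`
(so that `1 - k = - l.length`) and its last term `b = i_k`.

* strict unitarity: `α(i, i)` is the identity, and `α(i₀, …, i_k) = 0` if `k ≥ 2` and two
  consecutive indices are equal;
* coherence: `d α(i₀, …, i_k) =
  ∑_{0<j<k} (-1)^{k-1-j} (α(i_j, …, i_k) ∘ α(i₀, …, i_j) - α(i₀, …, î_j, …, i_k))`;
  in the code the index `j` is shifted by one, since `l[j] = i_{j+1}`. -/
structure CoherentSimplex {B : Type u} [CommRing B] (A : DGCategory B) (n : ℕ) where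
  obj : Fin (n + 1) → A.Obj
  arrow : ∀ (a : Fin (n + 1)) (l : List (Fin (n + 1))) (b : Fin (n + 1)), IsMonotoneSeq a l b →
    ∀ p : ℤ, p = -(l.length : ℤ) → A.Hom (obj a) (obj b) p
  unit : ∀ a, arrow a [] a (isMonotoneSeq_pair le_rfl) 0 (by simp) = A.id (obj a)
  degenerate : ∀ a l b (h : IsMonotoneSeq a l b) (p : ℤ) (hp : p = -(l.length : ℤ)),
    l ≠ [] → IsDegenerateSeq a l b → arrow a l b h p hp = 0
  coherence : ∀ a l b (h : IsMonotoneSeq a l b) (p q : ℤ) (hp : p = -(l.length : ℤ))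
    (hpq : p + 1 = q),
    A.d p q hpq (arrow a l b h p hp) =
      ∑ j : Fin l.length, ((l.length : ℤ) - 1 - (j : ℤ)).negOnePow •
        (A.comp (-((l.drop (j + 1)).length : ℤ)) (-((l.take j).length : ℤ)) q
            (by have := j.2; rw [List.length_drop, List.length_take]; omega)
            (arrow l[j] (l.drop (j + 1)) b (h.right j) _ rfl)
            (arrow a (l.take j) l[j] (h.left j) _ rfl) -
          arrow a (l.eraseIdx j) b (h.erase j) q
            (by have := j.2; rw [List.length_eraseIdx_of_lt this]; omega))

namespace CoherentSimplex

variable {B : Type u} [CommRing B] {A : DGCategory B} {n m : ℕ}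

theorem arrow_congr (σ : CoherentSimplex A n) {a b : Fin (n + 1)} {l l' : List (Fin (n + 1))}
    (hl : l = l') (h : IsMonotoneSeq a l b) (h' : IsMonotoneSeq a l' b) (p : ℤ)
    (hp : p = -(l.length : ℤ)) (hp' : p = -(l'.length : ℤ)) :
    σ.arrow a l b h p hp = σ.arrow a l' b h' p hp' := by
  subst hl; rfl

theorem comp_arrow_congr (σ : CoherentSimplex A n) {a b c c' : Fin (n + 1)}
    {l₁ l₁' l₂ l₂' : List (Fin (n + 1))}
    (hc : c = c') (hl₁ : l₁ = l₁') (hl₂ : l₂ = l₂') (p₁ p₂ p₁' p₂' q : ℤ)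
    (h₁ : IsMonotoneSeq a l₁ c) (h₁' : IsMonotoneSeq a l₁' c')
    (h₂ : IsMonotoneSeq c l₂ b) (h₂' : IsMonotoneSeq c' l₂' b)
    (e₁ : p₁ = -(l₁.length : ℤ)) (e₁' : p₁' = -(l₁'.length : ℤ))
    (e₂ : p₂ = -(l₂.length : ℤ)) (e₂' : p₂' = -(l₂'.length : ℤ))
    (e : p₂ + p₁ = q) (e' : p₂' + p₁' = q) :
    A.comp p₂ p₁ q e (σ.arrow c l₂ b h₂ p₂ e₂) (σ.arrow a l₁ c h₁ p₁ e₁) =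
      A.comp p₂' p₁' q e' (σ.arrow c' l₂' b h₂' p₂' e₂') (σ.arrow a l₁' c' h₁' p₁' e₁') := by
  subst hc hl₁ hl₂ e₁ e₁' e₂ e₂'; rfl

theorem ext_arrow {σ τ : CoherentSimplex A n} (ho : σ.obj = τ.obj)
    (ha : ∀ a l b h p hp, HEq (σ.arrow a l b h p hp) (τ.arrow a l b h p hp)) : σ = τ := by
  obtain ⟨o, f, _, _, _⟩ := σ
  obtain ⟨o', f', _, _, _⟩ := τ
  obtain rfl : o = o' := ho
  obtain rfl : f = f' := by
    funext a l b h p hp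
    exact eq_of_heq (ha a l b h p hp)
  rfl

/-- The simplicial structure: `(f^* α)(i₀, …, i_k) = α(f i₀, …, f i_k)`. -/
def pullback (f : Fin (m + 1) →o Fin (n + 1)) (σ : CoherentSimplex A n) :
    CoherentSimplex A m where
  obj := fun a => σ.obj (f a)
  arrow := fun a l b h p hp => σ.arrow (f a) (l.map f) (f b) (h.map f) p (by simpa using hp)
  unit := fun a => σ.unit (f a)
  degenerate := fun a l b h p hp hl hd =>
    σ.degenerate _ _ _ _ _ _ (by simpa using hl) (hd.map f)
  coherence := by
    intro a l b h p q hp hpq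
    rw [σ.coherence]
    refine Fintype.sum_equiv (finCongr (by simp)) _ _ ?_
    intro j
    have hj : (j : ℕ) < l.length := by simpa using j.2
    congr 1
    · simp
    · congr 1
      · apply σ.comp_arrow_congr <;> simp [List.map_take, List.map_drop]
      · apply σ.arrow_congr
        simp [List.eraseIdx_map]

theorem pullback_id (σ : CoherentSimplex A n) : σ.pullback OrderHom.id = σ := by
  refine ext_arrow rfl fun a l b h p hp => heq_of_eq ?_
  exact σ.arrow_congr (by simp) _ _ _ _ _

theorem pullback_pullback {r : ℕ} (f : Fin (m + 1) →o Fin (n + 1))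
    (g : Fin (r + 1) →o Fin (m + 1)) (σ : CoherentSimplex A n) :
    (σ.pullback f).pullback g = σ.pullback (f.comp g) := by
  refine ext_arrow rfl fun a l b h p hp => heq_of_eq ?_
  exact σ.arrow_congr (by simp) _ _ _ _ _

end CoherentSimplex

/-- The coherent nerve `NC(A)` of a dg-category, a simplicial set. -/
def coherentNerve {B : Type u} [CommRing B] (A : DGCategory B) : SSet.{u} where
  obj m := CoherentSimplex A m.unop.len
  map f := ↾(CoherentSimplex.pullback f.unop.toOrderHom)
  map_id m := by
    ext σ
    exact σ.pullback_id
  map_comp f g := by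
    ext σ
    exact (σ.pullback_pullback f.unop.toOrderHom g.unop.toOrderHom).symm

/-- The simplicial subset `NC^*(A)` of the coherent nerve: all the `α(i₀, i₁)`, `i₀ ≤ i₁`, are
equivalences. -/
def equivNerve {B : Type u} [CommRing B] (A : DGCategory B) :
    (coherentNerve A).Subcomplex where
  obj m := Set.ofPred fun σ : CoherentSimplex A m.unop.len =>
    ∀ (a b : Fin (m.unop.len + 1)) (h : a ≤ b),
      A.IsEquivalence (σ.arrow a [] b (isMonotoneSeq_pair h) 0 (by simp))
  map f := fun σ hσ a b h => hσ (f.unop.toOrderHom a) (f.unop.toOrderHom b)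
    (f.unop.toOrderHom.monotone h)

section

variable {k : Type u} [Field k]

/-- A dg-functor from a `B`-linear dg-category to a `B'`-linear one, semilinear over a morphism
`φ : B ⟶ B'` of commutative `k`-algebras. -/
@[ext]
structure DGFunctor {B B' : CommAlgCat.{u} k} (φ : B ⟶ B') (A : DGCategory B)
    (A' : DGCategory B') where
  obj : A.Obj → A'.Obj
  map : ∀ {x y : A.Obj} {i : ℤ}, A.Hom x y i →+ A'.Hom (obj x) (obj y) i
  map_smul : ∀ {x y : A.Obj} {i : ℤ} (c : B) (f : A.Hom x y i), map (c • f) = φ.hom c • map f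
  map_d : ∀ {x y : A.Obj} (i j : ℤ) (h : i + 1 = j) (f : A.Hom x y i),
    map (A.d i j h f) = A'.d i j h (map f)
  map_id : ∀ x : A.Obj, map (A.id x) = A'.id (obj x)
  map_comp : ∀ {x y z : A.Obj} (i j l : ℤ) (h : i + j = l) (g : A.Hom y z i) (f : A.Hom x y j),
    map (A.comp i j l h g f) = A'.comp i j l h (map g) (map f)

namespace DGFunctor

/-- The identity dg-functor. -/
def refl {B : CommAlgCat.{u} k} (A : DGCategory B) : DGFunctor (𝟙 B) A A where
  obj := fun x => x
  map := AddMonoidHom.id _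
  map_smul _ _ := rfl
  map_d _ _ _ _ := rfl
  map_id _ := rfl
  map_comp _ _ _ _ _ _ := rfl

variable {B B' B'' : CommAlgCat.{u} k} {φ : B ⟶ B'} {ψ : B' ⟶ B''}
  {A : DGCategory B} {A' : DGCategory B'} {A'' : DGCategory B''}

/-- The composition of dg-functors. -/
def trans (F : DGFunctor φ A A') (G : DGFunctor ψ A' A'') : DGFunctor (φ ≫ ψ) A A'' where
  obj := fun x => G.obj (F.obj x)
  map := G.map.comp F.map
  map_smul c f := by simp [F.map_smul, G.map_smul]
  map_d i j h f := by simp [F.map_d, G.map_d]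
  map_id x := by simp [F.map_id, G.map_id]
  map_comp i j l h g f := by simp [F.map_comp, G.map_comp]

theorem isEquivalence (F : DGFunctor φ A A') {x y : A.Obj} {f : A.Hom x y 0}
    (hf : A.IsEquivalence f) : A'.IsEquivalence (F.map f) := by
  obtain ⟨h₀, a, ha, ⟨h, hh⟩, ⟨g, hg⟩⟩ := hf
  refine ⟨by rw [← F.map_d, h₀, map_zero], F.map a, by rw [← F.map_d, ha, map_zero],
    ⟨F.map h, ?_⟩, ⟨F.map g, ?_⟩⟩
  · rw [← F.map_comp, hh, map_add, F.map_id, F.map_d]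
  · rw [← F.map_comp, hg, map_add, F.map_id, F.map_d]

/-- The image of a simplex of the coherent nerve under a dg-functor. -/
def mapSimplex (F : DGFunctor φ A A') {n : ℕ} (σ : CoherentSimplex A n) :
    CoherentSimplex A' n where
  obj := fun a => F.obj (σ.obj a)
  arrow := fun a l b h p hp => F.map (σ.arrow a l b h p hp)
  unit a := by rw [σ.unit, F.map_id]
  degenerate a l b h p hp hl hd := by rw [σ.degenerate a l b h p hp hl hd, map_zero]
  coherence a l b h p q hp hpq := by
    rw [← F.map_d, σ.coherence, map_sum]
    refine Finset.sum_congr rfl fun j _ => ?_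
    rw [Units.smul_def, Units.smul_def, map_zsmul, map_sub, F.map_comp]

/-- The morphism induced by a dg-functor on the simplicial sets `NC^*`. -/
def mapEquivNerve (F : DGFunctor φ A A') :
    (equivNerve A : SSet.{u}) ⟶ (equivNerve A' : SSet.{u}) where
  app _ := ↾(fun σ => ⟨F.mapSimplex σ.1, fun a b h => F.isEquivalence (σ.2 a b h)⟩)
  naturality _ _ _ := rfl

end DGFunctor

variable (k) in
/-- A functor `R` from commutative `k`-algebras to dg-categories such that `R(B)` is `B`-linear:
the dg-functor `R(B) → R(B')` attached to `φ : B ⟶ B'` is `φ`-semilinear. -/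
structure DGFamily where
  cat : ∀ B : CommAlgCat.{u} k, DGCategory.{u} B
  map : ∀ {B B' : CommAlgCat.{u} k} (φ : B ⟶ B'), DGFunctor φ (cat B) (cat B')
  map_id : ∀ B : CommAlgCat.{u} k, map (𝟙 B) = DGFunctor.refl (cat B)
  map_comp : ∀ {B B' B'' : CommAlgCat.{u} k} (φ : B ⟶ B') (ψ : B' ⟶ B''),
    map (φ ≫ ψ) = (map φ).trans (map ψ)

/-- The morphism `Spec B' ⟶ Spec B` defined by a morphism `B ⟶ B'` of `k`-algebras. -/
noncomputable abbrev specMap {B B' : CommAlgCat.{u} k} (φ : B ⟶ B') :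
    Spec (CommRingCat.of B') ⟶ Spec (CommRingCat.of B) :=
  Spec.map (CommRingCat.ofHom φ.hom.toRingHom)

/-- The structure morphism `Spec B ⟶ Spec k` of a `k`-algebra. -/
noncomputable abbrev specStr (B : CommAlgCat.{u} k) :
    Spec (CommRingCat.of B) ⟶ Spec (CommRingCat.of k) :=
  Spec.map (CommRingCat.ofHom (algebraMap k B))

/-- An additive map `f : M → M'` that is semilinear over `φ : B → B'` exhibits the `B'`-module `M'`
as the extension of scalars `B' ⊗ M`. -/
def IsScalarExtension {B B' M M' : Type u} [CommRing B] [CommRing B'] [AddCommGroup M]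
    [AddCommGroup M'] [Module B M] [Module B' M'] (φ : B →+* B') (f : M →+ M')
    (hf : ∀ (c : B) (x : M), f (c • x) = φ c • f x) : Prop :=
  letI : Algebra B B' := φ.toAlgebra
  letI : Module B M' := Module.compHom M' φ
  haveI : IsScalarTower B B' M' := ⟨fun b c x => mul_smul (φ b) c x⟩
  IsBaseChange B' ({ toFun := f, map_add' := f.map_add, map_smul' := hf } : M →ₗ[B] M')

namespace DGFamily

variable (R : DGFamily.{u} k)

/-- The representability hypotheses (REPR):

* the functor `ob(R)` is represented by a `k`-scheme `S`;
* every `R^i` is a vector bundle (of finite rank) on `ob(R) × ob(R)`: at each `B`-valued point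
  `(x, y)` of `ob(R) × ob(R)` its module of sections `R(B)^i(x, y)` is a finitely generated
  projective `B`-module, and the formation of this module commutes with every base change
  `B ⟶ B'`. -/
structure IsRepresentable : Prop where
  ob : ∃ (S : Scheme.{u}) (s : S ⟶ Spec (CommRingCat.of k))
    (e : ∀ B : CommAlgCat.{u} k,
      (R.cat B).Obj ≃ {t : Spec (CommRingCat.of B) ⟶ S // t ≫ s = specStr B}),
    ∀ (B B' : CommAlgCat.{u} k) (φ : B ⟶ B') (x : (R.cat B).Obj),
      (e B' ((R.map φ).obj x)).1 = specMap φ ≫ (e B x).1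
  finite : ∀ (B : CommAlgCat.{u} k) (x y : (R.cat B).Obj) (i : ℤ),
    Module.Finite B ((R.cat B).Hom x y i)
  projective : ∀ (B : CommAlgCat.{u} k) (x y : (R.cat B).Obj) (i : ℤ),
    Module.Projective B ((R.cat B).Hom x y i)
  baseChange : ∀ (B B' : CommAlgCat.{u} k) (φ : B ⟶ B') (x y : (R.cat B).Obj) (i : ℤ),
    IsScalarExtension φ.hom.toRingHom ((R.map φ).map (x := x) (y := y) (i := i))
      (R.map φ).map_smul

/-- The functor `X = NC^* ∘ R` from commutative `k`-algebras to simplicial sets. -/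
def nerve : CommAlgCat.{u} k ⥤ SSet.{u} where
  obj B := (equivNerve (R.cat B) : SSet.{u})
  map φ := (R.map φ).mapEquivNerve
  map_id B := by rw [R.map_id]; rfl
  map_comp φ ψ := by rw [R.map_comp]; rfl

end DGFamily

/-- A morphism `μ : F ⟶ G` of functors on commutative `k`-algebras is representable by schemes,
smooth and surjective: for every `k`-algebra `B` and every point `g ∈ G(B)` the fibre product
`Spec B ×_G F` is represented by a scheme `T` over `Spec B` whose structure morphism `π` is smooth
and surjective.  (For functors represented by schemes this says that the morphism of schemes `μ`
is smooth and surjective.) -/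
def IsSmoothSurjective {F G : CommAlgCat.{u} k ⥤ Type u} (μ : F ⟶ G) : Prop :=
  ∀ (B : CommAlgCat.{u} k) (g : G.obj B),
    ∃ (T : Scheme.{u}) (π : T ⟶ Spec (CommRingCat.of B)), Smooth π ∧ Surjective π ∧
      ∃ e : ∀ (B' : CommAlgCat.{u} k) (φ : B ⟶ B'),
        {x : F.obj B' // μ.app B' x = G.map φ g} ≃
          {t : Spec (CommRingCat.of B') ⟶ T // t ≫ π = specMap φ},
        ∀ (B' B'' : CommAlgCat.{u} k) (φ : B ⟶ B') (ψ : B' ⟶ B'')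
          (x : {x : F.obj B' // μ.app B' x = G.map φ g})
          (y : {y : F.obj B'' // μ.app B'' y = G.map (φ ≫ ψ) g}),
          y.1 = F.map ψ x.1 → (e B'' (φ ≫ ψ) y).1 = specMap ψ ≫ (e B' φ x).1

section GP

variable (X : CommAlgCat.{u} k ⥤ SSet.{u}) (n : ℕ) (i : Fin (n + 1))

/-- The functor `X_n`. -/
def simplices : CommAlgCat.{u} k ⥤ Type u :=
  X ⋙ (evaluation SimplexCategoryᵒᵖ (Type u)).obj (op ⦋n⦌)

/-- The matching object `Match_{Λ^i_n}(X)`: its value at `B` is the set of morphisms from the horn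
`Λ^i_n` to `X(B)`, that is, for `n ≥ 2`, of families `(f_j)_{j ≠ i}` of elements of `X_{n-1}(B)`
with `∂_j f_l = ∂_{l-1} f_j` for `j < l`. -/
def matching : CommAlgCat.{u} k ⥤ Type u :=
  X ⋙ coyoneda.obj (op (Λ[n, i] : SSet.{u}))

/-- The restriction `X_n ⟶ Match_{Λ^i_n}(X)`, `x ↦ (∂_j x)_{j ≠ i}`. -/
def toMatching : simplices X n ⟶ matching X n i where
  app B := ↾(fun x => Λ[n, i].ι ≫ SSet.yonedaEquiv.symm x)
  naturality B B' φ := by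
    ext x
    exact ((Category.assoc _ _ _).trans
      (congrArg (Λ[n, i].ι ≫ ·) (SSet.yonedaEquiv_symm_comp _ (X.map φ)))).symm

/-- The condition `G.P_{n,i}`: the morphism `X_n ⟶ Match_{Λ^i_n}(X)` is smooth and surjective. -/
def GrothendieckPridham : Prop :=
  IsSmoothSurjective (toMatching X n i)

end GP

end

/-! Since n ≥ 2, every vertex lies in the horn, so the objects of a filler are prescribed. Extending
the horn by zero gives a presimplex S in which only two nondegenerate arrows remain to be chosen: x
= α(0,…,î,…,n), where i is the omitted index, and y = α(0,…,n). Degenerate arrows are forced, and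
the coherence equations still to be satisfied are dx = β₁ and dy = β₀ + U x. Here β₁ and β₀ are the
right hand sides computed from S, and U is the coefficient of x in the equation of the full
sequence. Up to sign, U is the identity if 0 < i < n, precomposition with α(0,1) if i = 0, and
postcomposition with α(n-1,n) if i = n.

In the last two cases the edge belongs to the horn, so it is an equivalence. Hence U is a homotopy
equivalence of complexes and its cone is contractible (`isContractibleCone_of_homotopy`). The linear
part D(x,y) = (dx, dy - U x) is a differential of this cone, and (β₁, β₀) is a cocycle by the
identity d ∘ d = 0 of the coherence equations (`PreSimplex.d_bdry`). The contraction c therefore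
gives the particular solution c(β₁, β₀) and also satisfies D c D = D. The solutions are a translate
of ker D, the image of the projector 1 - cD, hence a direct summand of a finitely generated
projective module, and its formation commutes with base change.

Lifting this projector to a free module gives an idempotent matrix P whose fixed vectors parametrize
the fillers over every B-algebra (`exists_idempotent_of_split`). The functor of fixed vectors is
represented by B[X]/(X - PX). This algebra is smooth because a lift of a fixed vector can be
corrected by applying P, and its spectrum surjects onto Spec B because of the zero section.

The condition that edges be equivalences concerns a new arrow only if n = 2, where x is itself an
edge. There the coherence equation of y says that the triangle commutes up to homotopy, and
two-out-of-three in H⁰ applies. -/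

/-! ### Presimplices and signed sums over pairs of positions -/

/-- The data underlying a simplex of the coherent nerve, without the coherence conditions. -/
structure PreSimplex {B : Type u} [CommRing B] (A : DGCategory B) (n : ℕ) where
  obj : Fin (n + 1) → A.Obj
  arrow : ∀ (a : Fin (n + 1)) (l : List (Fin (n + 1))) (b : Fin (n + 1)), IsMonotoneSeq a l b →
    ∀ p : ℤ, p = -(l.length : ℤ) → A.Hom (obj a) (obj b) p

theorem IsMonotoneSeq.mid {n : ℕ} {a b : Fin (n + 1)} {l : List (Fin (n + 1))}
    (h : IsMonotoneSeq a l b) {j k : ℕ} (hjk : j < k) (hk : k < l.length) :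
    IsMonotoneSeq (l[j]'(hjk.trans hk)) ((l.take k).drop (j + 1)) l[k] := by
  have := (h.left ⟨k, hk⟩).right ⟨j, by simp; omega⟩
  simpa using this

theorem sum_range_shift {M : Type*} [AddCommMonoid M] (f : ℕ → M) {j L : ℕ} (hj : j < L) :
    ∑ k ∈ Finset.range (L - 1 - j), f (j + 1 + k) =
      ∑ k ∈ Finset.range L, if j < k then f k else 0 := by
  rw [← Finset.sum_filter]
  refine Finset.sum_bij' (fun k _ => j + 1 + k) (fun k _ => k - (j + 1)) ?_ ?_ ?_ ?_ ?_
  all_goals simp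
  all_goals intros
  all_goals omega

theorem sum_range_initial {M : Type*} [AddCommMonoid M] (f : ℕ → M) {j L : ℕ} (hj : j < L) :
    ∑ k ∈ Finset.range j, f k = ∑ k ∈ Finset.range L, if k < j then f k else 0 := by
  rw [← Finset.sum_filter]
  refine Finset.sum_congr ?_ fun _ _ => rfl
  ext k
  simp
  omega

theorem sum_range_omit {M : Type*} [AddCommMonoid M] (f g : ℕ → M) {j L : ℕ} (hj : j < L) :
    ∑ k ∈ Finset.range (L - 1), (if k < j then f k else g (k + 1)) =
      ∑ k ∈ Finset.range L, ((if k < j then f k else 0) + if j < k then g k else 0) := by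
  obtain ⟨d, rfl⟩ : ∃ d, L = j + 1 + d := ⟨L - (j + 1), by omega⟩
  rw [show j + 1 + d - 1 = j + d by omega, Finset.sum_range_add, Finset.sum_range_add,
    Finset.sum_range_succ]
  simp only [lt_irrefl, if_false, add_zero]
  congr 1
  · refine Finset.sum_congr rfl fun k hk => ?_
    have := Finset.mem_range.1 hk
    simp [this, this.not_gt]
  · refine Finset.sum_congr rfl fun k hk => ?_
    rw [if_neg (by omega), if_neg (by omega), if_pos (by omega), zero_add]
    congr 1
    omega

/-- The combinatorial identity behind `d ∘ d = 0` for the coherence equations. -/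
theorem sum_cut_face_eq_zero {M : Type*} [AddCommGroup M] (L : ℕ) (T P Q E : ℕ → ℕ → M) :
    ∑ j ∈ Finset.range L, ((L : ℤ) - 1 - j).negOnePow •
      ((∑ k ∈ Finset.range (L - 1 - j), ((L : ℤ) - 1 - (j + 1 + k)).negOnePow •
          (T j (j + 1 + k) - P j (j + 1 + k))) +
        ((L : ℤ) - 1 - j).negOnePow • (∑ k ∈ Finset.range j, ((j : ℤ) - 1 - k).negOnePow •
          (T k j - Q k j)) -
        ∑ k ∈ Finset.range (L - 1), ((L : ℤ) - 2 - k).negOnePow •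
          (if k < j then P k j - E k j else Q j (k + 1) - E j (k + 1))) = 0 := by
  have key : ∀ j ∈ Finset.range L, ((L : ℤ) - 1 - j).negOnePow •
      ((∑ k ∈ Finset.range (L - 1 - j), ((L : ℤ) - 1 - (j + 1 + k)).negOnePow •
          (T j (j + 1 + k) - P j (j + 1 + k))) +
        ((L : ℤ) - 1 - j).negOnePow • (∑ k ∈ Finset.range j, ((j : ℤ) - 1 - k).negOnePow •
          (T k j - Q k j)) -
        ∑ k ∈ Finset.range (L - 1), ((L : ℤ) - 2 - k).negOnePow •
          (if k < j then P k j - E k j else Q j (k + 1) - E j (k + 1))) =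
      ∑ k ∈ Finset.range L,
        ((if j < k then (j + k : ℤ).negOnePow • (T j k - P j k - Q j k + E j k) else 0) -
        (if k < j then (k + j : ℤ).negOnePow • (T k j - P k j - Q k j + E k j) else 0)) := by
    intro j hj
    have hj := Finset.mem_range.1 hj
    have h₁ := sum_range_shift (fun k => ((L : ℤ) - 1 - k).negOnePow • (T j k - P j k)) hj
    have h₂ := sum_range_initial (fun k => ((j : ℤ) - 1 - k).negOnePow • (T k j - Q k j)) hj
    have h₃ := sum_range_omit (fun k => ((L : ℤ) - 2 - k).negOnePow • (P k j - E k j))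
      (fun k => ((L : ℤ) - 1 - k).negOnePow • (Q j k - E j k)) hj
    push_cast at h₁ h₃
    have h₃' : ∑ k ∈ Finset.range (L - 1), ((L : ℤ) - 2 - k).negOnePow •
          (if k < j then P k j - E k j else Q j (k + 1) - E j (k + 1)) =
        ∑ k ∈ Finset.range (L - 1), (if k < j then ((L : ℤ) - 2 - k).negOnePow • (P k j - E k j)
          else ((L : ℤ) - 1 - (k + 1)).negOnePow • (Q j (k + 1) - E j (k + 1))) := by
      refine Finset.sum_congr rfl fun k _ => ?_
      split_ifs
      · rfl
      · rw [show (L : ℤ) - 2 - k = L - 1 - (k + 1) by ring]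
    rw [h₁, h₂, h₃', h₃, Finset.smul_sum, ← Finset.sum_add_distrib, ← Finset.sum_sub_distrib,
      Finset.smul_sum]
    refine Finset.sum_congr rfl fun k _ => ?_
    rcases lt_trichotomy j k with h | rfl | h
    · have e : ((L : ℤ) - 1 - j).negOnePow * ((L : ℤ) - 1 - k).negOnePow =
          (j + k : ℤ).negOnePow := by
        rw [← Int.negOnePow_add, Int.negOnePow_eq_iff]
        exact ⟨L - 1 - j - k, by ring⟩
      simp only [h, h.not_gt, if_true, if_false, smul_zero, add_zero, sub_zero, zero_add]
      rw [← smul_sub, smul_smul, e]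
      congr 1
      abel
    · simp
    · have e : ((L : ℤ) - 1 - j).negOnePow * ((L : ℤ) - 1 - j).negOnePow = 1 := by
        rw [← Int.negOnePow_add]
        exact Int.negOnePow_even _ ⟨_, rfl⟩
      have e₁ : ((j : ℤ) - 1 - k).negOnePow = - (k + j : ℤ).negOnePow := by
        rw [← Int.negOnePow_succ, Int.negOnePow_eq_iff]
        exact ⟨- 1 - k, by ring⟩
      have e₂ : ((L : ℤ) - 1 - j).negOnePow * ((L : ℤ) - 2 - k).negOnePow =
          - (k + j : ℤ).negOnePow := by
        rw [← Int.negOnePow_succ, ← Int.negOnePow_add, Int.negOnePow_eq_iff]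
        exact ⟨L - 2 - j - k, by ring⟩
      simp only [h, h.not_gt, if_true, if_false, add_zero, zero_add, zero_sub]
      rw [smul_sub, smul_smul, smul_smul, smul_smul, e, one_mul, e₁, e₂, Units.neg_smul,
        Units.neg_smul, sub_neg_eq_add, ← sub_eq_neg_add, ← smul_sub, ← smul_neg]
      congr 1
      abel
  rw [Finset.sum_congr rfl key]
  simp only [Finset.sum_sub_distrib]
  rw [sub_eq_zero]
  exact Finset.sum_comm

/-! ### The right hand side of the coherence equations and its differential -/

namespace PreSimplex

variable {B : Type u} [CommRing B] {A : DGCategory B} {n : ℕ} (S : PreSimplex A n)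

theorem arrow_congr {a b : Fin (n + 1)} {l l' : List (Fin (n + 1))}
    (hl : l = l') (h : IsMonotoneSeq a l b) (h' : IsMonotoneSeq a l' b) (p : ℤ)
    (hp : p = -(l.length : ℤ)) (hp' : p = -(l'.length : ℤ)) :
    S.arrow a l b h p hp = S.arrow a l' b h' p hp' := by
  subst hl; rfl

/-- Vertices, lists and degrees are compared by separate equalities, so each arithmetic or list
identity can be proved on its own and then substituted in the dependent types. -/
theorem comp_arrow_congr {a b c c' : Fin (n + 1)} {l₁ l₁' l₂ l₂' : List (Fin (n + 1))}
    (hc : c = c') (hl₁ : l₁ = l₁') (hl₂ : l₂ = l₂') {p₁ p₂ p₁' p₂' q : ℤ}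
    {h₁ : IsMonotoneSeq a l₁ c} {h₁' : IsMonotoneSeq a l₁' c'}
    {h₂ : IsMonotoneSeq c l₂ b} {h₂' : IsMonotoneSeq c' l₂' b}
    {e₁ : p₁ = -(l₁.length : ℤ)} {e₁' : p₁' = -(l₁'.length : ℤ)}
    {e₂ : p₂ = -(l₂.length : ℤ)} {e₂' : p₂' = -(l₂'.length : ℤ)}
    {e : p₂ + p₁ = q} {e' : p₂' + p₁' = q} :
    A.comp p₂ p₁ q e (S.arrow c l₂ b h₂ p₂ e₂) (S.arrow a l₁ c h₁ p₁ e₁) =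
      A.comp p₂' p₁' q e' (S.arrow c' l₂' b h₂' p₂' e₂') (S.arrow a l₁' c' h₁' p₁' e₁') := by
  subst hc hl₁ hl₂ e₁ e₁' e₂ e₂'; rfl

theorem comp_comp_arrow_congr {a b c c' e e' : Fin (n + 1)}
    {l₁ l₁' l₂ l₂' l₃ l₃' : List (Fin (n + 1))}
    (hc : c = c') (he : e = e') (hl₁ : l₁ = l₁') (hl₂ : l₂ = l₂') (hl₃ : l₃ = l₃')
    {p₁ p₂ p₃ p₁' p₂' p₃' r r' q : ℤ}
    {h₁ : IsMonotoneSeq a l₁ c} {h₁' : IsMonotoneSeq a l₁' c'}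
    {h₂ : IsMonotoneSeq c l₂ e} {h₂' : IsMonotoneSeq c' l₂' e'}
    {h₃ : IsMonotoneSeq e l₃ b} {h₃' : IsMonotoneSeq e' l₃' b}
    {e₁ : p₁ = -(l₁.length : ℤ)} {e₁' : p₁' = -(l₁'.length : ℤ)}
    {e₂ : p₂ = -(l₂.length : ℤ)} {e₂' : p₂' = -(l₂'.length : ℤ)}
    {e₃ : p₃ = -(l₃.length : ℤ)} {e₃' : p₃' = -(l₃'.length : ℤ)}
    {hr : p₂ + p₁ = r} {hr' : p₂' + p₁' = r'} {hq : p₃ + r = q} {hq' : p₃' + r' = q} :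
    A.comp p₃ r q hq (S.arrow e l₃ b h₃ p₃ e₃)
        (A.comp p₂ p₁ r hr (S.arrow c l₂ e h₂ p₂ e₂) (S.arrow a l₁ c h₁ p₁ e₁)) =
      A.comp p₃' r' q hq' (S.arrow e' l₃' b h₃' p₃' e₃')
        (A.comp p₂' p₁' r' hr' (S.arrow c' l₂' e' h₂' p₂' e₂')
          (S.arrow a l₁' c' h₁' p₁' e₁')) := by
  subst hc he hl₁ hl₂ hl₃ e₁ e₁' e₂ e₂' e₃ e₃' hr hr'; rfl

/-- The right hand side of the coherence equation. -/
def bdry (a : Fin (n + 1)) (l : List (Fin (n + 1))) (b : Fin (n + 1)) (h : IsMonotoneSeq a l b)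
    (q : ℤ) (hq : -(l.length : ℤ) + 1 = q) : A.Hom (S.obj a) (S.obj b) q :=
  ∑ j : Fin l.length, ((l.length : ℤ) - 1 - (j : ℤ)).negOnePow •
        (A.comp (-((l.drop (j + 1)).length : ℤ)) (-((l.take j).length : ℤ)) q
            (by have := j.2; rw [List.length_drop, List.length_take]; omega)
            (S.arrow l[j] (l.drop (j + 1)) b (h.right j) _ rfl)
            (S.arrow a (l.take j) l[j] (h.left j) _ rfl) -
          S.arrow a (l.eraseIdx j) b (h.erase j) q
            (by have := j.2; rw [List.length_eraseIdx_of_lt this]; omega))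

section

variable (a : Fin (n + 1)) (l : List (Fin (n + 1))) (b : Fin (n + 1)) (h : IsMonotoneSeq a l b)
    (q : ℤ) (hq : -(l.length : ℤ) + 2 = q) (j k : ℕ)

/-- The composition of the arrows obtained by cutting a sequence at two places. -/
def cutCut : A.Hom (S.obj a) (S.obj b) q :=
  -- The default value 0 makes this a function on all pairs of natural numbers, as
  -- `sum_cut_face_eq_zero` requires; the same device is used in the next three definitions.
  if hjk : j < k ∧ k < l.length then
    A.comp (-((l.drop (k + 1)).length : ℤ)) _ q
      (by simp only [List.length_drop, List.length_take]; omega)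
      (S.arrow l[k] (l.drop (k + 1)) b (h.right ⟨k, hjk.2⟩) _ rfl)
      (A.comp (-(((l.take k).drop (j + 1)).length : ℤ)) (-((l.take j).length : ℤ)) _ rfl
        (S.arrow (l[j]'(hjk.1.trans hjk.2)) ((l.take k).drop (j + 1)) l[k] (h.mid hjk.1 hjk.2) _
          rfl)
        (S.arrow a (l.take j) (l[j]'(hjk.1.trans hjk.2)) (h.left ⟨j, hjk.1.trans hjk.2⟩) _ rfl))
  else 0

/-- Cutting a sequence and omitting a later term. -/
def cutFace : A.Hom (S.obj a) (S.obj b) q :=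
  if hjk : j < k ∧ k < l.length then
    A.comp (-(((l.drop (j + 1)).eraseIdx (k - (j + 1))).length : ℤ)) (-((l.take j).length : ℤ)) q
      (by
        rw [List.length_eraseIdx_of_lt (by rw [List.length_drop]; omega)]
        simp only [List.length_drop, List.length_take]; omega)
      (S.arrow (l[j]'(hjk.1.trans hjk.2)) ((l.drop (j + 1)).eraseIdx (k - (j + 1))) b
        ((h.right ⟨j, hjk.1.trans hjk.2⟩).erase _) _ rfl)
      (S.arrow a (l.take j) (l[j]'(hjk.1.trans hjk.2)) (h.left ⟨j, hjk.1.trans hjk.2⟩) _ rfl)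
  else 0

/-- Cutting a sequence and omitting an earlier term. -/
def faceCut : A.Hom (S.obj a) (S.obj b) q :=
  if hjk : j < k ∧ k < l.length then
    A.comp (-((l.drop (k + 1)).length : ℤ)) (-(((l.take k).eraseIdx j).length : ℤ)) q
      (by
        rw [List.length_eraseIdx_of_lt (by rw [List.length_take]; omega)]
        simp only [List.length_drop, List.length_take]; omega)
      (S.arrow l[k] (l.drop (k + 1)) b (h.right ⟨k, hjk.2⟩) _ rfl)
      (S.arrow a ((l.take k).eraseIdx j) l[k] ((h.left ⟨k, hjk.2⟩).erase _) _ rfl)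
  else 0

/-- Omitting two terms of a sequence. -/
def faceFace : A.Hom (S.obj a) (S.obj b) q :=
  if hjk : j < k ∧ k < l.length then
    S.arrow a ((l.eraseIdx k).eraseIdx j) b ((h.erase k).erase j) q
      (by
        rw [List.length_eraseIdx_of_lt (by rw [List.length_eraseIdx_of_lt hjk.2]; omega),
          List.length_eraseIdx_of_lt hjk.2]
        omega)
  else 0

end

end PreSimplex

namespace DGCategory

variable {B : Type u} [CommRing B] (A : DGCategory B)

theorem negOnePow_smul_comp {x y z : A.Obj} {i j l : ℤ} (h : i + j = l) (e : ℤˣ)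
    (g : A.Hom y z i) (f : A.Hom x y j) :
    A.comp i j l h (e • g) f = e • A.comp i j l h g f := by
  rw [Units.smul_def, Units.smul_def, map_zsmul, LinearMap.smul_apply]

theorem comp_negOnePow_smul {x y z : A.Obj} {i j l : ℤ} (h : i + j = l) (e : ℤˣ)
    (g : A.Hom y z i) (f : A.Hom x y j) :
    A.comp i j l h g (e • f) = e • A.comp i j l h g f := by
  rw [Units.smul_def, Units.smul_def, map_zsmul]

theorem d_negOnePow_smul {x y : A.Obj} {i j : ℤ} (h : i + 1 = j) (e : ℤˣ) (f : A.Hom x y i) :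
    A.d i j h (e • f) = e • A.d i j h f := by
  rw [Units.smul_def, Units.smul_def, map_zsmul]

end DGCategory

namespace PreSimplex

variable {B : Type u} [CommRing B] {A : DGCategory B} {n : ℕ} (S : PreSimplex A n)
  {a : Fin (n + 1)} {l : List (Fin (n + 1))} {b : Fin (n + 1)} (h : IsMonotoneSeq a l b)
    (q : ℤ) (hq : -(l.length : ℤ) + 2 = q)

include hq in
-- After a cut at j, position k of the remaining right piece is position j + 1 + k of the original
-- sequence. Associativity turns the composite with a further cut into a symmetric double cut.
theorem comp_bdry_arrow (j : Fin l.length) (h₁ h₂) :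
    A.comp (-((l.drop (j + 1)).length : ℤ) + 1) (-((l.take j).length : ℤ)) q h₁
        (S.bdry l[j] (l.drop (j + 1)) b (h.right j) _ rfl)
        (S.arrow a (l.take j) l[j] (h.left j) _ h₂) =
      ∑ k ∈ Finset.range (l.length - 1 - j), ((l.length : ℤ) - 1 - (j + 1 + k)).negOnePow •
          (S.cutCut a l b h q hq j (j + 1 + k) - S.cutFace a l b h q hq j (j + 1 + k)) := by
  have hj := j.2
  have hlen : (l.drop (j + 1)).length = l.length - 1 - j := by simp; omega
  rw [bdry, map_sum, LinearMap.sum_apply, ← hlen, ← Fin.sum_univ_eq_sum_range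
    (fun k => ((l.length : ℤ) - 1 - (j + 1 + k)).negOnePow •
          (S.cutCut a l b h q hq j (j + 1 + k) - S.cutFace a l b h q hq j (j + 1 + k)))]
  refine Finset.sum_congr rfl fun k _ => ?_
  have hk := k.2
  have hjk : (j : ℕ) < j + 1 + k ∧ j + 1 + (k : ℕ) < l.length := by omega
  rw [A.negOnePow_smul_comp, map_sub, LinearMap.sub_apply, cutCut, cutFace, dif_pos hjk,
    dif_pos hjk]
  congr 1
  · congr 1
    omega
  · congr 1
    · rw [A.assoc _ _ _ _ _ _ _ rfl]
      · apply S.comp_comp_arrow_congr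
        · rfl
        · simp
        · rfl
        · simp [List.drop_take]
        · simp [Nat.add_comm, Nat.add_left_comm]
      · simp only [List.length_drop, List.length_take]; omega
    · apply S.comp_arrow_congr
      · rfl
      · rfl
      · simp

include hq in
theorem comp_arrow_bdry (j : Fin l.length) (h₁ h₂) :
    A.comp (-((l.drop (j + 1)).length : ℤ)) (-((l.take j).length : ℤ) + 1) q h₁
        (S.arrow l[j] (l.drop (j + 1)) b (h.right j) _ h₂)
        (S.bdry a (l.take j) l[j] (h.left j) _ rfl) =
      ∑ k ∈ Finset.range j, ((j : ℤ) - 1 - k).negOnePow •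
          (S.cutCut a l b h q hq k j - S.faceCut a l b h q hq k j) := by
  have hj := j.2
  have hlen : (l.take j).length = j := by simp
  rw [bdry, map_sum]
  conv_rhs => rw [← hlen]
  rw [← Fin.sum_univ_eq_sum_range (fun k => (((l.take j).length : ℤ) - 1 - k).negOnePow •
          (S.cutCut a l b h q hq k (l.take j).length - S.faceCut a l b h q hq k (l.take j).length))]
  refine Finset.sum_congr rfl fun k _ => ?_
  have hk := k.2
  have hjk : (k : ℕ) < (l.take j).length ∧ (l.take j).length < l.length := by omega
  rw [A.comp_negOnePow_smul, map_sub, cutCut, faceCut, dif_pos hjk, dif_pos hjk]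
  congr 2
  · apply S.comp_comp_arrow_congr
    · simp
    · simp
    · simp [List.take_take, (show (k : ℕ) ≤ j by omega)]
    · simp
    · simp
  · apply S.comp_arrow_congr <;> simp

include hq in
-- Once position j is deleted, position k of the new list is position k of the old one if k < j and
-- k + 1 otherwise; this decides whether the deletion comes after or before the other operation.
theorem bdry_eraseIdx (j : Fin l.length) (h₁) :
    S.bdry a (l.eraseIdx j) b (h.erase j) q h₁ =
      ∑ k ∈ Finset.range (l.length - 1), ((l.length : ℤ) - 2 - k).negOnePow •
          (if k < (j : ℕ) then S.cutFace a l b h q hq k j - S.faceFace a l b h q hq k j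
            else S.faceCut a l b h q hq j (k + 1) - S.faceFace a l b h q hq j (k + 1)) := by
  have hj := j.2
  have hlen : (l.eraseIdx j).length = l.length - 1 := by
    rw [List.length_eraseIdx_of_lt hj]
  rw [bdry, ← hlen, ← Fin.sum_univ_eq_sum_range (fun k => ((l.length : ℤ) - 2 - k).negOnePow •
          (if k < (j : ℕ) then S.cutFace a l b h q hq k j - S.faceFace a l b h q hq k j
            else S.faceCut a l b h q hq j (k + 1) - S.faceFace a l b h q hq j (k + 1)))]
  refine Finset.sum_congr rfl fun k _ => ?_
  have hk := k.2
  congr 1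
  · congr 1
    omega
  · split_ifs with hkj
    · rw [cutFace, faceFace, dif_pos ⟨hkj, hj⟩, dif_pos ⟨hkj, hj⟩]
      congr 1
      apply S.comp_arrow_congr
      · simp [List.getElem_eraseIdx, hkj]
      · refine List.ext_getElem? fun m => ?_
        grind
      · refine List.ext_getElem? fun m => ?_
        grind
    · have hjk : (j : ℕ) < k + 1 ∧ (k : ℕ) + 1 < l.length := by omega
      rw [faceCut, faceFace, dif_pos hjk, dif_pos hjk]
      congr 1
      · apply S.comp_arrow_congr
        · simp [List.getElem_eraseIdx, hkj]
        · refine List.ext_getElem? fun m => ?_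
          grind
        · refine List.ext_getElem? fun m => ?_
          grind
      · apply S.arrow_congr
        refine List.ext_getElem? fun m => ?_
        grind

/-- This is the Leibniz expansion of d of the right hand side, with each dα replaced by its
prescribed value. Double cuts, mixed terms and double deletions each occur twice with opposite
signs, so no coherence of `S` is needed. -/
theorem comp_bdry_sum_eq_zero :
    ∑ j : Fin l.length, ((l.length : ℤ) - 1 - (j : ℤ)).negOnePow •
      (A.comp (-((l.drop (j + 1)).length : ℤ) + 1) (-((l.take j).length : ℤ)) q
          (by have := j.2; rw [List.length_drop, List.length_take]; omega)
          (S.bdry l[j] (l.drop (j + 1)) b (h.right j) _ rfl)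
          (S.arrow a (l.take j) l[j] (h.left j) _ rfl) +
        (-((l.drop (j + 1)).length : ℤ)).negOnePow •
          A.comp (-((l.drop (j + 1)).length : ℤ)) (-((l.take j).length : ℤ) + 1) q
            (by have := j.2; rw [List.length_drop, List.length_take]; omega)
            (S.arrow l[j] (l.drop (j + 1)) b (h.right j) _ rfl)
            (S.bdry a (l.take j) l[j] (h.left j) _ rfl) -
        S.bdry a (l.eraseIdx j) b (h.erase j) q
          (by have := j.2; rw [List.length_eraseIdx_of_lt this]; omega)) = 0 := by
  rw [← sum_cut_face_eq_zero l.length (S.cutCut a l b h q hq) (S.cutFace a l b h q hq)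
    (S.faceCut a l b h q hq) (S.faceFace a l b h q hq), ← Fin.sum_univ_eq_sum_range (fun j => 
    ((l.length : ℤ) - 1 - j).negOnePow •
      ((∑ k ∈ Finset.range (l.length - 1 - j), ((l.length : ℤ) - 1 - (j + 1 + k)).negOnePow •
          (S.cutCut a l b h q hq j (j + 1 + k) - S.cutFace a l b h q hq j (j + 1 + k))) +
        ((l.length : ℤ) - 1 - j).negOnePow •
          (∑ k ∈ Finset.range j, ((j : ℤ) - 1 - k).negOnePow •
            (S.cutCut a l b h q hq k j - S.faceCut a l b h q hq k j)) -
        ∑ k ∈ Finset.range (l.length - 1), ((l.length : ℤ) - 2 - k).negOnePow •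
          (if k < j then S.cutFace a l b h q hq k j - S.faceFace a l b h q hq k j
            else S.faceCut a l b h q hq j (k + 1) - S.faceFace a l b h q hq j (k + 1))))]
  refine Finset.sum_congr rfl fun j _ => ?_
  rw [S.comp_bdry_arrow h q hq, S.comp_arrow_bdry h q hq, S.bdry_eraseIdx h q hq]
  congr 4
  rw [Int.negOnePow_eq_iff]
  refine ⟨-((l.drop (j + 1)).length : ℤ), ?_⟩
  have := j.2
  rw [List.length_drop]
  omega

/-- The differential of the right hand side of a coherence equation, in terms of the failure of
the coherence equations of the shorter sequences. -/
theorem d_bdry {q₀ : ℤ} (hq₀ : -(l.length : ℤ) + 1 = q₀) (hq' : q₀ + 1 = q) :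
    A.d q₀ q hq' (S.bdry a l b h q₀ hq₀) =
    ∑ j : Fin l.length, ((l.length : ℤ) - 1 - (j : ℤ)).negOnePow •
      (A.comp (-((l.drop (j + 1)).length : ℤ) + 1) (-((l.take j).length : ℤ)) q
          (by have := j.2; rw [List.length_drop, List.length_take]; omega)
          (A.d _ _ rfl (S.arrow l[j] (l.drop (j + 1)) b (h.right j) _ rfl) -
            S.bdry l[j] (l.drop (j + 1)) b (h.right j) _ rfl)
          (S.arrow a (l.take j) l[j] (h.left j) _ rfl) +
        (-((l.drop (j + 1)).length : ℤ)).negOnePow •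
          A.comp (-((l.drop (j + 1)).length : ℤ)) (-((l.take j).length : ℤ) + 1) q
            (by have := j.2; rw [List.length_drop, List.length_take]; omega)
            (S.arrow l[j] (l.drop (j + 1)) b (h.right j) _ rfl)
            (A.d _ _ rfl (S.arrow a (l.take j) l[j] (h.left j) _ rfl) -
              S.bdry a (l.take j) l[j] (h.left j) _ rfl) -
        (A.d _ _ hq' (S.arrow a (l.eraseIdx j) b (h.erase j) q₀
            (by have := j.2; rw [List.length_eraseIdx_of_lt this]; omega)) -
          S.bdry a (l.eraseIdx j) b (h.erase j) q
            (by have := j.2; rw [List.length_eraseIdx_of_lt this]; omega))) := by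
  -- Subtracting a sum that vanishes identically replaces each dα of the Leibniz expansion by its
  -- defect dα - bdry.
  have key := S.comp_bdry_sum_eq_zero h q (by omega)
  rw [← sub_eq_zero, ← key, bdry, map_sum, sub_eq_iff_eq_add,
    ← Finset.sum_add_distrib]
  refine Finset.sum_congr rfl fun j _ => ?_
  have h₁ : -((l.drop (j + 1)).length : ℤ) + 1 + -((l.take j).length : ℤ) = q := by
    have := j.2; rw [List.length_drop, List.length_take]; omega
  have h₂ : -((l.drop (j + 1)).length : ℤ) + (-((l.take j).length : ℤ) + 1) = q := by
    have := j.2; rw [List.length_drop, List.length_take]; omega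
  rw [A.d_negOnePow_smul, ← smul_add, map_sub (A.d q₀ q hq'),
    A.leibniz _ _ _ _ _ _ rfl rfl hq' _ h₁ h₂,
    map_sub, map_sub,
    LinearMap.sub_apply, smul_sub (-((l.drop (j + 1)).length : ℤ)).negOnePow]
  congr 1
  abel

end PreSimplex

/-! ### Cuts and faces of index sequences, and degenerate sequences -/

section Sequences

variable {n : ℕ} {a a' b b' : Fin (n + 1)} {l l' : List (Fin (n + 1))}

theorem length_fullSeq : (fullSeq a l b).length = l.length + 2 := by
  simp [fullSeq]

theorem fullSeq_inj : fullSeq a l b = fullSeq a' l' b' ↔ a = a' ∧ l = l' ∧ b = b' := by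
  refine ⟨fun h => ?_, by rintro ⟨rfl, rfl, rfl⟩; rfl⟩
  simp only [fullSeq, List.cons.injEq] at h
  have := List.append_inj' h.2 (by simp)
  exact ⟨h.1, by simpa using this⟩

theorem getElem_fullSeq_succ {j : ℕ} (hj : j < l.length) :
    (fullSeq a l b)[j + 1]'(by rw [length_fullSeq]; omega) = l[j] := by
  simp [fullSeq, hj]

theorem fullSeq_left (j : Fin l.length) :
    fullSeq a (l.take j) l[j] = (fullSeq a l b).take (j + 2) := by
  refine List.ext_getElem? fun m => ?_
  have := j.2
  simp only [fullSeq, List.getElem?_cons, List.getElem?_append, List.getElem?_take,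
    List.length_take]
  grind

theorem fullSeq_right (j : Fin l.length) :
    fullSeq l[j] (l.drop (j + 1)) b = (fullSeq a l b).drop (j + 1) := by
  rw [fullSeq_split j]
  have := j.2
  simp [fullSeq]

theorem fullSeq_eraseIdx (j : Fin l.length) :
    fullSeq a (l.eraseIdx j) b = (fullSeq a l b).eraseIdx (j + 1) := by
  have := j.2
  simp [fullSeq, List.eraseIdx_append_of_lt_length]

theorem isDegenerateSeq_iff :
    IsDegenerateSeq a l b ↔ ∃ (t : ℕ) (ht : t ≤ l.length),
      (fullSeq a l b)[t]'(by rw [length_fullSeq]; omega) =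
        (fullSeq a l b)[t + 1]'(by rw [length_fullSeq]; omega) := by
  rw [IsDegenerateSeq, List.isChain_iff_getElem]
  push Not
  refine exists_congr fun t => ?_
  constructor
  · rintro ⟨h, h'⟩
    rw [length_fullSeq] at h
    exact ⟨by omega, h'⟩
  · rintro ⟨h, h'⟩
    exact ⟨by rw [length_fullSeq]; omega, h'⟩

end Sequences

namespace PreSimplex

variable {B : Type u} [CommRing B] {A : DGCategory B} {n : ℕ} (S : PreSimplex A n)

theorem comp_arrow_left_congr {a c : Fin (n + 1)} {z : A.Obj} {l l' : List (Fin (n + 1))}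
    (hl : l = l') {p p' r q : ℤ} {h : IsMonotoneSeq a l c} {h' : IsMonotoneSeq a l' c}
    {e : p = -(l.length : ℤ)} {e' : p' = -(l'.length : ℤ)} {hq : r + p = q} {hq' : r + p' = q}
    (g : A.Hom (S.obj c) z r) :
    A.comp r p q hq g (S.arrow a l c h p e) = A.comp r p' q hq' g (S.arrow a l' c h' p' e') := by
  subst hl e e'; rfl

theorem comp_arrow_right_congr {c b : Fin (n + 1)} {z : A.Obj} {l l' : List (Fin (n + 1))}
    (hl : l = l') {p p' r q : ℤ} {h : IsMonotoneSeq c l b} {h' : IsMonotoneSeq c l' b}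
    {e : p = -(l.length : ℤ)} {e' : p' = -(l'.length : ℤ)} {hq : p + r = q} {hq' : p' + r = q}
    (g : A.Hom z (S.obj c) r) :
    A.comp p r q hq (S.arrow c l b h p e) g = A.comp p' r q hq' (S.arrow c l' b h' p' e') g := by
  subst hl e e'; rfl

theorem comp_arrow_id
    (hu : ∀ a, S.arrow a [] a (isMonotoneSeq_pair le_rfl) 0 (by simp) = A.id (S.obj a))
    {a b c : Fin (n + 1)} {l₁ l₂ l₃ : List (Fin (n + 1))} (hac : a = c) (hl₁ : l₁ = [])
    (hl : l₂ = l₃) {p₁ p₂ q : ℤ} {h₁ : IsMonotoneSeq a l₁ c} {h₂ : IsMonotoneSeq c l₂ b}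
    {h₃ : IsMonotoneSeq a l₃ b} {e₁ : p₁ = -(l₁.length : ℤ)} {e₂ : p₂ = -(l₂.length : ℤ)}
    {e₃ : q = -(l₃.length : ℤ)} {e : p₂ + p₁ = q} :
    A.comp p₂ p₁ q e (S.arrow c l₂ b h₂ p₂ e₂) (S.arrow a l₁ c h₁ p₁ e₁) =
      S.arrow a l₃ b h₃ q e₃ := by
  subst hac hl₁ hl e₂ e₃
  obtain rfl : p₁ = 0 := by simpa using e₁
  rw [hu, A.comp_id]

theorem id_comp_arrow
    (hu : ∀ a, S.arrow a [] a (isMonotoneSeq_pair le_rfl) 0 (by simp) = A.id (S.obj a))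
    {a b c : Fin (n + 1)} {l₁ l₂ l₃ : List (Fin (n + 1))} (hcb : c = b) (hl₂ : l₂ = [])
    (hl : l₁ = l₃) {p₁ p₂ q : ℤ} {h₁ : IsMonotoneSeq a l₁ c} {h₂ : IsMonotoneSeq c l₂ b}
    {h₃ : IsMonotoneSeq a l₃ b} {e₁ : p₁ = -(l₁.length : ℤ)} {e₂ : p₂ = -(l₂.length : ℤ)}
    {e₃ : q = -(l₃.length : ℤ)} {e : p₂ + p₁ = q} :
    A.comp p₂ p₁ q e (S.arrow c l₂ b h₂ p₂ e₂) (S.arrow a l₁ c h₁ p₁ e₁) =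
      S.arrow a l₃ b h₃ q e₃ := by
  subst hcb hl₂ hl e₁ e₃
  obtain rfl : p₂ = 0 := by simpa using e₂
  rw [hu, A.id_comp]

/-- Let the entries t and t + 1 of the full sequence coincide. Every piece that still contains both
vanishes, so only the terms at these two entries matter. For an interior repetition their composites
vanish too, and their faces are equal with consecutive, hence opposite, signs. For a repetition at
an end, one factor of the remaining composite is a unit, and the composite cancels the face. -/
theorem bdry_eq_zero_of_isDegenerateSeq
    (hu : ∀ a, S.arrow a [] a (isMonotoneSeq_pair le_rfl) 0 (by simp) = A.id (S.obj a))
    (hd : ∀ a l b (h : IsMonotoneSeq a l b) (p : ℤ) (hp : p = -(l.length : ℤ)),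
      l ≠ [] → IsDegenerateSeq a l b → S.arrow a l b h p hp = 0)
    {a : Fin (n + 1)} {l : List (Fin (n + 1))} {b : Fin (n + 1)} (h : IsMonotoneSeq a l b)
    (q : ℤ) (hq : -(l.length : ℤ) + 1 = q) (hdeg : IsDegenerateSeq a l b) :
    S.bdry a l b h q hq = 0 := by
  obtain ⟨t, ht, htt⟩ := isDegenerateSeq_iff.1 hdeg
  -- The condition j + 1 < `l.length` keeps the piece from being a bare pair (i,i), whose arrow is a
  -- unit and not zero. The nonvanishing of j plays this role for left pieces.
  have right : ∀ (j : Fin l.length) p hp, t ≥ j + 1 → (j : ℕ) + 1 < l.length →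
      S.arrow l[j] (l.drop (j + 1)) b (h.right j) p hp = 0 := by
    intro j p hp hj hj'
    refine hd _ _ _ _ _ _ (by simpa using hj') (isDegenerateSeq_iff.2 ⟨t - (j + 1), ?_, ?_⟩)
    · rw [List.length_drop]; omega
    · simp only [fullSeq_right (a := a), List.getElem_drop]
      grind
  have left : ∀ (j : Fin l.length) p hp, t ≤ j → (j : ℕ) ≠ 0 →
      S.arrow a (l.take j) l[j] (h.left j) p hp = 0 := by
    intro j p hp hj hj'
    refine hd _ _ _ _ _ _ ?_ (isDegenerateSeq_iff.2 ⟨t, ?_, ?_⟩)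
    · have := j.2
      rw [← List.length_pos_iff, List.length_take]; omega
    · have := j.2
      rw [List.length_take]; omega
    · simp only [fullSeq_left (b := b), List.getElem_take]
      exact htt
  have face : ∀ (j : Fin l.length) p hp, (j : ℕ) + 1 ≠ t → (j : ℕ) ≠ t →
      S.arrow a (l.eraseIdx j) b (h.erase j) p hp = 0 := by
    intro j p hp hj hj'
    have := j.2
    have hlen := List.length_eraseIdx_of_lt this
    refine hd _ _ _ _ _ _ ?_ (isDegenerateSeq_iff.2 ?_)
    · rw [← List.length_pos_iff, hlen]; omega
    · by_cases hjt : (j : ℕ) + 1 < t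
      · refine ⟨t - 1, by omega, ?_⟩
        simp only [fullSeq_eraseIdx]
        grind
      · refine ⟨t, by omega, ?_⟩
        simp only [fullSeq_eraseIdx]
        grind
  rw [bdry]
  rcases Nat.eq_zero_or_pos t with rfl | ht₀
  · refine Finset.sum_eq_zero fun j _ => ?_
    have hj := j.2
    by_cases hj₀ : (j : ℕ) = 0
    · have : a = l[0] := by
        simpa [fullSeq, List.getElem_append, (by omega : 0 < l.length)] using htt
      rw [S.comp_arrow_id hu (l₃ := l.eraseIdx j) (h₃ := h.erase j)
        (e₃ := by rw [List.length_eraseIdx_of_lt hj]; omega), sub_self, smul_zero]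
      · simpa [hj₀] using this
      · simp [hj₀]
      · simp [hj₀]
    · rw [left j _ _ (by omega) hj₀, face j _ _ (by omega) hj₀, map_zero, sub_zero, smul_zero]
  rcases eq_or_lt_of_le ht with rfl | ht₁
  · refine Finset.sum_eq_zero fun j _ => ?_
    have hj := j.2
    by_cases hj₀ : (j : ℕ) + 1 = l.length
    · have : l[j] = b := by
        simp only [← hj₀, getElem_fullSeq_succ hj] at htt
        simpa [fullSeq, hj₀] using htt
      rw [S.id_comp_arrow hu (l₃ := l.eraseIdx j) (h₃ := h.erase j)
        (e₃ := by rw [List.length_eraseIdx_of_lt hj]; omega), sub_self, smul_zero]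
      · exact this
      · simp [hj₀]
      · refine List.ext_getElem? fun m => ?_
        grind
    · rw [right j _ _ (by omega) (by omega), face j _ _ (by omega) (by omega), map_zero,
        LinearMap.zero_apply, sub_zero, smul_zero]
  · rw [Fintype.sum_eq_add (⟨t - 1, by omega⟩ : Fin l.length) ⟨t, ht₁⟩
      (by simp only [ne_eq, Fin.mk.injEq]; omega)]
    · rw [right ⟨t - 1, by omega⟩ _ _ (by simp only; omega) (by simp only; omega),
        left ⟨t, by omega⟩ _ _ le_rfl (by simp only; omega), map_zero, LinearMap.zero_apply,
        map_zero, zero_sub, zero_sub]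
      have hface : l.eraseIdx (t - 1) = l.eraseIdx t := by
        refine List.ext_getElem? fun m => ?_
        obtain ⟨t, rfl⟩ : ∃ t', t = t' + 1 := ⟨t - 1, by omega⟩
        rw [getElem_fullSeq_succ (by omega), getElem_fullSeq_succ ht₁] at htt
        grind
      have hsign : ((l.length : ℤ) - 1 - ((t - 1 : ℕ) : ℤ)).negOnePow =
          -((l.length : ℤ) - 1 - (t : ℤ)).negOnePow := by
        rw [← Int.negOnePow_succ]
        congr 1
        omega
      rw [S.arrow_congr hface _ (h.erase t) _ _
        (by rw [List.length_eraseIdx_of_lt ht₁]; omega), hsign, Units.neg_smul, neg_add_cancel]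
    · rintro j ⟨hj₁, hj₂⟩
      have hj₁ : (j : ℕ) + 1 ≠ t := fun e => hj₁ (Fin.ext (by simp only; omega))
      have hj₂ : (j : ℕ) ≠ t := fun e => hj₂ (Fin.ext e)
      have hj := j.2
      rw [face j _ _ hj₁ hj₂, sub_zero]
      rcases lt_or_gt_of_ne hj₂ with h' | h'
      · rw [right j _ _ (by omega) (by omega), map_zero, LinearMap.zero_apply, smul_zero]
      · rw [left j _ _ (by omega) (by omega), map_zero, smul_zero]

end PreSimplex

/-! ### Homotopies and two-out-of-three for equivalences -/

namespace DGCategory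

variable {B : Type u} [CommRing B] (A : DGCategory B)

/-- Two morphisms of degree `0` are homotopic if their difference is a boundary. -/
def Homotopic {x y : A.Obj} (f g : A.Hom x y 0) : Prop :=
  ∃ h : A.Hom x y (-1), f = g + A.d (-1) 0 (by norm_num) h

variable {A}

theorem d_id (x : A.Obj) : A.d 0 1 (zero_add 1) (A.id x) = 0 := by
  have h := A.leibniz 0 1 0 1 0 1 (zero_add 1) (zero_add 1) (zero_add 1) (add_zero 0) (add_zero 1)
    (zero_add 1) (A.id x) (A.id x)
  rw [A.comp_id, A.comp_id, A.id_comp] at h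
  simpa using h

theorem d_comp_eq_zero {x y z : A.Obj} {g : A.Hom y z 0} {f : A.Hom x y 0}
    (hg : A.d 0 1 (zero_add 1) g = 0) (hf : A.d 0 1 (zero_add 1) f = 0) :
    A.d 0 1 (zero_add 1) (A.comp 0 0 0 (add_zero 0) g f) = 0 := by
  rw [A.leibniz 0 1 0 1 0 1 (zero_add 1) (zero_add 1) (zero_add 1) (add_zero 0) (add_zero 1)
    (zero_add 1), hg, hf]
  simp

namespace Homotopic

variable {x y z : A.Obj}

theorem symm {f g : A.Hom x y 0} : A.Homotopic f g → A.Homotopic g f := by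
  rintro ⟨h, rfl⟩
  exact ⟨-h, by simp⟩

theorem trans {f g h : A.Hom x y 0} : A.Homotopic f g → A.Homotopic g h → A.Homotopic f h := by
  rintro ⟨a, rfl⟩ ⟨b, rfl⟩
  exact ⟨b + a, by rw [map_add, add_assoc]⟩

theorem comp_left {f f' : A.Hom x y 0} {g : A.Hom y z 0} (hg : A.d 0 1 (zero_add 1) g = 0) :
    A.Homotopic f f' →
      A.Homotopic (A.comp 0 0 0 (add_zero 0) g f) (A.comp 0 0 0 (add_zero 0) g f') := by
  rintro ⟨h, rfl⟩
  refine ⟨A.comp 0 (-1) (-1) (by norm_num) g h, ?_⟩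
  rw [A.leibniz 0 1 (-1) 0 (-1) 0 (zero_add 1) (by norm_num) (by norm_num) _ (by norm_num)
    (add_zero 0), hg]
  simp

theorem comp_right {g g' : A.Hom y z 0} {f : A.Hom x y 0} (hf : A.d 0 1 (zero_add 1) f = 0) :
    A.Homotopic g g' →
      A.Homotopic (A.comp 0 0 0 (add_zero 0) g f) (A.comp 0 0 0 (add_zero 0) g' f) := by
  rintro ⟨h, rfl⟩
  refine ⟨A.comp (-1) 0 (-1) (by norm_num) h f, ?_⟩
  rw [A.leibniz (-1) 0 0 1 (-1) 0 (by norm_num) (zero_add 1) (by norm_num) _ (add_zero 0)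
    (by norm_num), hf]
  simp

end Homotopic

/-- If c inverts h ~ gf up to homotopy, then f c inverts g. In the two companion statements, c g
inverts f and a b inverts h, where a and b are inverses of f and g. -/
theorem IsEquivalence.of_comp_right {x y z : A.Obj} {g : A.Hom y z 0} {f : A.Hom x y 0}
    {h : A.Hom x z 0} (hh : A.Homotopic (A.comp 0 0 0 (add_zero 0) g f) h)
    (hf : A.IsEquivalence f) (hh' : A.IsEquivalence h) (hg : A.d 0 1 (zero_add 1) g = 0) :
    A.IsEquivalence g := by
  obtain ⟨f₀, a, ha, hfa, haf⟩ := hf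
  obtain ⟨h₀, c, hc, hhc, hch⟩ := hh'
  refine ⟨hg, A.comp 0 0 0 (add_zero 0) f c, d_comp_eq_zero f₀ hc, ?_, ?_⟩
  · refine Homotopic.trans ?_ hhc
    rw [← A.assoc 0 0 0 0 0 0 (add_zero 0) (add_zero 0) (add_zero 0) (add_zero 0)]
    exact hh.comp_right hc
  · change A.Homotopic _ _
    -- For the side (f c) g ~ 1, the factor f a ~ 1 is inserted on the right: (f c) g ~ (f c) g f a
    -- ~ f a ~ 1, because c (g f) ~ c h ~ 1.
    have key : A.Homotopic (A.comp 0 0 0 (add_zero 0) (A.comp 0 0 0 (add_zero 0)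
        (A.comp 0 0 0 (add_zero 0) (A.comp 0 0 0 (add_zero 0) f c) g) f) a)
        (A.comp 0 0 0 (add_zero 0) f a) := by
      refine Homotopic.comp_right ha ?_
      rw [A.assoc 0 0 0 0 0 0 (add_zero 0) (add_zero 0) (add_zero 0) (add_zero 0),
        A.assoc 0 0 0 0 0 0 (add_zero 0) (add_zero 0) (add_zero 0) (add_zero 0)]
      conv_rhs => rw [← A.comp_id 0 f]
      refine Homotopic.comp_left f₀ ?_
      exact (hh.comp_left hc).trans hch
    refine Homotopic.trans ?_ (key.trans hfa)
    rw [A.assoc 0 0 0 0 0 0 (add_zero 0) (add_zero 0) (add_zero 0) (add_zero 0) _ f a]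
    conv_lhs => rw [← A.comp_id 0 (A.comp 0 0 0 _ (A.comp 0 0 0 _ f c) g)]
    exact (Homotopic.symm hfa).comp_left (d_comp_eq_zero (d_comp_eq_zero f₀ hc) hg)

theorem IsEquivalence.of_comp_left {x y z : A.Obj} {g : A.Hom y z 0} {f : A.Hom x y 0}
    {h : A.Hom x z 0} (hh : A.Homotopic (A.comp 0 0 0 (add_zero 0) g f) h)
    (hg : A.IsEquivalence g) (hh' : A.IsEquivalence h) (hf : A.d 0 1 (zero_add 1) f = 0) :
    A.IsEquivalence f := by
  obtain ⟨g₀, b, hb, hgb, hbg⟩ := hg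
  obtain ⟨h₀, c, hc, hhc, hch⟩ := hh'
  refine ⟨hf, A.comp 0 0 0 (add_zero 0) c g, d_comp_eq_zero hc g₀, ?_, ?_⟩
  · change A.Homotopic _ _
    have key : A.Homotopic (A.comp 0 0 0 (add_zero 0) b (A.comp 0 0 0 (add_zero 0) g
        (A.comp 0 0 0 (add_zero 0) f (A.comp 0 0 0 (add_zero 0) c g))))
        (A.comp 0 0 0 (add_zero 0) b g) := by
      refine Homotopic.comp_left hb ?_
      rw [← A.assoc 0 0 0 0 0 0 (add_zero 0) (add_zero 0) (add_zero 0) (add_zero 0),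
        ← A.assoc 0 0 0 0 0 0 (add_zero 0) (add_zero 0) (add_zero 0) (add_zero 0)]
      conv_rhs => rw [← A.id_comp 0 g]
      refine Homotopic.comp_right g₀ ?_
      exact (hh.comp_right hc).trans hhc
    refine Homotopic.trans ?_ (key.trans hbg)
    rw [← A.assoc 0 0 0 0 0 0 (add_zero 0) (add_zero 0) (add_zero 0) (add_zero 0) b g]
    conv_lhs => rw [← A.id_comp 0 (A.comp 0 0 0 _ f (A.comp 0 0 0 _ c g))]
    exact (Homotopic.symm hbg).comp_right (d_comp_eq_zero hf (d_comp_eq_zero hc g₀))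
  · refine Homotopic.trans ?_ hch
    rw [A.assoc 0 0 0 0 0 0 (add_zero 0) (add_zero 0) (add_zero 0) (add_zero 0)]
    exact hh.comp_left hc

theorem IsEquivalence.comp {x y z : A.Obj} {g : A.Hom y z 0} {f : A.Hom x y 0}
    {h : A.Hom x z 0} (hh : A.Homotopic (A.comp 0 0 0 (add_zero 0) g f) h)
    (hg : A.IsEquivalence g) (hf : A.IsEquivalence f) (hh' : A.d 0 1 (zero_add 1) h = 0) :
    A.IsEquivalence h := by
  obtain ⟨g₀, b, hb, hgb, hbg⟩ := hg
  obtain ⟨f₀, a, ha, hfa, haf⟩ := hf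
  refine ⟨hh', A.comp 0 0 0 (add_zero 0) a b, d_comp_eq_zero ha hb, ?_, ?_⟩
  · refine Homotopic.trans (hh.symm.comp_right (d_comp_eq_zero ha hb)) (Homotopic.trans ?_ hgb)
    rw [A.assoc 0 0 0 0 0 0 (add_zero 0) (add_zero 0) (add_zero 0) (add_zero 0)]
    refine Homotopic.comp_left g₀ ?_
    rw [← A.assoc 0 0 0 0 0 0 (add_zero 0) (add_zero 0) (add_zero 0) (add_zero 0)]
    conv_rhs => rw [← A.id_comp 0 b]
    exact Homotopic.comp_right hb hfa
  · refine Homotopic.trans (hh.symm.comp_left (d_comp_eq_zero ha hb)) (Homotopic.trans ?_ haf)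
    rw [A.assoc 0 0 0 0 0 0 (add_zero 0) (add_zero 0) (add_zero 0) (add_zero 0)]
    refine Homotopic.comp_left ha ?_
    rw [← A.assoc 0 0 0 0 0 0 (add_zero 0) (add_zero 0) (add_zero 0) (add_zero 0)]
    conv_rhs => rw [← A.id_comp 0 f]
    exact Homotopic.comp_right f₀ hbg

/-! ### Contractible cones of composition with an equivalence -/

variable (A) in
/-- The mapping cone of the morphism of complexes `U` is contractible, in the form in which it is
used to solve equations: cocycles of the cone are boundaries, linearly. -/
structure IsContractibleCone {x y x' y' : A.Obj}
    (U : ∀ i : ℤ, A.Hom x y i →ₗ[B] A.Hom x' y' i) : Prop where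
  d_apply : ∀ (i j : ℤ) (h : i + 1 = j) (β : A.Hom x y i), A.d i j h (U i β) = U j (A.d i j h β)
  -- The sign of U alternates in the cone: (x,y) ↦ (dx, dy - Ux) is followed by (z₁,z₂) ↦ (dz₁, dz₂
  -- + Uz₁). Linearity of the contraction is what later survives base change.
  exists_contraction : ∀ (p q r s : ℤ) (hpq : p + 1 = q) (hqr : q + 1 = r) (hrs : r + 1 = s),
    ∃ c : (A.Hom x y r × A.Hom x' y' q) →ₗ[B] (A.Hom x y q × A.Hom x' y' p),
      ∀ z : A.Hom x y r × A.Hom x' y' q, A.d r s hrs z.1 = 0 → A.d q r hqr z.2 + U r z.1 = 0 →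
        A.d q r hqr (c z).1 = z.1 ∧ A.d p q hpq (c z).2 - U q (c z).1 = z.2

/-- Multiplying the first component by ε carries the cone of εU to that of U, since ε² = 1; the
contraction is conjugated accordingly. -/
theorem IsContractibleCone.units_smul {x y x' y' : A.Obj}
    {U : ∀ i : ℤ, A.Hom x y i →ₗ[B] A.Hom x' y' i} (hU : A.IsContractibleCone U) (ε : ℤˣ) :
    A.IsContractibleCone (fun i => (ε : ℤ) • U i) where
  d_apply i j h β := by
    rw [LinearMap.smul_apply, LinearMap.smul_apply, map_zsmul, hU.d_apply]
  exists_contraction p q r s hpq hqr hrs := by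
    obtain ⟨c, hc⟩ := hU.exists_contraction p q r s hpq hqr hrs
    have hε : (ε : ℤ) * ε = 1 := by rw [← Units.val_mul, Int.units_mul_self]; rfl
    let T : ∀ a b : ℤ, (A.Hom x y a × A.Hom x' y' b) →ₗ[B] (A.Hom x y a × A.Hom x' y' b) :=
      fun a b => ((ε : ℤ) • LinearMap.id).prodMap LinearMap.id
    refine ⟨T q p ∘ₗ c ∘ₗ T r q, fun z h₁ h₂ => ?_⟩
    obtain ⟨e₁, e₂⟩ := hc (T r q z)
      (by simp only [T, LinearMap.prodMap_apply, LinearMap.smul_apply, map_zsmul,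
            LinearMap.id_apply, h₁, smul_zero])
      (by simpa only [T, LinearMap.prodMap_apply, LinearMap.smul_apply, map_zsmul,
            LinearMap.id_apply] using h₂)
    refine ⟨?_, ?_⟩
    · change A.d q r hqr ((ε : ℤ) • (c (T r q z)).1) = z.1
      rw [map_zsmul, e₁]
      change (ε : ℤ) • (ε : ℤ) • z.1 = z.1
      rw [smul_smul, hε, one_smul]
    · change A.d p q hpq (c (T r q z)).2 - (ε : ℤ) • U q ((ε : ℤ) • (c (T r q z)).1) = z.2
      rw [map_zsmul, smul_smul, hε, one_smul, e₂]
      rfl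

theorem isContractibleCone_id (x y : A.Obj) :
    A.IsContractibleCone (fun i => (LinearMap.id : A.Hom x y i →ₗ[B] A.Hom x y i)) where
  d_apply _ _ _ _ := rfl
  exists_contraction p q r s hpq hqr hrs := by
    refine ⟨LinearMap.prod (-LinearMap.snd B _ _) 0, fun z h₁ h₂ => ?_⟩
    simp only [LinearMap.prod_apply, Function.prod, LinearMap.neg_apply, LinearMap.snd_apply,
      LinearMap.zero_apply, map_zero, map_neg, LinearMap.id_apply] at h₂ ⊢
    exact ⟨neg_eq_of_add_eq_zero_right h₂, by simp⟩

/-- The naive contraction (z₁,z₂) ↦ (-Vz₂ - Hz₁, -Gz₂) is wrong in the second component by Wz₁, with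
W = GU - UH, as no triangle identity relates H and G. If z₁ is closed then d(GUz₁) and d(UHz₁) are
both UVUz₁ - Uz₁, so Wz₁ is closed. The extra terms -VWz₁ and -GWz₁ then remove the error. -/
theorem isContractibleCone_of_homotopy {x y x' y' : A.Obj}
    (U : ∀ i : ℤ, A.Hom x y i →ₗ[B] A.Hom x' y' i) (V : ∀ i : ℤ, A.Hom x' y' i →ₗ[B] A.Hom x y i)
    (H : ∀ i j : ℤ, j + 1 = i → (A.Hom x y i →ₗ[B] A.Hom x y j))
    (G : ∀ i j : ℤ, j + 1 = i → (A.Hom x' y' i →ₗ[B] A.Hom x' y' j))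
    (hU : ∀ (i j : ℤ) (h : i + 1 = j) β, A.d i j h (U i β) = U j (A.d i j h β))
    (hV : ∀ (i j : ℤ) (h : i + 1 = j) β, A.d i j h (V i β) = V j (A.d i j h β))
    (hVU : ∀ (i j k : ℤ) (h : i + 1 = j) (h' : j + 1 = k) β,
      V j (U j β) = β + A.d i j h (H j i h β) + H k j h' (A.d j k h' β))
    (hUV : ∀ (i j k : ℤ) (h : i + 1 = j) (h' : j + 1 = k) β,
      U j (V j β) = β + A.d i j h (G j i h β) + G k j h' (A.d j k h' β)) :
    A.IsContractibleCone U where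
  d_apply := hU
  exists_contraction p q r s hpq hqr hrs := by
    let W : A.Hom x y r →ₗ[B] A.Hom x' y' q := G r q hqr ∘ₗ U r - U q ∘ₗ H r q hqr
    refine ⟨LinearMap.prod
      (-(V q ∘ₗ LinearMap.snd B _ _) - H r q hqr ∘ₗ LinearMap.fst B _ _ -
        V q ∘ₗ W ∘ₗ LinearMap.fst B _ _)
      (-(G q p hpq ∘ₗ LinearMap.snd B _ _) - G q p hpq ∘ₗ W ∘ₗ LinearMap.fst B _ _), ?_⟩
    rintro ⟨z₁, z₂⟩ h₁ h₂
    simp only at h₁ h₂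
    have hd : A.d q r hqr z₂ = - U r z₁ := eq_neg_of_add_eq_zero_left h₂
    have eVU := hVU q r s hqr hrs z₁
    have eUV := hUV q r s hqr hrs (U r z₁)
    have hW : A.d q r hqr (W z₁) = 0 := by
      rw [h₁, map_zero, add_zero] at eVU
      rw [hU, h₁, map_zero, map_zero, add_zero, eVU, map_add] at eUV
      simp only [W, LinearMap.sub_apply, LinearMap.comp_apply, map_sub, hU]
      rw [← add_left_cancel eUV, sub_self]
    rw [h₁, map_zero, add_zero] at eVU
    have eUV₂ := hUV p q r hpq hqr z₂
    have eUVW := hUV p q r hpq hqr (W z₁)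
    rw [hW, map_zero, add_zero] at eUVW
    simp only [LinearMap.prod_apply, Function.prod, LinearMap.sub_apply, LinearMap.neg_apply,
      LinearMap.comp_apply, LinearMap.snd_apply, LinearMap.fst_apply, map_sub, map_neg]
    refine ⟨?_, ?_⟩
    · rw [hV, hV, hW, map_zero, hd, map_neg, eVU]
      abel
    · rw [eUV₂, eUVW, hd, map_neg]
      simp only [W, LinearMap.sub_apply, LinearMap.comp_apply, map_sub]
      abel

/-- Precomposition with a morphism of degree `0`. -/
def precomp {x y : A.Obj} (f : A.Hom x y 0) (z : A.Obj) (i : ℤ) :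
    A.Hom y z i →ₗ[B] A.Hom x z i :=
  (A.comp i 0 i (add_zero i)).flip f

/-- Postcomposition with a morphism of degree `0`. -/
def postcomp {y z : A.Obj} (f : A.Hom y z 0) (x : A.Obj) (i : ℤ) :
    A.Hom x y i →ₗ[B] A.Hom x z i :=
  A.comp 0 i i (zero_add i) f

/-- Precomposition with a homotopy inverse of f is the inverse map, and right multiplication by h
and g gives the homotopies. The sign (-1)^i compensates for the Leibniz sign when d passes an
element of degree i; left multiplication, used for postcomposition, needs none. -/
theorem isContractibleCone_precomp {x y : A.Obj} {f : A.Hom x y 0} (hf : A.IsEquivalence f)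
    (z : A.Obj) : A.IsContractibleCone (precomp f z) := by
  obtain ⟨hf₀, a, ha₀, ⟨h, hh⟩, ⟨g, hg⟩⟩ := hf
  have chain : ∀ {x y : A.Obj} {f : A.Hom x y 0}, A.d 0 1 (zero_add 1) f = 0 →
      ∀ (i j : ℤ) (h : i + 1 = j) (β : A.Hom y z i),
        A.d i j h (precomp f z i β) = precomp f z j (A.d i j h β) := by
    intro x y f hf i j h β
    simp only [precomp, LinearMap.flip_apply]
    rw [A.leibniz i j 0 1 i j h (zero_add 1) h _ (add_zero j) h, hf, map_zero, smul_zero, add_zero]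
  have homotopy : ∀ {x y : A.Obj} {f : A.Hom x y 0} {a : A.Hom y x 0} {h : A.Hom y y (-1)},
      A.comp 0 0 0 (add_zero 0) f a = A.id y + A.d (-1) 0 (by norm_num) h →
      ∀ (i j k : ℤ) (e : i + 1 = j) (e' : j + 1 = k) (β : A.Hom y z j),
        precomp a z j (precomp f z j β) = β +
          A.d i j e ((j.negOnePow : ℤ) • (A.comp j (-1) i (by omega)).flip h β) +
          (k.negOnePow : ℤ) • (A.comp k (-1) j (by omega)).flip h (A.d j k e' β) := by
    intro x y f a h hh i j k e e' β
    simp only [precomp, LinearMap.flip_apply]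
    rw [A.assoc j 0 0 j 0 j _ (add_zero 0) _ (add_zero j), hh, map_add, A.comp_id, map_zsmul,
      A.leibniz j k (-1) 0 i j e' (by norm_num) e _ (by omega) (add_zero j), add_assoc]
    subst e'
    rw [Int.negOnePow_succ, Units.smul_def, smul_add, smul_smul, ← Units.val_mul,
      Int.units_mul_self]
    simp
  exact isContractibleCone_of_homotopy (precomp f z) (precomp a z)
    (fun i j e => (i.negOnePow : ℤ) • (A.comp i (-1) j (by omega)).flip h)
    (fun i j e => (i.negOnePow : ℤ) • (A.comp i (-1) j (by omega)).flip g)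
    (chain hf₀) (chain ha₀) (homotopy hh) (homotopy hg)

theorem isContractibleCone_postcomp {y z : A.Obj} {f : A.Hom y z 0} (hf : A.IsEquivalence f)
    (x : A.Obj) : A.IsContractibleCone (postcomp f x) := by
  obtain ⟨hf₀, a, ha₀, ⟨h, hh⟩, ⟨g, hg⟩⟩ := hf
  have chain : ∀ {y z : A.Obj} {f : A.Hom y z 0}, A.d 0 1 (zero_add 1) f = 0 →
      ∀ (i j : ℤ) (h : i + 1 = j) (β : A.Hom x y i),
        A.d i j h (postcomp f x i β) = postcomp f x j (A.d i j h β) := by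
    intro y z f hf i j h β
    simp only [postcomp]
    rw [A.leibniz 0 1 i j i j (zero_add 1) h h _ (by omega) (zero_add j), hf, map_zero,
      LinearMap.zero_apply, zero_add, Int.negOnePow_zero, one_smul]
  have homotopy : ∀ {y z : A.Obj} {f : A.Hom y z 0} {a : A.Hom z y 0} {g : A.Hom y y (-1)},
      A.comp 0 0 0 (add_zero 0) a f = A.id y + A.d (-1) 0 (by norm_num) g →
      ∀ (i j k : ℤ) (e : i + 1 = j) (e' : j + 1 = k) (β : A.Hom x y j),
        postcomp a x j (postcomp f x j β) = β +
          A.d i j e (A.comp (-1) j i (by omega) g β) +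
          A.comp (-1) k j (by omega) g (A.d j k e' β) := by
    intro y z f a g hg i j k e e' β
    simp only [postcomp]
    rw [← A.assoc 0 0 j 0 j j (add_zero 0) (zero_add j) (zero_add j), hg, map_add,
      LinearMap.add_apply, A.id_comp,
      A.leibniz (-1) 0 j k i j (by norm_num) e' e _ (zero_add j) (by omega)]
    simp only [Int.reduceNeg, Int.negOnePow_neg, Int.negOnePow_one, Units.neg_smul, one_smul]
    abel
  exact isContractibleCone_of_homotopy (postcomp f x) (postcomp a x)
    (fun i j e => A.comp (-1) i j (by omega) g)
    (fun i j e => A.comp (-1) i j (by omega) h)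
    (chain hf₀) (chain ha₀) (homotopy hg) (homotopy hh)

end DGCategory

/-! ### The smooth scheme of fixed vectors of an idempotent matrix -/

section IdempotentAlgebra

open MvPolynomial

variable {B : Type u} [CommRing B] {r : ℕ} (P : Matrix (Fin r) (Fin r) B)

/-- The ideal of the equations `P x = x`. -/
noncomputable def fixedIdeal : Ideal (MvPolynomial (Fin r) B) :=
  Ideal.span (Set.range fun i => X i - ∑ j, C (P i j) * X j)

/-- The algebra representing the fixed vectors of a matrix. -/
abbrev FixedAlgebra : Type u := MvPolynomial (Fin r) B ⧸ fixedIdeal P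

namespace FixedAlgebra

/-- The coordinates of the universal fixed vector. -/
noncomputable def coord (i : Fin r) : FixedAlgebra P := Ideal.Quotient.mk _ (X i)

theorem coord_eq (i : Fin r) :
    coord P i = ∑ j, algebraMap B (FixedAlgebra P) (P i j) * coord P j := by
  have h : (X i - ∑ j, C (P i j) * X j : MvPolynomial (Fin r) B) ∈ fixedIdeal P :=
    Ideal.subset_span ⟨i, rfl⟩
  rw [← Ideal.Quotient.eq_zero_iff_mem, map_sub, sub_eq_zero, map_sum] at h
  simp only [map_mul] at h
  exact h

variable {P} {E : Type*} [CommRing E]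

theorem ringHom_fixed (h : FixedAlgebra P →+* E) :
    (P.map (h.comp (algebraMap B (FixedAlgebra P)))).mulVec (fun i => h (coord P i)) =
      fun i => h (coord P i) := by
  funext i
  conv_rhs => rw [coord_eq, map_sum]
  simp [Matrix.mulVec, dotProduct]

theorem ringHom_ext {h h' : FixedAlgebra P →+* E}
    (h₀ : h.comp (algebraMap B (FixedAlgebra P)) = h'.comp (algebraMap B (FixedAlgebra P)))
    (h₁ : ∀ i, h (coord P i) = h' (coord P i)) : h = h' := by
  refine Ideal.Quotient.ringHom_ext (MvPolynomial.ringHom_ext (fun b => ?_) h₁)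
  exact RingHom.congr_fun h₀ b

theorem eval₂Hom_eq_zero (φ : B →+* E) (v : Fin r → E) (hv : (P.map φ).mulVec v = v) :
    ∀ a ∈ fixedIdeal P, eval₂Hom φ v a = 0 := by
  have : fixedIdeal P ≤ RingHom.ker (eval₂Hom φ v) := by
    rw [fixedIdeal, Ideal.span_le]
    rintro _ ⟨i, rfl⟩
    have := congrFun hv i
    simp only [Matrix.mulVec, dotProduct, Matrix.map_apply] at this
    simp [RingHom.mem_ker, this]
  exact fun a ha => this ha

/-- The morphism defined by a fixed vector. -/
noncomputable def lift (φ : B →+* E) (v : Fin r → E) (hv : (P.map φ).mulVec v = v) :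
    FixedAlgebra P →+* E :=
  Ideal.Quotient.lift _ (eval₂Hom φ v) (eval₂Hom_eq_zero φ v hv)

theorem lift_coord (φ : B →+* E) (v : Fin r → E) (hv : (P.map φ).mulVec v = v) (i : Fin r) :
    lift φ v hv (coord P i) = v i := by
  exact (Ideal.Quotient.lift_mk _ _ _).trans (eval₂Hom_X' _ _ _)

theorem lift_comp_algebraMap (φ : B →+* E) (v : Fin r → E) (hv : (P.map φ).mulVec v = v) :
    (lift φ v hv).comp (algebraMap B (FixedAlgebra P)) = φ := by
  ext b
  exact (Ideal.Quotient.lift_mk (fixedIdeal P) (eval₂Hom φ v) (eval₂Hom_eq_zero φ v hv)).trans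
    (eval₂Hom_C φ v b)

/-- Given a point modulo I, lift its coordinates arbitrarily to w and replace w by Pw. This vector
is fixed because P² = P, and it still reduces to the given point, whose coordinates are already
fixed by P. Finitely many variables and equations give finite presentation. -/
theorem smooth (hP : P * P = P) : Algebra.Smooth B (FixedAlgebra P) where
  formallySmooth := by
    refine Algebra.FormallySmooth.of_comp_surjective fun E _ _ I _ g => ?_
    choose w hw using fun i => Ideal.Quotient.mk_surjective (g (coord P i))
    have hv : (P.map (algebraMap B E)).mulVec ((P.map (algebraMap B E)).mulVec w) =
        (P.map (algebraMap B E)).mulVec w := by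
      rw [Matrix.mulVec_mulVec, ← Matrix.map_mul, hP]
    let f : FixedAlgebra P →ₐ[B] E :=
      { lift (algebraMap B E) _ hv with
        commutes' := fun b => RingHom.congr_fun (lift_comp_algebraMap _ _ hv) b }
    refine ⟨f, AlgHom.coe_ringHom_injective (ringHom_ext ?_ fun i => ?_)⟩
    · ext b
      simp
    · change Ideal.Quotient.mk I (lift (algebraMap B E) _ hv (coord P i)) = g (coord P i)
      rw [lift_coord, coord_eq, map_sum, Matrix.mulVec, dotProduct, map_sum]
      refine Finset.sum_congr rfl fun j _ => ?_
      rw [map_mul, map_mul, hw, AlgHom.commutes]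
      rfl
  finitePresentation := by
    refine Algebra.FinitePresentation.quotient ?_
    exact Submodule.fg_span (Set.finite_range _)

end FixedAlgebra

end IdempotentAlgebra

section

variable {k : Type u} [Field k]

/-- The functor of fixed vectors of an idempotent matrix is represented by a smooth surjective
scheme. -/
theorem exists_scheme_of_idempotent (B : CommAlgCat.{u} k) {r : ℕ}
    (P : Matrix (Fin r) (Fin r) B) (hP : P * P = P) :
    ∃ (T : Scheme.{u}) (π : T ⟶ Spec (CommRingCat.of B)), Smooth π ∧ Surjective π ∧
      ∃ e : ∀ (B' : CommAlgCat.{u} k) (φ : B ⟶ B'),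
        {v : Fin r → B' // (P.map φ.hom.toRingHom).mulVec v = v} ≃
          {t : Spec (CommRingCat.of B') ⟶ T // t ≫ π = specMap φ},
        ∀ (B' B'' : CommAlgCat.{u} k) (φ : B ⟶ B') (ψ : B' ⟶ B'')
          (v : {v : Fin r → B' // (P.map φ.hom.toRingHom).mulVec v = v})
          (w : {v : Fin r → B'' // (P.map (φ ≫ ψ).hom.toRingHom).mulVec v = v}),
          (∀ i, w.1 i = ψ.hom (v.1 i)) → (e B'' (φ ≫ ψ) w).1 = specMap ψ ≫ (e B' φ v).1 := by
  -- Full faithfulness of Spec turns points over Spec B into ring maps compatible with B, and these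
  -- are determined by the images of the coordinates.
  have hbij : ∀ (B' : CommAlgCat.{u} k) (φ : B ⟶ B'), Function.Bijective
      (fun v : {v : Fin r → B' // (P.map φ.hom.toRingHom).mulVec v = v} =>
        (⟨Spec.map (CommRingCat.ofHom (FixedAlgebra.lift _ v.1 v.2)), by
          rw [← Spec.map_comp, ← CommRingCat.ofHom_comp, FixedAlgebra.lift_comp_algebraMap]⟩ :
        {t : Spec (CommRingCat.of B') ⟶ Spec (CommRingCat.of (FixedAlgebra P)) //
          t ≫ Spec.map (CommRingCat.ofHom (algebraMap B (FixedAlgebra P))) = specMap φ})) := by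
    intro B' φ
    constructor
    · intro v w h
      have h := Spec.map_injective (congrArg Subtype.val h)
      have h := congrArg CommRingCat.Hom.hom h
      simp only [CommRingCat.hom_ofHom] at h
      refine Subtype.ext (funext fun i => ?_)
      rw [← FixedAlgebra.lift_coord _ v.1 v.2, h, FixedAlgebra.lift_coord]
    · rintro ⟨t, ht⟩
      obtain ⟨h, rfl⟩ := Spec.map_surjective t
      rw [← Spec.map_comp] at ht
      have ht := congrArg CommRingCat.Hom.hom (Spec.map_injective ht)
      simp only [CommRingCat.hom_comp, CommRingCat.hom_ofHom] at ht
      have hv := FixedAlgebra.ringHom_fixed h.hom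
      rw [ht] at hv
      refine ⟨⟨_, hv⟩, Subtype.ext ?_⟩
      refine congrArg Spec.map (CommRingCat.hom_ext (FixedAlgebra.ringHom_ext ?_ fun i => ?_))
      · rw [CommRingCat.hom_ofHom, FixedAlgebra.lift_comp_algebraMap, ht]
      · rw [CommRingCat.hom_ofHom, FixedAlgebra.lift_coord]
  refine ⟨Spec (CommRingCat.of (FixedAlgebra P)),
    Spec.map (CommRingCat.ofHom (algebraMap B (FixedAlgebra P))), ?_, ?_,
    fun B' φ => Equiv.ofBijective _ (hbij B' φ), ?_⟩
  · rw [HasRingHomProperty.Spec_iff (P := @Smooth), CommRingCat.hom_ofHom,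
      RingHom.smooth_algebraMap]
    exact FixedAlgebra.smooth hP
  -- The zero vector is fixed by every matrix, so it defines a section of the structure morphism,
  -- which is therefore surjective.
  · have hv : (P.map (RingHom.id B)).mulVec (0 : Fin r → B) = 0 := Matrix.mulVec_zero _
    refine ⟨fun x => ⟨Spec.map (CommRingCat.ofHom (FixedAlgebra.lift _ _ hv)) x, ?_⟩⟩
    rw [← Scheme.Hom.comp_apply, ← Spec.map_comp, ← CommRingCat.ofHom_comp,
      FixedAlgebra.lift_comp_algebraMap]
    simp
  · intro B' B'' φ ψ v w h
    simp only [Equiv.ofBijective_apply]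
    rw [← Spec.map_comp, ← CommRingCat.ofHom_comp]
    congr 2
    refine FixedAlgebra.ringHom_ext ?_ fun i => ?_
    · rw [FixedAlgebra.lift_comp_algebraMap, RingHom.comp_assoc,
        FixedAlgebra.lift_comp_algebraMap]
      rfl
    · rw [FixedAlgebra.lift_coord, RingHom.comp_apply, FixedAlgebra.lift_coord]
      exact h i

end

/-! ### Kernels of split linear maps under base change -/

/-- The solutions of a split homogeneous linear system over a ring, after any base change, are the
fixed vectors of an idempotent matrix. -/
theorem exists_idempotent_of_split {B M N : Type u} [CommRing B] [AddCommGroup M] [AddCommGroup N]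
    [Module B M] [Module B N] [Module.Finite B M] [Module.Projective B M]
    (D : M →ₗ[B] N) (c : N →ₗ[B] M) (hc : ∀ x, D (c (D x)) = D x) :
    ∃ (r : ℕ) (P : Matrix (Fin r) (Fin r) B) (z : Fin r → M), P * P = P ∧
      ∀ (B' M' N' : Type u) [CommRing B'] [AddCommGroup M'] [AddCommGroup N'] [Module B' M']
        [Module B' N'] (φ : B →+* B') (f : M →+ M') (g : N →+ N')
        (hf : ∀ (b : B) (x : M), f (b • x) = φ b • f x)
        (hg : ∀ (b : B) (x : N), g (b • x) = φ b • g x) (D' : M' →ₗ[B'] N'),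
        IsScalarExtension φ f hf → IsScalarExtension φ g hg → (∀ x, D' (f x) = g (D x)) →
        (∀ v : Fin r → B', D' (∑ j, v j • f (z j)) = 0) ∧
        ∀ y : M', D' y = 0 → ∃! v : Fin r → B', (P.map φ).mulVec v = v ∧
          ∑ j, v j • f (z j) = y := by
  obtain ⟨r, p, hp⟩ := Module.Finite.exists_fin' B M
  obtain ⟨s, hs⟩ := Module.projective_lifting_property p LinearMap.id hp
  replace hs : ∀ x, p (s x) = x := LinearMap.congr_fun hs
  -- From D c D = D, the map e = 1 - cD is a projector onto ker D. With p the presentation by a free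
  -- module and s a section of it, the matrix P below represents s e p and is idempotent because p s
  -- = 1.
  let e : M →ₗ[B] M := LinearMap.id - c ∘ₗ D
  have he : ∀ x, e x = x - c (D x) := fun _ => rfl
  have hDe : ∀ x, D (e x) = 0 := fun x => by rw [he, map_sub, hc, sub_self]
  have hee : ∀ x, e (e x) = e x := fun x => by rw [he (e x), hDe, map_zero, sub_zero]
  have hsum : ∀ (q : M →ₗ[B] M) x, q x = ∑ j, s x j • q (p (Pi.single j 1)) := by
    intro q x
    conv_lhs => rw [← hs x, pi_eq_sum_univ' (s x), map_sum, map_sum]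
    refine Finset.sum_congr rfl fun j _ => ?_
    rw [map_smul, map_smul]
  let z : Fin r → M := fun j => e (p (Pi.single j 1))
  have hz : ∀ x, e x = ∑ j, s x j • z j := hsum e
  let P : Matrix (Fin r) (Fin r) B := Matrix.of fun i j => s (z j) i
  refine ⟨r, P, z, ?_, ?_⟩
  · ext i j
    have : z j = ∑ l, s (z j) l • z l := by rw [← hz]; exact (hee _).symm
    have h := congrFun (congrArg s this) i
    rw [map_sum, Finset.sum_apply] at h
    simp only [map_smul, Pi.smul_apply, smul_eq_mul] at h
    simp only [Matrix.mul_apply, P, Matrix.of_apply]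
    rw [h]
    exact Finset.sum_congr rfl fun l _ => mul_comm _ _
  intro B' M' N' _ _ _ _ _ φ f g hf hg D' hf' hg' hD'
  let _ : Algebra B B' := φ.toAlgebra
  let _ : Module B M' := Module.compHom M' φ
  have : IsScalarTower B B' M' := ⟨fun b c x => mul_smul (φ b) c x⟩
  let _ : Module B N' := Module.compHom N' φ
  have : IsScalarTower B B' N' := ⟨fun b c x => mul_smul (φ b) c x⟩
  let f₀ : M →ₗ[B] M' := { toFun := f, map_add' := f.map_add, map_smul' := hf }
  let g₀ : N →ₗ[B] N' := { toFun := g, map_add' := g.map_add, map_smul' := hg }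
  replace hf' : IsBaseChange B' f₀ := hf'
  replace hg' : IsBaseChange B' g₀ := hg'
  let s' : M' →ₗ[B'] (Fin r → B') := hf'.lift ((Algebra.linearMap B B').compLeft (Fin r) ∘ₗ s)
  have hs' : ∀ x i, s' (f x) i = φ (s x i) := fun x i => congrFun (hf'.lift_eq _ x) i
  let c' : N' →ₗ[B'] M' := hg'.lift (f₀ ∘ₗ c)
  have hc' : ∀ x, c' (g x) = f (c x) := hg'.lift_eq _
  -- The projector 1 - c'D' over B' factors through s' and the vectors f(z_j); by the universal
  -- property of base change, this need only be tested on the elements f x. A vector in ker D' thus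
  -- has coordinates s' y, and a P-fixed v is recovered as s' of its combination.
  have key : ∀ y, y - c' (D' y) = ∑ j, s' y j • f (z j) := by
    have := hf'.algHom_ext (LinearMap.id - c' ∘ₗ D')
      (∑ j, (LinearMap.toSpanSingleton B' M' (f (z j))) ∘ₗ LinearMap.proj j ∘ₗ s') fun x => by
        simp only [LinearMap.sub_apply, LinearMap.id_apply, LinearMap.comp_apply,
          LinearMap.sum_apply, LinearMap.proj_apply, LinearMap.toSpanSingleton_apply]
        change f x - c' (D' (f x)) = ∑ j, s' (f x) j • f (z j)
        rw [hD', hc', ← map_sub, ← he, hz, map_sum]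
        exact Finset.sum_congr rfl fun j _ => by rw [hf, hs']
    intro y
    simpa using LinearMap.congr_fun this y
  have hP : ∀ v : Fin r → B', s' (∑ j, v j • f (z j)) = (P.map φ).mulVec v := by
    intro v
    ext i
    simp [Matrix.mulVec, dotProduct, hs', P, mul_comm]
  refine ⟨fun v => ?_, fun y hy => ⟨s' y, ⟨?_, ?_⟩, ?_⟩⟩
  · rw [map_sum]
    refine Finset.sum_eq_zero fun j _ => ?_
    rw [map_smul, hD', hDe, map_zero, smul_zero]
  · rw [← hP, ← key, hy, map_zero, sub_zero]
  · rw [← key, hy, map_zero, sub_zero]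
  · rintro v ⟨hv, rfl⟩
    rw [hP, hv]

theorem IsScalarExtension.prodMap {B B' M M' N N' : Type u} [CommRing B] [CommRing B']
    [AddCommGroup M] [AddCommGroup M'] [Module B M] [Module B' M'] [AddCommGroup N]
    [AddCommGroup N'] [Module B N] [Module B' N'] {φ : B →+* B'} {f : M →+ M'} {g : N →+ N'}
    {hf : ∀ (c : B) (x : M), f (c • x) = φ c • f x} {hg : ∀ (c : B) (x : N), g (c • x) = φ c • g x}
    (h : IsScalarExtension φ f hf) (h' : IsScalarExtension φ g hg) :
    IsScalarExtension φ (f.prodMap g)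
      (fun c x => Prod.ext (hf c x.1) (hg c x.2)) := by
  let _ : Algebra B B' := φ.toAlgebra
  let _ : Module B M' := Module.compHom M' φ
  have : IsScalarTower B B' M' := ⟨fun b c x => mul_smul (φ b) c x⟩
  let _ : Module B N' := Module.compHom N' φ
  have : IsScalarTower B B' N' := ⟨fun b c x => mul_smul (φ b) c x⟩
  let f₀ : M →ₗ[B] M' := { toFun := f, map_add' := f.map_add, map_smul' := hf }
  let g₀ : N →ₗ[B] N' := { toFun := g, map_add' := g.map_add, map_smul' := hg }
  have := IsBaseChange.prodMap (S := B') f₀ g₀ h h'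
  exact this

/-! ### Replacing one arrow, and the linear system of a horn -/

namespace PreSimplex

variable {B : Type u} [CommRing B] {A : DGCategory B} {n : ℕ}

/-- The presimplex `S` with one arrow replaced by `x`. -/
@[reducible]
def update (S : PreSimplex A n) (a₁ : Fin (n + 1)) (l₁ : List (Fin (n + 1))) (b₁ : Fin (n + 1))
    (x : A.Hom (S.obj a₁) (S.obj b₁) (-(l₁.length : ℤ))) : PreSimplex A n where
  obj := S.obj
  arrow a l b h p hp :=
    if e : a₁ = a ∧ l₁ = l ∧ b₁ = b then
      cast (by obtain ⟨rfl, rfl, rfl⟩ := e; rw [hp]) x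
    else S.arrow a l b h p hp

variable (S : PreSimplex A n) {a₁ : Fin (n + 1)} {l₁ : List (Fin (n + 1))} {b₁ : Fin (n + 1)}
  (x : A.Hom (S.obj a₁) (S.obj b₁) (-(l₁.length : ℤ)))

theorem update_arrow_self (h : IsMonotoneSeq a₁ l₁ b₁) :
    (S.update a₁ l₁ b₁ x).arrow a₁ l₁ b₁ h _ rfl = x :=
  dif_pos ⟨rfl, rfl, rfl⟩

theorem update_arrow_of_ne {a b : Fin (n + 1)} {l : List (Fin (n + 1))}
    (hne : ¬ (a₁ = a ∧ l₁ = l ∧ b₁ = b)) (h : IsMonotoneSeq a l b) (p : ℤ)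
    (hp : p = -(l.length : ℤ)) :
    (S.update a₁ l₁ b₁ x).arrow a l b h p hp = S.arrow a l b h p hp :=
  dif_neg hne

theorem d_update_arrow_self (h : IsMonotoneSeq a₁ l₁ b₁) (hx : A.d _ _ rfl x = 0) (p q : ℤ)
    (hp : p = -(l₁.length : ℤ)) (hpq : p + 1 = q) :
    A.d p q hpq ((S.update a₁ l₁ b₁ x).arrow a₁ l₁ b₁ h p hp) = 0 := by
  subst hp hpq
  rw [update_arrow_self, hx]

/-- Cuts and faces are strictly shorter than the sequence they come from, so an arrow at least as
long as that sequence does not occur in its boundary. -/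
theorem bdry_update_of_length_le {a b : Fin (n + 1)} {l : List (Fin (n + 1))}
    (hl : l.length ≤ l₁.length) (h : IsMonotoneSeq a l b) (q : ℤ)
    (hq : -(l.length : ℤ) + 1 = q) :
    (S.update a₁ l₁ b₁ x).bdry a l b h q hq = S.bdry a l b h q hq := by
  refine Finset.sum_congr rfl fun j _ => ?_
  have hj := j.2
  have ne : ∀ {a b : Fin (n + 1)} {l : List (Fin (n + 1))}, l.length < l₁.length →
      ¬ (a₁ = a ∧ l₁ = l ∧ b₁ = b) := by
    rintro a b l h ⟨-, rfl, -⟩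
    exact lt_irrefl _ h
  rw [update_arrow_of_ne, update_arrow_of_ne, update_arrow_of_ne]
  · exact ne (by rw [List.length_eraseIdx_of_lt hj]; omega)
  · exact ne (by rw [List.length_take]; omega)
  · exact ne (by rw [List.length_drop]; omega)

end PreSimplex

/-- A presimplex which is coherent away from two strictly increasing sequences, where it
vanishes. -/
structure PreSimplex.IsHornFamily {B : Type u} [CommRing B] {A : DGCategory B} {n : ℕ}
    (S : PreSimplex A n) (a₀ : Fin (n + 1)) (l₀ : List (Fin (n + 1))) (b₀ : Fin (n + 1))
    (a₁ : Fin (n + 1)) (l₁ : List (Fin (n + 1))) (b₁ : Fin (n + 1)) : Prop where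
  unit : ∀ a, S.arrow a [] a (isMonotoneSeq_pair le_rfl) 0 (by simp) = A.id (S.obj a)
  degenerate : ∀ a l b (h : IsMonotoneSeq a l b) (p : ℤ) (hp : p = -(l.length : ℤ)),
    l ≠ [] → IsDegenerateSeq a l b → S.arrow a l b h p hp = 0
  arrow_full : ∀ h p hp, S.arrow a₀ l₀ b₀ h p hp = 0
  arrow_omit : ∀ h p hp, S.arrow a₁ l₁ b₁ h p hp = 0
  coherence : ∀ a l b (h : IsMonotoneSeq a l b) (p q : ℤ) (hp : p = -(l.length : ℤ))
    (hpq : p + 1 = q), (fullSeq a l b).Pairwise (· < ·) → ¬ (a₀ = a ∧ l₀ = l ∧ b₀ = b) →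
    ¬ (a₁ = a ∧ l₁ = l ∧ b₁ = b) →
    A.d p q hpq (S.arrow a l b h p hp) = S.bdry a l b h q (by rw [← hp, hpq])
  isEquivalence : ∀ a b (h : a < b), ¬ (a₀ = a ∧ l₀ = [] ∧ b₀ = b) →
    ¬ (a₁ = a ∧ l₁ = [] ∧ b₁ = b) →
    A.IsEquivalence (S.arrow a [] b (isMonotoneSeq_pair h.le) 0 (by simp))

/-- A description of the dependence of the coherence equation of the sequence `a₀, l₀, b₀` on the
arrow indexed by `a₁, l₁, b₁`. -/
structure HornSystem {n : ℕ} {a₀ : Fin (n + 1)} {l₀ : List (Fin (n + 1))} {b₀ : Fin (n + 1)}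
    (h₀ : IsMonotoneSeq a₀ l₀ b₀) {a₁ : Fin (n + 1)} {l₁ : List (Fin (n + 1))} {b₁ : Fin (n + 1)}
    (h₁ : IsMonotoneSeq a₁ l₁ b₁) where
  length_eq : l₁.length + 1 = l₀.length
  -- Everything is quantified over all rings and presimplices, so that one system applies both to
  -- the given horn and to its base changes.
  U : ∀ {B : Type u} [CommRing B] {A : DGCategory.{u} B} (S : PreSimplex A n) (q : ℤ),
    A.Hom (S.obj a₁) (S.obj b₁) q →ₗ[B] A.Hom (S.obj a₀) (S.obj b₀) q
  bdry_update : ∀ {B : Type u} [CommRing B] {A : DGCategory.{u} B} (S : PreSimplex A n)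
    (x : A.Hom (S.obj a₁) (S.obj b₁) (-(l₁.length : ℤ))),
    S.IsHornFamily a₀ l₀ b₀ a₁ l₁ b₁ →
    (S.update a₁ l₁ b₁ x).bdry a₀ l₀ b₀ h₀ (-(l₁.length : ℤ)) (by omega) =
      S.bdry a₀ l₀ b₀ h₀ _ (by omega) + U S _ x
  d_bdry : ∀ {B : Type u} [CommRing B] {A : DGCategory.{u} B} (S : PreSimplex A n),
    S.IsHornFamily a₀ l₀ b₀ a₁ l₁ b₁ →
    A.d (-(l₁.length : ℤ)) _ rfl (S.bdry a₀ l₀ b₀ h₀ (-(l₁.length : ℤ)) (by omega)) =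
      - U S _ (S.bdry a₁ l₁ b₁ h₁ _ rfl)
  isContractibleCone : ∀ {B : Type u} [CommRing B] {A : DGCategory.{u} B} (S : PreSimplex A n),
    S.IsHornFamily a₀ l₀ b₀ a₁ l₁ b₁ → A.IsContractibleCone (U S)
  isEquivalence : ∀ {B : Type u} [CommRing B] {A : DGCategory.{u} B} (S : PreSimplex A n),
    S.IsHornFamily a₀ l₀ b₀ a₁ l₁ b₁ → ∀ (hl : l₁ = [])
    (x : A.Hom (S.obj a₁) (S.obj b₁) (-(l₁.length : ℤ)))
    (y : A.Hom (S.obj a₀) (S.obj b₀) (-(l₀.length : ℤ))),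
    A.d _ _ rfl x = 0 →
    A.d _ _ rfl y = (S.update a₁ l₁ b₁ x).bdry a₀ l₀ b₀ h₀ _ rfl →
    A.IsEquivalence ((S.update a₁ l₁ b₁ x).arrow a₁ l₁ b₁ h₁ 0 (by simp [hl]))

section Sequences

variable {n : ℕ} {a b : Fin (n + 1)} {l : List (Fin (n + 1))}

theorem first_lt_getElem (h : (fullSeq a l b).Pairwise (· < ·)) (j : Fin l.length) : a < l[j] := by
  rw [fullSeq, List.pairwise_cons] at h
  exact h.1 _ (by simp)

theorem getElem_lt_last (h : (fullSeq a l b).Pairwise (· < ·)) (j : Fin l.length) : l[j] < b := by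
  rw [fullSeq, List.pairwise_cons, List.pairwise_append] at h
  exact h.2.2.2 _ (by simp) _ (by simp)

theorem nodup_of_pairwise (h : (fullSeq a l b).Pairwise (· < ·)) : l.Nodup := by
  rw [fullSeq, List.pairwise_cons, List.pairwise_append] at h
  exact h.2.1.imp ne_of_lt

theorem pairwise_left (h : (fullSeq a l b).Pairwise (· < ·)) (j : Fin l.length) :
    (fullSeq a (l.take j) l[j]).Pairwise (· < ·) := by
  rw [fullSeq_left (b := b)]
  exact h.sublist (List.take_sublist _ _)

theorem pairwise_right (h : (fullSeq a l b).Pairwise (· < ·)) (j : Fin l.length) :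
    (fullSeq l[j] (l.drop (j + 1)) b).Pairwise (· < ·) := by
  rw [fullSeq_right (a := a)]
  exact h.sublist (List.drop_sublist _ _)

theorem pairwise_erase (h : (fullSeq a l b).Pairwise (· < ·)) (j : Fin l.length) :
    (fullSeq a (l.eraseIdx j) b).Pairwise (· < ·) := by
  rw [fullSeq_eraseIdx]
  exact h.sublist (List.eraseIdx_sublist _ _)

theorem eraseIdx_injective (h : l.Nodup) {i j : Fin l.length}
    (e : l.eraseIdx i = l.eraseIdx j) : i = j := by
  by_contra hne
  have h₁ : l[i] ∈ l.eraseIdx j := by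
    rw [List.mem_eraseIdx_iff_getElem]
    exact ⟨i, i.2, fun h => hne (Fin.ext h), rfl⟩
  rw [← e, List.mem_eraseIdx_iff_getElem] at h₁
  obtain ⟨m, hm, hmi, hmm⟩ := h₁
  exact hmi ((h.getElem_inj_iff).1 hmm)

end Sequences

namespace HornSystem

variable {n : ℕ} {a₀ : Fin (n + 1)} {l₀ : List (Fin (n + 1))} {b₀ : Fin (n + 1)}
    (h₀ : IsMonotoneSeq a₀ l₀ b₀) (hlt : (fullSeq a₀ l₀ b₀).Pairwise (· < ·))

section

variable {B : Type u} [CommRing B] {A : DGCategory.{u} B} {S : PreSimplex A n}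
  {a₁ : Fin (n + 1)} {l₁ : List (Fin (n + 1))} {b₁ : Fin (n + 1)}
  (hS : S.IsHornFamily a₀ l₀ b₀ a₁ l₁ b₁)

include hlt hS

theorem defect_right (j : Fin l₀.length) (p q : ℤ) (hp hpq hq)
    (hne : ¬ (a₁ = l₀[j] ∧ l₁ = l₀.drop (j + 1) ∧ b₁ = b₀)) :
    A.d p q hpq (S.arrow l₀[j] (l₀.drop (j + 1)) b₀ (h₀.right j) p hp) -
      S.bdry l₀[j] (l₀.drop (j + 1)) b₀ (h₀.right j) q hq = 0 := by
  rw [hS.coherence _ _ _ _ _ _ _ _ (pairwise_right hlt j) _ hne, sub_self]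
  rintro ⟨h, -, -⟩
  exact (first_lt_getElem hlt j).ne h

theorem defect_left (j : Fin l₀.length) (p q : ℤ) (hp hpq hq)
    (hne : ¬ (a₁ = a₀ ∧ l₁ = l₀.take j ∧ b₁ = l₀[j])) :
    A.d p q hpq (S.arrow a₀ (l₀.take j) l₀[j] (h₀.left j) p hp) -
      S.bdry a₀ (l₀.take j) l₀[j] (h₀.left j) q hq = 0 := by
  rw [hS.coherence _ _ _ _ _ _ _ _ (pairwise_left hlt j) _ hne, sub_self]
  rintro ⟨-, -, h⟩
  exact (getElem_lt_last hlt j).ne' h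

theorem defect_erase (j : Fin l₀.length) (p q : ℤ) (hp hpq hq)
    (hne : ¬ (a₁ = a₀ ∧ l₁ = l₀.eraseIdx j ∧ b₁ = b₀)) :
    A.d p q hpq (S.arrow a₀ (l₀.eraseIdx j) b₀ (h₀.erase j) p hp) -
      S.bdry a₀ (l₀.eraseIdx j) b₀ (h₀.erase j) q hq = 0 := by
  rw [hS.coherence _ _ _ _ _ _ _ _ (pairwise_erase hlt j) _ hne, sub_self]
  rintro ⟨-, h, -⟩
  have := congrArg List.length h
  rw [List.length_eraseIdx_of_lt j.2] at this
  have := j.2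
  omega

end

/-- For a full sequence with one interior vertex, the coherence equation reads dy = α(1,2) ∘ α(0,1)
- α(0,2), so y is the required homotopy. -/
theorem homotopic_of_triangle {B : Type u} [CommRing B] {A : DGCategory.{u} B}
    (S : PreSimplex A n) (hl : l₀.length = 1) (j : Fin l₀.length) (p q : ℤ) (hp : p = -1)
    (hpq : p + 1 = q) (y : A.Hom (S.obj a₀) (S.obj b₀) p) (hq : -(l₀.length : ℤ) + 1 = q)
    (hy : A.d p q hpq y = S.bdry a₀ l₀ b₀ h₀ q hq) (h₁ : IsMonotoneSeq l₀[j] [] b₀)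
    (h₂ : IsMonotoneSeq a₀ [] l₀[j]) (h₃ : IsMonotoneSeq a₀ [] b₀) :
    A.Homotopic (A.comp 0 0 0 (add_zero 0) (S.arrow l₀[j] [] b₀ h₁ 0 (by simp))
      (S.arrow a₀ [] l₀[j] h₂ 0 (by simp))) (S.arrow a₀ [] b₀ h₃ 0 (by simp)) := by
  subst hp
  obtain rfl : q = 0 := by omega
  have hj : (j : ℕ) = 0 := by have := j.2; omega
  refine ⟨y, ?_⟩
  rw [hy, PreSimplex.bdry, Fintype.sum_eq_single j
    (fun m hm => (hm (Fin.ext (by have := m.2; omega))).elim),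
    Int.negOnePow_even _ (by simp [hl, hj]), one_smul, ← sub_eq_iff_eq_add']
  congr 1
  · exact S.comp_arrow_congr rfl (by simp [hj])
      (by simp [← List.length_eq_zero_iff, hl, hj])
  · exact S.arrow_congr (by simp [← List.length_eq_zero_iff, hl, hj]) _ _ _ _ _

/-- The system in which the omitted index is the first one. -/
def right (j : Fin l₀.length) (hj : (j : ℕ) = 0) : HornSystem.{u} h₀ (h₀.right j) where
  length_eq := by have := j.2; rw [List.length_drop]; omega
  -- The missing arrow occurs only in the cut at the first interior vertex, where it is composed
  -- with the edge α(0,1).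
  U S q := (((l₀.length : ℤ) - 1 - j).negOnePow : ℤ) •
    DGCategory.precomp (S.arrow a₀ [] l₀[j] (isMonotoneSeq_pair (first_lt_getElem hlt j).le) 0
      (by simp)) (S.obj b₀) q
  bdry_update {B _ A} S x hS := by
    rw [PreSimplex.bdry, PreSimplex.bdry, ← sub_eq_iff_eq_add', ← Finset.sum_sub_distrib,
      Fintype.sum_eq_single j]
    · rw [S.update_arrow_self, S.update_arrow_of_ne, S.update_arrow_of_ne, ← smul_sub,
        hS.arrow_omit,
        map_zero, LinearMap.zero_apply, sub_sub_sub_cancel_right, sub_zero]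
      · rw [LinearMap.smul_apply, Units.smul_def]
        congr 1
        exact S.comp_arrow_left_congr (by simp [hj]) _
      · rintro ⟨h, -, -⟩
        exact (first_lt_getElem hlt j).ne' h
      · rintro ⟨h, -, -⟩
        exact (first_lt_getElem hlt j).ne' h
    · intro m hm
      rw [S.update_arrow_of_ne, S.update_arrow_of_ne, S.update_arrow_of_ne, sub_self]
      · rintro ⟨h, -, -⟩
        exact (first_lt_getElem hlt j).ne' h
      · rintro ⟨h, -, -⟩
        exact (first_lt_getElem hlt j).ne' h
      · rintro ⟨h, -, -⟩
        exact hm (Fin.ext ((nodup_of_pairwise hlt).getElem_inj_iff.1 h).symm)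
  -- All defects in `PreSimplex.d_bdry` vanish by coherence on the horn, except that of the omitted
  -- arrow. Its value in `S` is zero, so its defect is minus its boundary.
  d_bdry {B _ A} S hS := by
    rw [S.d_bdry h₀ _ (by have := j.2; rw [List.length_drop]; omega), Fintype.sum_eq_single j]
    · rw [defect_left h₀ hlt hS, defect_erase h₀ hlt hS, hS.arrow_omit, map_zero, map_zero,
        smul_zero, add_zero, sub_zero, zero_sub, map_neg, LinearMap.neg_apply, smul_neg,
        LinearMap.smul_apply, Units.smul_def]
      · congr 2
        exact S.comp_arrow_left_congr (by simp [hj]) _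
      · rintro ⟨h, -, -⟩
        exact (first_lt_getElem hlt j).ne' h
      · rintro ⟨h, -, -⟩
        exact (first_lt_getElem hlt j).ne' h
    · intro m hm
      rw [defect_left h₀ hlt hS, defect_erase h₀ hlt hS, defect_right h₀ hlt hS]
      · simp
      · rintro ⟨h, -, -⟩
        exact hm (Fin.ext ((nodup_of_pairwise hlt).getElem_inj_iff.1 h).symm)
      · rintro ⟨h, -, -⟩
        exact (first_lt_getElem hlt j).ne' h
      · rintro ⟨h, -, -⟩
        exact (first_lt_getElem hlt j).ne' h
  isContractibleCone {B _ A} S hS := by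
    refine (DGCategory.isContractibleCone_precomp
      (hS.isEquivalence _ _ (first_lt_getElem hlt j) ?_ ?_) _).units_smul _
    · rintro ⟨-, h, -⟩
      exact List.ne_nil_of_length_pos (Fin.pos j) h
    · rintro ⟨h, -, -⟩
      exact (first_lt_getElem hlt j).ne' h
  isEquivalence {B _ A} S hS hl x y hx hy := by
    have hl' := congrArg List.length hl
    rw [List.length_drop, List.length_nil] at hl'
    have hlen : l₀.length = 1 := by omega
    have key := homotopic_of_triangle h₀ (S.update l₀[j] (l₀.drop (j + 1)) b₀ x) hlen j _ _
      (by simp [hlen]) rfl y rfl hy (isMonotoneSeq_pair (getElem_lt_last hlt j).le)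
      (isMonotoneSeq_pair (first_lt_getElem hlt j).le)
      (isMonotoneSeq_pair ((first_lt_getElem hlt j).trans (getElem_lt_last hlt j)).le)
    have hd := S.d_update_arrow_self x (h₀.right j) hx 0 1 (by simp [hl]) (zero_add 1)
    rw [PreSimplex.arrow_congr _ hl _ (isMonotoneSeq_pair (getElem_lt_last hlt j).le) _ _
      (by simp)] at hd ⊢
    have hne := (first_lt_getElem hlt j).ne'
    have hne' := List.ne_nil_of_length_pos (Fin.pos j)
    refine DGCategory.IsEquivalence.of_comp_right key ?_ ?_ hd
    · rw [S.update_arrow_of_ne _ (fun h => hne h.1)]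
      exact hS.isEquivalence _ _ (first_lt_getElem hlt j) (fun h => hne' h.2.1) (fun h => hne h.1)
    · rw [S.update_arrow_of_ne _ (fun h => hne h.1)]
      exact hS.isEquivalence _ _ ((first_lt_getElem hlt j).trans (getElem_lt_last hlt j))
        (fun h => hne' h.2.1) (fun h => hne h.1)

/-- The system in which the omitted index is the last one. -/
def left (j : Fin l₀.length) (hj : (j : ℕ) + 1 = l₀.length) :
    HornSystem.{u} h₀ (h₀.left j) where
  length_eq := by have := j.2; rw [List.length_take]; omega
  U S q := (((l₀.length : ℤ) - 1 - j).negOnePow : ℤ) •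
    DGCategory.postcomp (S.arrow l₀[j] [] b₀ (isMonotoneSeq_pair (getElem_lt_last hlt j).le) 0
      (by simp)) (S.obj a₀) q
  bdry_update {B _ A} S x hS := by
    have hne := (getElem_lt_last hlt j).ne
    rw [PreSimplex.bdry, PreSimplex.bdry, ← sub_eq_iff_eq_add', ← Finset.sum_sub_distrib,
      Fintype.sum_eq_single j]
    · rw [S.update_arrow_self, S.update_arrow_of_ne _ (fun h => hne h.2.2),
        S.update_arrow_of_ne _ (fun h => hne h.2.2), ← smul_sub, hS.arrow_omit,
        map_zero, sub_sub_sub_cancel_right, sub_zero, LinearMap.smul_apply, Units.smul_def]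
      congr 1
      exact S.comp_arrow_right_congr (by simp [hj]) _
    · intro m hm
      rw [S.update_arrow_of_ne _ (fun h => hne h.2.2), S.update_arrow_of_ne,
        S.update_arrow_of_ne _ (fun h => hne h.2.2), sub_self]
      rintro ⟨-, -, h⟩
      exact hm (Fin.ext ((nodup_of_pairwise hlt).getElem_inj_iff.1 h).symm)
  d_bdry {B _ A} S hS := by
    have hne := (getElem_lt_last hlt j).ne
    have hj' : l₀.drop (j + 1) = [] := by simp [hj]
    rw [S.d_bdry h₀ _ (by have := j.2; rw [List.length_take]; omega), Fintype.sum_eq_single j]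
    · rw [defect_right h₀ hlt hS _ _ _ _ _ _ (fun h => hne h.2.2),
        defect_erase h₀ hlt hS _ _ _ _ _ _ (fun h => hne h.2.2), hS.arrow_omit, map_zero,
        map_zero, zero_add, sub_zero, zero_sub, map_neg, smul_neg, smul_neg,
        LinearMap.smul_apply, Units.smul_def]
      congr 2
      rw [Int.negOnePow_even _ (by simp [hj']), one_smul]
      exact S.comp_arrow_right_congr hj' _
    · intro m hm
      rw [defect_left h₀ hlt hS, defect_erase h₀ hlt hS _ _ _ _ _ _ (fun h => hne h.2.2),
        defect_right h₀ hlt hS _ _ _ _ _ _ (fun h => hne h.2.2)]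
      · simp
      · rintro ⟨-, -, h⟩
        exact hm (Fin.ext ((nodup_of_pairwise hlt).getElem_inj_iff.1 h).symm)
  isContractibleCone {B _ A} S hS :=
    (DGCategory.isContractibleCone_postcomp
      (hS.isEquivalence _ _ (getElem_lt_last hlt j)
        (fun h => List.ne_nil_of_length_pos (Fin.pos j) h.2.1)
        (fun h => (getElem_lt_last hlt j).ne h.2.2)) _).units_smul _
  isEquivalence {B _ A} S hS hl x y hx hy := by
    have hl' := congrArg List.length hl
    rw [List.length_take, List.length_nil] at hl'
    have hlen : l₀.length = 1 := by omega
    have key := homotopic_of_triangle h₀ (S.update a₀ (l₀.take j) l₀[j] x) hlen j _ _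
      (by simp [hlen]) rfl y rfl hy (isMonotoneSeq_pair (getElem_lt_last hlt j).le)
      (isMonotoneSeq_pair (first_lt_getElem hlt j).le)
      (isMonotoneSeq_pair ((first_lt_getElem hlt j).trans (getElem_lt_last hlt j)).le)
    have hd := S.d_update_arrow_self x (h₀.left j) hx 0 1 (by simp [hl]) (zero_add 1)
    rw [PreSimplex.arrow_congr _ hl _ (isMonotoneSeq_pair (first_lt_getElem hlt j).le) _ _
      (by simp)] at hd ⊢
    have hne := (getElem_lt_last hlt j).ne
    have hne' := List.ne_nil_of_length_pos (Fin.pos j)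
    refine DGCategory.IsEquivalence.of_comp_left key ?_ ?_ hd
    · rw [S.update_arrow_of_ne _ (fun h => hne h.2.2)]
      exact hS.isEquivalence _ _ (getElem_lt_last hlt j) (fun h => hne' h.2.1) (fun h => hne h.2.2)
    · rw [S.update_arrow_of_ne _ (fun h => hne h.2.2)]
      exact hS.isEquivalence _ _ ((first_lt_getElem hlt j).trans (getElem_lt_last hlt j))
        (fun h => hne' h.2.1) (fun h => hne h.2.2)

/-- The system in which the omitted index is neither the first nor the last one. -/
def inner (j : Fin l₀.length) : HornSystem.{u} h₀ (h₀.erase j) where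
  length_eq := by have := j.2; rw [List.length_eraseIdx_of_lt this]; omega
  -- The missing arrow occurs as a face, and faces enter the coherence equation with a minus sign.
  U S q := ((-((l₀.length : ℤ) - 1 - j).negOnePow : ℤˣ) : ℤ) • LinearMap.id
  bdry_update {B _ A} S x hS := by
    rw [PreSimplex.bdry, PreSimplex.bdry, ← sub_eq_iff_eq_add', ← Finset.sum_sub_distrib,
      Fintype.sum_eq_single j]
    · rw [S.update_arrow_self, S.update_arrow_of_ne _ (fun h => (first_lt_getElem hlt j).ne h.1),
        S.update_arrow_of_ne _ (fun h => (getElem_lt_last hlt j).ne' h.2.2), ← smul_sub,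
        hS.arrow_omit, sub_zero, sub_sub_cancel_left, LinearMap.smul_apply, Units.val_neg,
        neg_smul, Units.smul_def, smul_neg]
      rfl
    · intro m hm
      rw [S.update_arrow_of_ne _ (fun h => (first_lt_getElem hlt m).ne h.1),
        S.update_arrow_of_ne _ (fun h => (getElem_lt_last hlt m).ne' h.2.2),
        S.update_arrow_of_ne, sub_self]
      rintro ⟨-, h, -⟩
      exact hm (eraseIdx_injective (nodup_of_pairwise hlt) h).symm
  d_bdry {B _ A} S hS := by
    rw [S.d_bdry h₀ _ (by have := j.2; rw [List.length_eraseIdx_of_lt this]; omega),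
      Fintype.sum_eq_single j]
    · rw [defect_right h₀ hlt hS _ _ _ _ _ _ (fun h => (first_lt_getElem hlt j).ne h.1),
        defect_left h₀ hlt hS _ _ _ _ _ _ (fun h => (getElem_lt_last hlt j).ne' h.2.2),
        hS.arrow_omit, map_zero, LinearMap.zero_apply, map_zero, map_zero, smul_zero, zero_add,
        zero_sub, zero_sub, neg_neg, LinearMap.smul_apply, Units.val_neg, neg_smul, neg_neg,
        Units.smul_def]
      rfl
    · intro m hm
      rw [defect_right h₀ hlt hS _ _ _ _ _ _ (fun h => (first_lt_getElem hlt m).ne h.1),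
        defect_left h₀ hlt hS _ _ _ _ _ _ (fun h => (getElem_lt_last hlt m).ne' h.2.2),
        defect_erase h₀ hlt hS]
      · simp
      · rintro ⟨-, h, -⟩
        exact hm (eraseIdx_injective (nodup_of_pairwise hlt) h).symm
  isContractibleCone {B _ A} S hS :=
    (DGCategory.isContractibleCone_id (S.obj a₀) (S.obj b₀)).units_smul _
  isEquivalence {B _ A} S hS hl x y hx hy := by
    have hl' := congrArg List.length hl
    rw [List.length_eraseIdx_of_lt j.2, List.length_nil] at hl'
    have hlen : l₀.length = 1 := by have := j.2; omega
    have hlt' := (first_lt_getElem hlt j).trans (getElem_lt_last hlt j)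
    have key := homotopic_of_triangle h₀ (S.update a₀ (l₀.eraseIdx j) b₀ x) hlen j _ _
      (by simp [hlen]) rfl y rfl hy (isMonotoneSeq_pair (getElem_lt_last hlt j).le)
      (isMonotoneSeq_pair (first_lt_getElem hlt j).le) (isMonotoneSeq_pair hlt'.le)
    have hd := S.d_update_arrow_self x (h₀.erase j) hx 0 1 (by simp [hl]) (zero_add 1)
    rw [PreSimplex.arrow_congr _ hl _ (isMonotoneSeq_pair hlt'.le) _ _ (by simp)] at hd ⊢
    have hne := List.ne_nil_of_length_pos (Fin.pos j)
    refine DGCategory.IsEquivalence.comp key ?_ ?_ hd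
    · rw [S.update_arrow_of_ne _ (fun h => (first_lt_getElem hlt j).ne h.1)]
      exact hS.isEquivalence _ _ (getElem_lt_last hlt j) (fun h => hne h.2.1)
        (fun h => (first_lt_getElem hlt j).ne h.1)
    · rw [S.update_arrow_of_ne _ (fun h => (getElem_lt_last hlt j).ne' h.2.2)]
      exact hS.isEquivalence _ _ (first_lt_getElem hlt j) (fun h => hne h.2.1)
        (fun h => (getElem_lt_last hlt j).ne' h.2.2)

end HornSystem

/-! ### Filling a horn by solving the linear system -/

theorem pairwise_lt_of_not_isDegenerateSeq {n : ℕ} {a b : Fin (n + 1)} {l : List (Fin (n + 1))}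
    (h : IsMonotoneSeq a l b) (hd : ¬ IsDegenerateSeq a l b) :
    (fullSeq a l b).Pairwise (· < ·) := by
  rw [IsDegenerateSeq, not_not] at hd
  rw [← List.isChain_iff_pairwise]
  rw [IsMonotoneSeq, ← List.isChain_iff_pairwise] at h
  rw [List.isChain_iff_getElem] at *
  exact fun i hi => lt_of_le_of_ne (h i hi) (hd i hi)

theorem not_isDegenerateSeq_of_pairwise_lt {n : ℕ} {a b : Fin (n + 1)} {l : List (Fin (n + 1))}
    (h : (fullSeq a l b).Pairwise (· < ·)) : ¬ IsDegenerateSeq a l b := by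
  rw [IsDegenerateSeq, not_not]
  exact (h.imp ne_of_lt).isChain

theorem DGCategory.isEquivalence_id {B : Type u} [CommRing B] {A : DGCategory B} (x : A.Obj) :
    A.IsEquivalence (A.id x) :=
  ⟨d_id x, A.id x, d_id x, ⟨0, by rw [A.comp_id, map_zero, add_zero]⟩,
    ⟨0, by rw [A.comp_id, map_zero, add_zero]⟩⟩

/-- The presimplex underlying a simplex of the coherent nerve. -/
@[reducible]
def CoherentSimplex.toPre {B : Type u} [CommRing B] {A : DGCategory B} {n : ℕ}
    (σ : CoherentSimplex A n) : PreSimplex A n where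
  obj := σ.obj
  arrow := σ.arrow

theorem CoherentSimplex.toPre_injective {B : Type u} [CommRing B] {A : DGCategory B} {n : ℕ} :
    Function.Injective (CoherentSimplex.toPre (A := A) (n := n)) := by
  rintro ⟨_, _, _, _, _⟩ ⟨_, _, _, _, _⟩ h
  cases h
  rfl

/-- The image of a presimplex under a dg-functor. -/
@[reducible]
def DGFunctor.mapPre {k : Type u} [Field k] {B B' : CommAlgCat.{u} k} {φ : B ⟶ B'}
    {A : DGCategory B} {A' : DGCategory B'} (F : DGFunctor φ A A') {n : ℕ} (S : PreSimplex A n) :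
    PreSimplex A' n where
  obj a := F.obj (S.obj a)
  arrow a l b h p hp := F.map (S.arrow a l b h p hp)

namespace PreSimplex

variable {n : ℕ} {a₀ : Fin (n + 1)} {l₀ : List (Fin (n + 1))} {b₀ : Fin (n + 1)}
  {a₁ : Fin (n + 1)} {l₁ : List (Fin (n + 1))} {b₁ : Fin (n + 1)}

section

variable {k : Type u} [Field k] {B B' : CommAlgCat.{u} k} {φ : B ⟶ B'}
    {A : DGCategory B} {A' : DGCategory B'} (F : DGFunctor φ A A') (S : PreSimplex A n)

theorem map_bdry (a : Fin (n + 1)) (l : List (Fin (n + 1))) (b : Fin (n + 1))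
    (h : IsMonotoneSeq a l b) (q : ℤ) (hq : -(l.length : ℤ) + 1 = q) :
    F.map (S.bdry a l b h q hq) = (F.mapPre S).bdry a l b h q hq := by
  rw [bdry, map_sum]
  refine Finset.sum_congr rfl fun j _ => ?_
  rw [Units.smul_def, Units.smul_def, map_zsmul, map_sub, F.map_comp]

theorem map_update (x : A.Hom (S.obj a₁) (S.obj b₁) (-(l₁.length : ℤ))) :
    F.mapPre (S.update a₁ l₁ b₁ x) = (F.mapPre S).update a₁ l₁ b₁ (F.map x) := by
  unfold DGFunctor.mapPre update
  congr 1
  funext a l b h p hp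
  simp only
  split_ifs with e
  · obtain ⟨rfl, rfl, rfl⟩ := e
    subst hp
    rfl
  · rfl

variable {S}

theorem IsHornFamily.map (hS : S.IsHornFamily a₀ l₀ b₀ a₁ l₁ b₁) :
    (F.mapPre S).IsHornFamily a₀ l₀ b₀ a₁ l₁ b₁ where
  unit a := (congrArg F.map (hS.unit a)).trans (F.map_id _)
  degenerate a l b h p hp hl hd :=
    (congrArg F.map (hS.degenerate a l b h p hp hl hd)).trans (map_zero _)
  arrow_full h p hp := (congrArg F.map (hS.arrow_full h p hp)).trans (map_zero _)
  arrow_omit h p hp := (congrArg F.map (hS.arrow_omit h p hp)).trans (map_zero _)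
  coherence a l b h p q hp hpq hlt h₀ h₁ := by
    rw [← map_bdry, ← hS.coherence a l b h p q hp hpq hlt h₀ h₁, F.map_d]
  isEquivalence a b h h₀ h₁ := F.isEquivalence (hS.isEquivalence a b h h₀ h₁)

end

variable {B : Type u} [CommRing B] {A : DGCategory B} {S : PreSimplex A n}

/-- The cuts and faces of the omitted sequence are shorter than it and therefore coherent, so every
defect in `PreSimplex.d_bdry` is zero. -/
theorem IsHornFamily.d_bdry_omit (hS : S.IsHornFamily a₀ l₀ b₀ a₁ l₁ b₁)
    (hlen : l₁.length + 1 = l₀.length) (hlt : (fullSeq a₁ l₁ b₁).Pairwise (· < ·))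
    (h₁ : IsMonotoneSeq a₁ l₁ b₁) (q r : ℤ) (hq : -(l₁.length : ℤ) + 1 = q) (hqr : q + 1 = r) :
    A.d q r hqr (S.bdry a₁ l₁ b₁ h₁ q hq) = 0 := by
  rw [S.d_bdry h₁ r (by omega)]
  have ne : ∀ {a b : Fin (n + 1)} {l : List (Fin (n + 1))}, l.length < l₁.length →
      ¬ (a₁ = a ∧ l₁ = l ∧ b₁ = b) := by
    rintro a b l h ⟨-, rfl, -⟩
    exact lt_irrefl _ h
  have ne' : ∀ {a b : Fin (n + 1)} {l : List (Fin (n + 1))}, l.length < l₁.length →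
      ¬ (a₀ = a ∧ l₀ = l ∧ b₀ = b) := by
    rintro a b l h ⟨-, rfl, -⟩
    omega
  refine Finset.sum_eq_zero fun j _ => ?_
  have hj := j.2
  have e₁ : (l₁.drop (j + 1)).length < l₁.length := by rw [List.length_drop]; omega
  have e₂ : (l₁.take j).length < l₁.length := by rw [List.length_take]; omega
  have e₃ : (l₁.eraseIdx j).length < l₁.length := by rw [List.length_eraseIdx_of_lt hj]; omega
  rw [hS.coherence _ _ _ _ _ _ _ _ (pairwise_right hlt j) (ne' e₁) (ne e₁),
    hS.coherence _ _ _ _ _ _ _ _ (pairwise_left hlt j) (ne' e₂) (ne e₂),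
    hS.coherence _ _ _ _ _ _ _ _ (pairwise_erase hlt j) (ne' e₃) (ne e₃)]
  simp

end PreSimplex

/-- The sequences `a₀, l₀, b₀` and `a₁, l₁, b₁` are strictly increasing, the first one being the
longest one, and the second one being shorter by one term. -/
structure IsHornPair {n : ℕ} (a₀ : Fin (n + 1)) (l₀ : List (Fin (n + 1))) (b₀ : Fin (n + 1))
    (a₁ : Fin (n + 1)) (l₁ : List (Fin (n + 1))) (b₁ : Fin (n + 1)) : Prop where
  pairwise_full : (fullSeq a₀ l₀ b₀).Pairwise (· < ·)
  pairwise_omit : (fullSeq a₁ l₁ b₁).Pairwise (· < ·)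
  length_eq : l₁.length + 1 = l₀.length
  length_le : ∀ a l b, (fullSeq a l b).Pairwise (· < ·) → ¬ (a₀ = a ∧ l₀ = l ∧ b₀ = b) →
    l.length ≤ l₁.length

theorem IsHornPair.mono₀ {n : ℕ} {a₀ : Fin (n + 1)} {l₀ : List (Fin (n + 1))} {b₀ : Fin (n + 1)}
    {a₁ : Fin (n + 1)} {l₁ : List (Fin (n + 1))} {b₁ : Fin (n + 1)}
    (hP : IsHornPair a₀ l₀ b₀ a₁ l₁ b₁) : IsMonotoneSeq a₀ l₀ b₀ :=
  hP.pairwise_full.imp le_of_lt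

theorem IsHornPair.mono₁ {n : ℕ} {a₀ : Fin (n + 1)} {l₀ : List (Fin (n + 1))} {b₀ : Fin (n + 1)}
    {a₁ : Fin (n + 1)} {l₁ : List (Fin (n + 1))} {b₁ : Fin (n + 1)}
    (hP : IsHornPair a₀ l₀ b₀ a₁ l₁ b₁) : IsMonotoneSeq a₁ l₁ b₁ :=
  hP.pairwise_omit.imp le_of_lt

namespace HornSystem

variable {n : ℕ} {a₀ : Fin (n + 1)} {l₀ : List (Fin (n + 1))} {b₀ : Fin (n + 1)}
  {a₁ : Fin (n + 1)} {l₁ : List (Fin (n + 1))} {b₁ : Fin (n + 1)}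
  (hP : IsHornPair a₀ l₀ b₀ a₁ l₁ b₁) (H : HornSystem.{u} hP.mono₀ hP.mono₁)

section

variable {B : Type u} [CommRing B] {A : DGCategory.{u} B} (S : PreSimplex A n)

/-- The pairs of arrows which may fill a horn. -/
abbrev Pair : Type u :=
  A.Hom (S.obj a₁) (S.obj b₁) (-(l₁.length : ℤ)) × A.Hom (S.obj a₀) (S.obj b₀) (-(l₀.length : ℤ))

/-- The values of the differentials of the pairs of arrows which may fill a horn. -/
abbrev Target : Type u :=
  A.Hom (S.obj a₁) (S.obj b₁) (-(l₁.length : ℤ) + 1) ×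
    A.Hom (S.obj a₀) (S.obj b₀) (-(l₁.length : ℤ))

/-- The linear part of the coherence equations of a filler. -/
def D : Pair (a₀ := a₀) (l₀ := l₀) (b₀ := b₀) (a₁ := a₁) (l₁ := l₁) (b₁ := b₁) S →ₗ[B]
    Target (a₀ := a₀) (b₀ := b₀) (a₁ := a₁) (l₁ := l₁) (b₁ := b₁) S :=
  LinearMap.prod (A.d _ _ rfl ∘ₗ LinearMap.fst B _ _)
    (A.d _ _ (by have := hP.length_eq; omega) ∘ₗ LinearMap.snd B _ _ -
      H.U S _ ∘ₗ LinearMap.fst B _ _)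

/-- The constant part of the coherence equations of a filler. -/
def rhs : Target (a₀ := a₀) (b₀ := b₀) (a₁ := a₁) (l₁ := l₁) (b₁ := b₁) S :=
  (S.bdry a₁ l₁ b₁ hP.mono₁ _ rfl, S.bdry a₀ l₀ b₀ hP.mono₀ _ (by have := hP.length_eq; omega))

variable {S} (hS : S.IsHornFamily a₀ l₀ b₀ a₁ l₁ b₁)

include hS in
-- `D` is a differential of the cone of U, so its values are cocycles; `rhs` is one too, by
-- `d_bdry_omit` and `HornSystem.d_bdry`. The contraction inverts the differential on all of them.
theorem exists_contraction :
    ∃ c : Target (a₀ := a₀) (b₀ := b₀) (a₁ := a₁) (l₁ := l₁) (b₁ := b₁) S →ₗ[B]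
      Pair (a₀ := a₀) (l₀ := l₀) (b₀ := b₀) (a₁ := a₁) (l₁ := l₁) (b₁ := b₁) S,
      (∀ x, D hP H S (c (D hP H S x)) = D hP H S x) ∧ D hP H S (c (rhs hP S)) = rhs hP S := by
  have hU := H.isContractibleCone S hS
  obtain ⟨c, hc⟩ := hU.exists_contraction (-(l₀.length : ℤ)) (-(l₁.length : ℤ)) _ _
    (by have := hP.length_eq; omega) rfl rfl
  refine ⟨c, fun x => ?_, ?_⟩
  · obtain ⟨e₁, e₂⟩ := hc (D hP H S x) (A.d_d _ _ _ _ _ _) (by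
      change A.d _ _ _ (A.d _ _ _ x.2 - H.U S _ x.1) + H.U S _ (A.d _ _ _ x.1) = 0
      rw [map_sub, A.d_d, hU.d_apply, zero_sub, neg_add_cancel])
    exact Prod.ext e₁ e₂
  · obtain ⟨e₁, e₂⟩ := hc (rhs hP S) 
      (hS.d_bdry_omit hP.length_eq hP.pairwise_omit hP.mono₁ _ _ rfl _) 
      (eq_neg_iff_add_eq_zero.1 (H.d_bdry S hS))
    exact Prod.ext e₁ e₂

/-- The presimplex obtained by filling a horn. -/
@[reducible]
def fill (S : PreSimplex A n)
    (x : Pair (a₀ := a₀) (l₀ := l₀) (b₀ := b₀) (a₁ := a₁) (l₁ := l₁) (b₁ := b₁) S) :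
    PreSimplex A n :=
  (S.update a₁ l₁ b₁ x.1).update a₀ l₀ b₀ x.2

variable (x : Pair (a₀ := a₀) (l₀ := l₀) (b₀ := b₀) (a₁ := a₁) (l₁ := l₁) (b₁ := b₁) S)

theorem fill_arrow_of_ne {a b : Fin (n + 1)} {l : List (Fin (n + 1))}
    (hne₀ : ¬ (a₀ = a ∧ l₀ = l ∧ b₀ = b)) (hne₁ : ¬ (a₁ = a ∧ l₁ = l ∧ b₁ = b))
    (h : IsMonotoneSeq a l b) (p : ℤ) (hp : p = -(l.length : ℤ)) :
    (fill S x).arrow a l b h p hp = S.arrow a l b h p hp := by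
  rw [PreSimplex.update_arrow_of_ne _ _ hne₀, PreSimplex.update_arrow_of_ne _ _ hne₁]

include hP in
theorem fill_arrow_omit (h : IsMonotoneSeq a₁ l₁ b₁) :
    (fill S x).arrow a₁ l₁ b₁ h _ rfl = x.1 := by
  rw [PreSimplex.update_arrow_of_ne, PreSimplex.update_arrow_self]
  rintro ⟨-, h, -⟩
  have := congrArg List.length h
  have := hP.length_eq
  omega

theorem fill_arrow_full (h : IsMonotoneSeq a₀ l₀ b₀) :
    (fill S x).arrow a₀ l₀ b₀ h _ rfl = x.2 :=
  PreSimplex.update_arrow_self _ _ _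

/-- The simplex obtained by filling a horn. -/
def fillSimplex (hx : D hP H S x = rhs hP S) : CoherentSimplex A n := by
  have hlt₀ := not_isDegenerateSeq_of_pairwise_lt hP.pairwise_full
  have hlt₁ := not_isDegenerateSeq_of_pairwise_lt hP.pairwise_omit
  have hunit : ∀ a, (fill S x).arrow a [] a (isMonotoneSeq_pair le_rfl) 0 (by simp) =
      A.id (S.obj a) := by
    intro a
    have hd : IsDegenerateSeq a [] a := by simp [IsDegenerateSeq, fullSeq]
    rw [fill_arrow_of_ne, hS.unit]
    · rintro ⟨rfl, rfl, rfl⟩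
      exact hlt₀ hd
    · rintro ⟨rfl, rfl, rfl⟩
      exact hlt₁ hd
  have hdeg : ∀ a l b (h : IsMonotoneSeq a l b) (p : ℤ) (hp : p = -(l.length : ℤ)),
      l ≠ [] → IsDegenerateSeq a l b → (fill S x).arrow a l b h p hp = 0 := by
    intro a l b h p hp hl hd
    rw [fill_arrow_of_ne, hS.degenerate a l b h p hp hl hd]
    · rintro ⟨rfl, rfl, rfl⟩
      exact hlt₀ hd
    · rintro ⟨rfl, rfl, rfl⟩
      exact hlt₁ hd
  refine
    { obj := S.obj
      arrow := (fill S x).arrow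
      unit := hunit
      degenerate := hdeg
      coherence := ?_ }
  intro a l b h p q hp hpq
  change A.d p q hpq ((fill S x).arrow a l b h p hp) =
    (fill S x).bdry a l b h q (by rw [← hp, hpq])
  have hlen := hP.length_eq
  -- The full and the omitted sequence use the two components of the system. Degenerate sequences
  -- have zero on both sides. All others are horn sequences no longer than `l₁`, whose boundary does
  -- not see the new arrows.
  by_cases h₀ : a₀ = a ∧ l₀ = l ∧ b₀ = b
  · obtain ⟨rfl, rfl, rfl⟩ := h₀
    obtain rfl : q = -(l₁.length : ℤ) := by omega
    subst hp
    rw [fill_arrow_full, PreSimplex.bdry_update_of_length_le _ _ le_rfl, H.bdry_update _ _ hS]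
    have := congrArg Prod.snd hx
    exact sub_eq_iff_eq_add.1 this
  by_cases h₁ : a₁ = a ∧ l₁ = l ∧ b₁ = b
  · obtain ⟨rfl, rfl, rfl⟩ := h₁
    subst hp hpq
    rw [fill_arrow_omit hP, PreSimplex.bdry_update_of_length_le _ _ (by omega),
      PreSimplex.bdry_update_of_length_le _ _ le_rfl]
    exact congrArg Prod.fst hx
  by_cases hd : IsDegenerateSeq a l b
  · by_cases hl : l = []
    · subst hl
      obtain rfl : a = b := by simpa [IsDegenerateSeq, fullSeq] using hd
      obtain rfl : p = 0 := by simpa using hp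
      obtain rfl : q = 1 := by omega
      rw [hunit, DGCategory.d_id]
      rfl
    · rw [hdeg _ _ _ _ _ _ hl hd, map_zero,
        PreSimplex.bdry_eq_zero_of_isDegenerateSeq _ hunit hdeg _ _ _ hd]
  · have hlt := pairwise_lt_of_not_isDegenerateSeq h hd
    have := hP.length_le a l b hlt h₀
    rw [fill_arrow_of_ne _ h₀ h₁, hS.coherence _ _ _ _ _ _ _ _ hlt h₀ h₁,
      PreSimplex.bdry_update_of_length_le _ _ (by omega),
      PreSimplex.bdry_update_of_length_le _ _ this]

/-- Diagonal edges are identities and horn edges are equivalences already. The omitted sequence is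
an edge only when `l₁` is empty; two-out-of-three for the filled triangle then applies. -/
theorem isEquivalence_fillSimplex (hx : D hP H S x = rhs hP S) (a b : Fin (n + 1)) (h : a ≤ b) :
    A.IsEquivalence
      ((fillSimplex hP H hS x hx).arrow a [] b (isMonotoneSeq_pair h) 0 (by simp)) := by
  have hlen := hP.length_eq
  rcases h.eq_or_lt with rfl | hlt
  · rw [(fillSimplex hP H hS x hx).unit]
    exact DGCategory.isEquivalence_id _
  change A.IsEquivalence ((fill S x).arrow a [] b (isMonotoneSeq_pair h) 0 (by simp))
  have h₀ : ¬ (a₀ = a ∧ l₀ = [] ∧ b₀ = b) := by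
    rintro ⟨-, h, -⟩
    rw [h, List.length_nil] at hlen
    omega
  by_cases h₁ : a₁ = a ∧ l₁ = [] ∧ b₁ = b
  · rw [PreSimplex.update_arrow_of_ne _ _ h₀]
    obtain ⟨rfl, hl, rfl⟩ := h₁
    have key := H.isEquivalence S hS hl x.1 x.2
    rw [PreSimplex.arrow_congr _ hl _ (isMonotoneSeq_pair h) _ _ (by simp)] at key
    refine key ?_ ?_
    · have hb : ∀ q hq, S.bdry a₁ l₁ b₁ hP.mono₁ q hq = 0 := by
        intro q hq
        rw [PreSimplex.bdry]
        refine Finset.sum_eq_zero fun j _ => ?_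
        have := j.2
        simp [hl] at this
      exact (congrArg Prod.fst hx).trans (hb _ rfl)
    · have h₂ := sub_eq_iff_eq_add.1 (congrArg Prod.snd hx)
      have h₃ := H.bdry_update _ x.1 hS
      have : ∀ (q : ℤ) (hq : -(l₀.length : ℤ) + 1 = q), A.d _ _ hq x.2 =
          (S.update a₁ l₁ b₁ x.1).bdry a₀ l₀ b₀ hP.mono₀ q hq := by
        intro q hq
        obtain rfl : q = -(l₁.length : ℤ) := by omega
        exact h₂.trans h₃.symm
      exact this _ rfl
  · rw [fill_arrow_of_ne _ h₀ h₁]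
    exact hS.isEquivalence _ _ hlt h₀ h₁

end

end HornSystem

/-! ### Base change of the linear system -/

namespace HornSystem

variable {n : ℕ} {a₀ : Fin (n + 1)} {l₀ : List (Fin (n + 1))} {b₀ : Fin (n + 1)}
  {a₁ : Fin (n + 1)} {l₁ : List (Fin (n + 1))} {b₁ : Fin (n + 1)}
  (hP : IsHornPair a₀ l₀ b₀ a₁ l₁ b₁) (H : HornSystem.{u} hP.mono₀ hP.mono₁)
  {k : Type u} [Field k] {B B' : CommAlgCat.{u} k} {φ : B ⟶ B'}
  {A : DGCategory.{u} B} {A' : DGCategory.{u} B'} (F : DGFunctor φ A A') (S : PreSimplex A n)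

/-- The map induced by a dg-functor on the pairs of arrows which may fill a horn. -/
abbrev mapPair : Pair (a₀ := a₀) (l₀ := l₀) (b₀ := b₀) (a₁ := a₁) (l₁ := l₁) (b₁ := b₁) S →+
    Pair (a₀ := a₀) (l₀ := l₀) (b₀ := b₀) (a₁ := a₁) (l₁ := l₁) (b₁ := b₁) (F.mapPre S) :=
  F.map.prodMap F.map

/-- The map induced by a dg-functor on the values of the differentials. -/
abbrev mapTarget : Target (a₀ := a₀) (b₀ := b₀) (a₁ := a₁) (l₁ := l₁) (b₁ := b₁) S →+
    Target (a₀ := a₀) (b₀ := b₀) (a₁ := a₁) (l₁ := l₁) (b₁ := b₁) (F.mapPre S) :=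
  F.map.prodMap F.map

theorem map_rhs : mapTarget F S (rhs hP S) = rhs hP (F.mapPre S) :=
  Prod.ext (PreSimplex.map_bdry F S a₁ l₁ b₁ hP.mono₁ _ rfl)
    (PreSimplex.map_bdry F S a₀ l₀ b₀ hP.mono₀ _ (by have := hP.length_eq; omega))

variable {S} (hS : S.IsHornFamily a₀ l₀ b₀ a₁ l₁ b₁)

include hS

/-- Naturality of `U` need not be assumed: `bdry_update` characterizes `U` as a difference of two
boundaries, and dg-functors preserve boundaries. -/
theorem map_U (x : A.Hom (S.obj a₁) (S.obj b₁) (-(l₁.length : ℤ))) :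
    H.U (F.mapPre S) _ (F.map x) = F.map (H.U S _ x) := by
  have h := congrArg F.map (H.bdry_update S x hS)
  have h' := H.bdry_update (F.mapPre S) (F.map x) (hS.map F)
  have e := PreSimplex.map_bdry F S a₀ l₀ b₀ hP.mono₀ (-(l₁.length : ℤ))
    (by have := hP.length_eq; omega)
  rw [map_add, PreSimplex.map_bdry] at h
  -- The two presimplices have the same objects definitionally but are only propositionally equal,
  -- so the equality of boundaries is obtained as a heterogeneous one and then converted.
  have e' := congr_arg_heq
    (fun T : PreSimplex A' n => T.bdry a₀ l₀ b₀ hP.mono₀ (-(l₁.length : ℤ))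
      (by have := hP.length_eq; omega)) (PreSimplex.map_update F S x)
  exact add_left_cancel (h'.symm.trans ((eq_of_heq e').symm.trans
    (h.trans (congrArg (· + _) e))))

theorem map_D (x : Pair (a₀ := a₀) (l₀ := l₀) (b₀ := b₀) (a₁ := a₁) (l₁ := l₁) (b₁ := b₁) S) :
    D hP H (F.mapPre S) (mapPair F S x) = mapTarget F S (D hP H S x) := by
  refine Prod.ext (F.map_d _ _ _ _).symm ?_
  change A'.d _ _ _ (F.map x.2) - H.U (F.mapPre S) _ (F.map x.1) =
    F.map (A.d _ _ _ x.2 - H.U S _ x.1)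
  rw [map_sub, F.map_d, map_U hP H F hS]

/-- The fillers of a horn are parametrized, compatibly with base change, by the fixed vectors of
an idempotent matrix. -/
theorem exists_parametrization (hfin : ∀ x y i, Module.Finite B (A.Hom x y i))
    (hproj : ∀ x y i, Module.Projective B (A.Hom x y i)) :
    ∃ (r : ℕ) (P : Matrix (Fin r) (Fin r) B)
      (c : Pair (a₀ := a₀) (l₀ := l₀) (b₀ := b₀) (a₁ := a₁) (l₁ := l₁) (b₁ := b₁) S)
      (z : Fin r → Pair (a₀ := a₀) (l₀ := l₀) (b₀ := b₀) (a₁ := a₁) (l₁ := l₁) (b₁ := b₁) S),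
      P * P = P ∧
      ∀ (B' : CommAlgCat.{u} k) (φ : B ⟶ B') (A' : DGCategory.{u} B') (F : DGFunctor φ A A'),
        (∀ x y i, IsScalarExtension φ.hom.toRingHom (F.map (x := x) (y := y) (i := i))
          F.map_smul) →
        (∀ v : Fin r → B', D hP H (F.mapPre S) (mapPair F S c + ∑ j, v j • mapPair F S (z j)) =
          rhs hP (F.mapPre S)) ∧
        ∀ y, D hP H (F.mapPre S) y = rhs hP (F.mapPre S) →
          ∃! v : Fin r → B', (P.map φ.hom.toRingHom).mulVec v = v ∧
            mapPair F S c + ∑ j, v j • mapPair F S (z j) = y := by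
  obtain ⟨c, hc, hc'⟩ := exists_contraction hP H hS
  have := hfin
  have := hproj
  obtain ⟨r, P, z, hPP, key⟩ := exists_idempotent_of_split (D hP H S) c hc
  refine ⟨r, P, c (rhs hP S), z, hPP, fun B' φ A' F hF => ?_⟩
  obtain ⟨k₁, k₂⟩ := key B' _ _ φ.hom.toRingHom (mapPair F S) (mapTarget F S)
    (fun b x => Prod.ext (F.map_smul b x.1) (F.map_smul b x.2))
    (fun b x => Prod.ext (F.map_smul b x.1) (F.map_smul b x.2)) (D hP H (F.mapPre S))
    (IsScalarExtension.prodMap (hF _ _ _) (hF _ _ _))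
    (IsScalarExtension.prodMap (hF _ _ _) (hF _ _ _)) (map_D hP H F hS)
  -- The image of the particular solution over B solves the system over B'; translating by it
  -- reduces to the homogeneous system.
  have hc₀ : D hP H (F.mapPre S) (mapPair F S (c (rhs hP S))) = rhs hP (F.mapPre S) := by
    rw [map_D hP H F hS, hc', map_rhs]
  refine ⟨fun v => by rw [map_add, k₁, add_zero, hc₀], fun y hy => ?_⟩
  obtain ⟨v, ⟨h₁, h₂⟩, h₃⟩ := k₂ (y - mapPair F S (c (rhs hP S))) (by
    rw [map_sub, hy, hc₀, sub_self])
  refine ⟨v, ⟨h₁, ?_⟩, fun w hw => h₃ w ⟨hw.1, ?_⟩⟩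
  · rw [h₂, add_sub_cancel]
  · rw [← hw.2, add_sub_cancel_left]

end HornSystem

/-! ### Index sequences missing from a horn -/

section Sequences

theorem fullSeq_map {m n : ℕ} (f : Fin (m + 1) → Fin (n + 1)) (a : Fin (m + 1))
    (l : List (Fin (m + 1))) (b : Fin (m + 1)) :
    fullSeq (f a) (l.map f) (f b) = (fullSeq a l b).map f := by
  simp [fullSeq]

/-- The list of the elements of `Fin (m + 2)` different from the first one and from the last
one. -/
def innerSeq (m : ℕ) : List (Fin (m + 2)) :=
  (List.finRange m).map fun j => j.castSucc.succ

theorem length_innerSeq (m : ℕ) : (innerSeq m).length = m := by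
  simp [innerSeq]

theorem fullSeq_innerSeq (m : ℕ) :
    fullSeq 0 (innerSeq m) (Fin.last (m + 1)) = List.finRange (m + 2) := by
  rw [List.finRange_succ, List.finRange_succ_last, fullSeq, innerSeq]
  simp [Function.comp_def]

theorem pairwise_innerSeq (m : ℕ) :
    (fullSeq 0 (innerSeq m) (Fin.last (m + 1))).Pairwise (· < ·) := by
  rw [fullSeq_innerSeq]
  exact (List.sortedLT_finRange _).pairwise

theorem isMonotoneSeq_innerSeq (m : ℕ) : IsMonotoneSeq 0 (innerSeq m) (Fin.last (m + 1)) :=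
  (pairwise_innerSeq m).imp le_of_lt

variable {n : ℕ} {a b : Fin (n + 1)} {l : List (Fin (n + 1))}

/-- The monotone map given by a monotone sequence. -/
def seqHom (h : IsMonotoneSeq a l b) {m : ℕ} (hm : l.length = m) :
    Fin (m + 2) →o Fin (n + 1) where
  toFun j := (fullSeq a l b)[j]'(by rw [length_fullSeq]; omega)
  monotone' := fun i j hij => by
    rcases hij.eq_or_lt with rfl | hij
    · exact le_rfl
    · exact List.pairwise_iff_getElem.1 h _ _ _ _ hij

theorem map_seqHom (h : IsMonotoneSeq a l b) {m : ℕ} (hm : l.length = m) :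
    (List.finRange (m + 2)).map (seqHom h hm) = fullSeq a l b := by
  refine List.ext_getElem (by simp [length_fullSeq, hm]) fun i _ _ => ?_
  simp [seqHom]

theorem exists_lift (h : IsMonotoneSeq a l b) {m : ℕ} (f : Fin (m + 1) → Fin (n + 1))
    (hf : StrictMono f) (hj : ∀ x ∈ fullSeq a l b, ∃ y, f y = x) :
    ∃ a' l' b', IsMonotoneSeq a' l' b' ∧ f a' = a ∧ l'.map f = l ∧ f b' = b := by
  obtain ⟨a', ha⟩ := hj a (by simp [fullSeq])
  obtain ⟨b', hb⟩ := hj b (by simp [fullSeq])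
  obtain ⟨l', hl⟩ : l ∈ Set.range (List.map f) := by
    rw [Set.range_list_map]
    exact fun x hx => hj x (by simp [fullSeq, hx])
  refine ⟨a', l', b', ?_, ha, hl, hb⟩
  subst ha hb hl
  rw [IsMonotoneSeq, fullSeq_map, List.pairwise_map] at h
  exact h.imp fun h => hf.le_iff_le.1 h

/-- A strictly increasing sequence containing all the indices different from `i` is either the full
one or the one omitting `i`. -/
theorem eq_or_eq_of_forall_mem {m : ℕ} {i : Fin m} {s t : List (Fin m)}
    (hs : s.Pairwise (· < ·)) (ht : t.Pairwise (· < ·)) (hti : ∀ j, j ∈ t ↔ j ≠ i)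
    (h : ∀ j, j ≠ i → j ∈ s) : s = List.finRange m ∨ s = t := by
  by_cases hi : i ∈ s
  · refine Or.inl (hs.eq_of_mem_iff (List.sortedLT_finRange _).pairwise fun j => ?_)
    by_cases hj : j = i
    · simp [hj, hi]
    · simp [h j hj]
  · refine Or.inr (hs.eq_of_mem_iff ht fun j => ?_)
    rw [hti]
    exact ⟨by rintro hj rfl; exact hi hj, h j⟩

theorem length_lt_of_ne_finRange {m : ℕ} {s : List (Fin m)} (hs : s.Pairwise (· < ·))
    (h : s ≠ List.finRange m) : s.length < m := by
  by_contra! hm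
  refine h (hs.eq_of_mem_iff (List.sortedLT_finRange _).pairwise fun j => ?_)
  have hnd : s.Nodup := hs.imp ne_of_lt
  have hc : s.toFinset = Finset.univ := by
    rw [← Finset.card_eq_iff_eq_univ, List.toFinset_card_of_nodup hnd, Fintype.card_fin]
    exact le_antisymm (by simpa using hnd.length_le_card) hm
  simp [← List.mem_toFinset, hc]

theorem mem_eraseIdx_finRange {m : ℕ} (i j : Fin m) :
    j ∈ (List.finRange m).eraseIdx i ↔ j ≠ i := by
  rw [List.mem_eraseIdx_iff_getElem]
  constructor
  · rintro ⟨x, hx, hxi, rfl⟩ h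
    exact hxi (by simpa using congrArg Fin.val h)
  · intro h
    exact ⟨j, by simp, fun e => h (Fin.ext e), by simp⟩

variable {m : ℕ} {i : Fin (m + 3)} {a₁ b₁ : Fin (m + 3)} {l₁ : List (Fin (m + 3))}

theorem isHornPair_of_fullSeq_eq (h : fullSeq a₁ l₁ b₁ = (List.finRange (m + 3)).eraseIdx i) :
    IsHornPair 0 (innerSeq (m + 1)) (Fin.last (m + 2)) a₁ l₁ b₁ := by
  have hl : l₁.length = m := by
    have := congrArg List.length h
    rw [length_fullSeq, List.length_eraseIdx_of_lt (by simp)] at this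
    simpa using this
  refine ⟨pairwise_innerSeq _, ?_, by rw [hl, length_innerSeq], fun a l b hp hne => ?_⟩
  · rw [h]
    exact (List.sortedLT_finRange _).pairwise.sublist (List.eraseIdx_sublist _ _)
  · rw [← fullSeq_inj, fullSeq_innerSeq] at hne
    have := length_lt_of_ne_finRange hp (Ne.symm hne)
    rw [length_fullSeq] at this
    omega

/-- A strictly increasing sequence lies in the horn as soon as it avoids some j ≠ i; if it avoids
none, it contains every vertex except possibly i, which leaves two sequences. -/
theorem eq_or_eq_or_exists_notMem (h : fullSeq a₁ l₁ b₁ = (List.finRange (m + 3)).eraseIdx i)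
    {a b : Fin (m + 3)} {l : List (Fin (m + 3))} (hp : (fullSeq a l b).Pairwise (· < ·)) :
    (0 = a ∧ innerSeq (m + 1) = l ∧ Fin.last (m + 2) = b) ∨ (a₁ = a ∧ l₁ = l ∧ b₁ = b) ∨
      ∃ j, j ≠ i ∧ j ∉ fullSeq a l b := by
  rw [← fullSeq_inj, ← fullSeq_inj, fullSeq_innerSeq, ← or_assoc, or_iff_not_imp_right]
  intro hn
  push Not at hn
  refine (eq_or_eq_of_forall_mem hp (isHornPair_of_fullSeq_eq h).pairwise_omit (fun j => ?_)
    hn).imp Eq.symm Eq.symm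
  rw [h, mem_eraseIdx_finRange]

theorem exists_hornSystem (i : Fin (m + 3)) : ∃ (a₁ b₁ : Fin (m + 3)) (l₁ : List (Fin (m + 3)))
    (h : fullSeq a₁ l₁ b₁ = (List.finRange (m + 3)).eraseIdx i),
    Nonempty (HornSystem.{u} (isHornPair_of_fullSeq_eq h).mono₀
      (isHornPair_of_fullSeq_eq h).mono₁) := by
  have hlen := length_innerSeq (m + 1)
  by_cases h₀ : (i : ℕ) = 0
  · refine ⟨_, _, _, ?_, ⟨HornSystem.right _ (pairwise_innerSeq (m + 1)) ⟨0, by omega⟩ rfl⟩⟩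
    rw [fullSeq_right, fullSeq_innerSeq, h₀]
    simp
  by_cases h₁ : (i : ℕ) = m + 2
  · refine ⟨_, _, _, ?_, ⟨HornSystem.left _ (pairwise_innerSeq (m + 1)) ⟨m, by omega⟩
      (by simp [hlen])⟩⟩
    rw [fullSeq_left, fullSeq_innerSeq, h₁, List.eraseIdx_eq_take_drop_succ]
    simp
  -- Interior positions start at vertex 1, so vertex i sits at position i - 1 of `innerSeq`.
  · refine ⟨_, _, _, ?_, ⟨HornSystem.inner _ (pairwise_innerSeq (m + 1)) ⟨i - 1, by omega⟩⟩⟩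
    rw [fullSeq_eraseIdx, fullSeq_innerSeq]
    congr 1
    simp
    omega

end Sequences

/-! ### From maps out of a horn to presimplices -/

namespace PreSimplex

variable {B : Type u} [CommRing B] {A : DGCategory B} {n : ℕ}

/-- An arrow of a presimplex, together with its source, its target and its degree. -/
@[reducible]
def tot (S : PreSimplex A n) (a : Fin (n + 1)) (l : List (Fin (n + 1))) (b : Fin (n + 1))
    (h : IsMonotoneSeq a l b) : (x : A.Obj) × (y : A.Obj) × (p : ℤ) × A.Hom x y p :=
  ⟨S.obj a, S.obj b, -(l.length : ℤ), S.arrow a l b h _ rfl⟩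

theorem mk_arrow_eq_tot (S : PreSimplex A n) {a : Fin (n + 1)} {l : List (Fin (n + 1))}
    {b : Fin (n + 1)} (h : IsMonotoneSeq a l b) (p : ℤ) (hp : p = -(l.length : ℤ)) :
    (⟨S.obj a, S.obj b, p, S.arrow a l b h p hp⟩ :
      (x : A.Obj) × (y : A.Obj) × (p : ℤ) × A.Hom x y p) = S.tot a l b h := by
  subst hp
  rfl

theorem tot_congr (S : PreSimplex A n) {a a' : Fin (n + 1)} {l l' : List (Fin (n + 1))}
    {b b' : Fin (n + 1)} (e : fullSeq a l b = fullSeq a' l' b') (h : IsMonotoneSeq a l b)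
    (h' : IsMonotoneSeq a' l' b') : S.tot a l b h = S.tot a' l' b' h' := by
  obtain ⟨rfl, rfl, rfl⟩ := fullSeq_inj.1 e
  rfl

/-- Bundling source, target and degree with an arrow allows comparison of arrows between objects
that are only propositionally equal; equality of objects is read off from the pairs (a,a). -/
theorem ext_tot {S T : PreSimplex A n} (h : ∀ a l b h, S.tot a l b h = T.tot a l b h) :
    S = T := by
  obtain ⟨o, f⟩ := S
  obtain ⟨o', f'⟩ := T
  obtain rfl : o = o' := by
    funext a
    exact congrArg Sigma.fst (h a [] a (isMonotoneSeq_pair le_rfl))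
  congr 1
  funext a l b hs p hp
  subst hp
  simpa [tot] using h a l b hs

/-- The pullback of a presimplex along a monotone map. -/
@[reducible]
def pullback {m : ℕ} (f : Fin (m + 1) →o Fin (n + 1)) (S : PreSimplex A n) : PreSimplex A m where
  obj a := S.obj (f a)
  arrow a l b h p hp := S.arrow (f a) (l.map f) (f b) (h.map f) p (by simpa using hp)

theorem tot_pullback {m : ℕ} (f : Fin (m + 1) →o Fin (n + 1)) (S : PreSimplex A n)
    (a : Fin (m + 1)) (l : List (Fin (m + 1))) (b : Fin (m + 1)) (h : IsMonotoneSeq a l b) :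
    (S.pullback f).tot a l b h = S.tot (f a) (l.map f) (f b) (h.map f) :=
  S.mk_arrow_eq_tot _ _ _

theorem bdry_pullback {m : ℕ} (f : Fin (m + 1) →o Fin (n + 1)) (S : PreSimplex A n)
    {a : Fin (m + 1)} {l : List (Fin (m + 1))} {b : Fin (m + 1)} (h : IsMonotoneSeq a l b) (q : ℤ)
    (hq : -(l.length : ℤ) + 1 = q) :
    (S.pullback f).bdry a l b h q hq =
      S.bdry (f a) (l.map f) (f b) (h.map f) q (by simpa using hq) := by
  refine Fintype.sum_equiv (finCongr (by simp)) _ _ ?_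
  intro j
  congr 1
  · simp
  · congr 1
    · apply S.comp_arrow_congr <;> simp [List.map_take, List.map_drop]
    · apply S.arrow_congr
      simp [List.eraseIdx_map]

end PreSimplex

/-- The monotone map underlying a simplex of a horn. -/
@[reducible]
def hornMap {n : ℕ} {i : Fin (n + 1)} {m : ℕ} (s : (Λ[n, i] : SSet.{u}).obj (op ⦋m⦌)) :
    Fin (m + 1) →o Fin (n + 1) :=
  (SSet.stdSimplex.objEquiv s.1).toOrderHom

theorem hornMap_injective {n : ℕ} {i : Fin (n + 1)} {m : ℕ} :
    Function.Injective (hornMap.{u} (n := n) (i := i) (m := m)) :=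
  fun _ _ h => Subtype.ext (SSet.stdSimplex.objEquiv.injective (SimplexCategory.Hom.ext _ _ h))

/-- The restriction of a simplex of a horn along a monotone map. -/
@[reducible]
def hornRestrict {n : ℕ} {i : Fin (n + 1)} {m m' : ℕ}
    (s : (Λ[n, i] : SSet.{u}).obj (op ⦋m⦌)) (t : Fin (m' + 1) →o Fin (m + 1)) :
    (Λ[n, i] : SSet.{u}).obj (op ⦋m'⦌) :=
  (Λ[n, i] : SSet.{u}).map (SimplexCategory.mkHom t).op s

theorem hornMap_hornRestrict {n : ℕ} {i : Fin (n + 1)} {m m' : ℕ}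
    (s : (Λ[n, i] : SSet.{u}).obj (op ⦋m⦌)) (t : Fin (m' + 1) →o Fin (m + 1)) :
    hornMap (hornRestrict s t) =
      (hornMap s).comp t :=
  rfl

theorem exists_notMem_range_hornMap {n : ℕ} {i : Fin (n + 1)} {m : ℕ}
    (s : (Λ[n, i] : SSet.{u}).obj (op ⦋m⦌)) : ∃ j, j ≠ i ∧ j ∉ Set.range (hornMap s) := by
  obtain ⟨j, hj, h⟩ := (SSet.mem_horn_iff_notMem_range _ _).1 s.2
  exact ⟨j, hj, h⟩

theorem exists_hornMap_eq {n : ℕ} {i j : Fin (n + 1)} (hj : j ≠ i) {m : ℕ}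
    (t : Fin (m + 1) →o Fin (n + 1)) (h : j ∉ Set.range t) :
    ∃ s : (Λ[n, i] : SSet.{u}).obj (op ⦋m⦌), hornMap s = t :=
  ⟨⟨SSet.stdSimplex.objMk t, (SSet.mem_horn_iff_notMem_range _ _).2 ⟨j, hj, h⟩⟩, rfl⟩

/-- With at least three vertices, each vertex lies on a face of the horn; this is where n ≥ 2
enters. -/
theorem exists_ne_ne {n : ℕ} (a i : Fin (n + 3)) : ∃ j, j ≠ i ∧ j ≠ a := by
  obtain ⟨j, hj⟩ := Finset.exists_mem_notMem_of_card_lt_card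
    (s := {i, a}) (t := (Finset.univ : Finset (Fin (n + 3)))) (by
      rw [Finset.card_univ, Fintype.card_fin]
      exact Finset.card_le_two.trans_lt (by omega))
  exact ⟨j, by simpa using hj.2⟩

section

variable {B : Type u} [CommRing B] {A : DGCategory.{u} B} {n : ℕ} {i : Fin (n + 1)}
  (g : (Λ[n, i] : SSet.{u}) ⟶ (equivNerve A : SSet.{u}))

/-- The presimplex underlying the image of a simplex of a horn. -/
@[reducible]
def hornPre {m : ℕ} (s : (Λ[n, i] : SSet.{u}).obj (op ⦋m⦌)) : PreSimplex A m :=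
  CoherentSimplex.toPre (g.app _ s).1

theorem hornPre_hornRestrict {m m' : ℕ} (s : (Λ[n, i] : SSet.{u}).obj (op ⦋m⦌))
    (t : Fin (m' + 1) →o Fin (m + 1)) :
    hornPre g (hornRestrict s t) =
      (hornPre g s).pullback t :=
  congrArg (fun x => CoherentSimplex.toPre (Subtype.val x)) (NatTrans.naturality_apply g _ s)

/-- An arrow indexed by a sequence is the top arrow of the simplex restricted along that sequence.
Two sequences with the same image in the standard simplex give the same restricted simplex of the
horn. -/
theorem tot_hornPre_congr {m m' : ℕ} (s : (Λ[n, i] : SSet.{u}).obj (op ⦋m⦌))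
    (s' : (Λ[n, i] : SSet.{u}).obj (op ⦋m'⦌)) {a b : Fin (m + 1)} {l : List (Fin (m + 1))}
    {a' b' : Fin (m' + 1)} {l' : List (Fin (m' + 1))} (h : IsMonotoneSeq a l b)
    (h' : IsMonotoneSeq a' l' b')
    (e : (fullSeq a l b).map (hornMap s) = (fullSeq a' l' b').map (hornMap s')) :
    (hornPre g s).tot a l b h = (hornPre g s').tot a' l' b' h' := by
  have key : ∀ {m : ℕ} (s : (Λ[n, i] : SSet.{u}).obj (op ⦋m⦌)) {a b : Fin (m + 1)}
      {l : List (Fin (m + 1))} (h : IsMonotoneSeq a l b) {L : ℕ} (hL : l.length = L),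
      (hornPre g s).tot a l b h = (hornPre g (hornRestrict s (seqHom h hL))).tot 0 (innerSeq L)
          (Fin.last (L + 1)) (isMonotoneSeq_innerSeq L) := by
    intro m s a b l h L hL
    rw [hornPre_hornRestrict, PreSimplex.tot_pullback]
    refine PreSimplex.tot_congr _ ?_ _ _
    rw [fullSeq_map, fullSeq_innerSeq, map_seqHom]
  have hl : l'.length = l.length := by
    have := congrArg List.length e
    simp only [List.length_map, length_fullSeq] at this
    omega
  rw [key s h rfl, key s' h' hl]
  have : hornRestrict s (seqHom h rfl) =
      hornRestrict s' (seqHom h' hl) := by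
    refine hornMap_injective ?_
    rw [hornMap_hornRestrict, hornMap_hornRestrict]
    refine OrderHom.ext _ _ (List.ofFn_injective ?_)
    rw [List.ofFn_eq_map, List.ofFn_eq_map, OrderHom.comp_coe, OrderHom.comp_coe,
      ← List.map_map, ← List.map_map, map_seqHom, map_seqHom, e]
  rw [this]

end

section

variable {B : Type u} [CommRing B] {A : DGCategory.{u} B} {m : ℕ} {i : Fin (m + 3)}
  (g : (Λ[m + 2, i] : SSet.{u}) ⟶ (equivNerve A : SSet.{u}))

/-- A horn in the nerve is given by a presimplex vanishing away from the horn. -/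
theorem exists_preSimplex : ∃ S : PreSimplex A (m + 2),
    (∀ (r : ℕ) (s : (Λ[m + 2, i] : SSet.{u}).obj (op ⦋r⦌)),
      hornPre g s = S.pullback (hornMap s)) ∧
    ∀ a l b h p hp, (∀ j, j ≠ i → j ∈ fullSeq a l b) → S.arrow a l b h p hp = 0 := by
  -- The object at a is the value of the horn on the constant 0-simplex at a, which avoids some j ≠
  -- i.
  have hv : ∀ a : Fin (m + 3), ∃ x : A.Obj, ∀ (r : ℕ)
      (s : (Λ[m + 2, i] : SSet.{u}).obj (op ⦋r⦌)) (c : Fin (r + 1)),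
      hornMap s c = a → (hornPre g s).obj c = x := by
    intro a
    obtain ⟨j, hj, hja⟩ := exists_ne_ne a i
    obtain ⟨s₀, hs₀⟩ := exists_hornMap_eq hj (m := 0) (OrderHom.const _ a)
      (by rintro ⟨_, h⟩; exact hja h.symm)
    refine ⟨(hornPre g s₀).obj 0, fun r s c hc => ?_⟩
    refine congrArg Sigma.fst (tot_hornPre_congr g s s₀
      (isMonotoneSeq_pair (le_refl c)) (isMonotoneSeq_pair (le_refl 0)) ?_)
    rw [hs₀]
    simp [fullSeq, hc]
  choose o ho using hv
  have harr : ∀ a l b, IsMonotoneSeq a l b → ∀ p : ℤ, p = -(l.length : ℤ) →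
      ∃ x : A.Hom (o a) (o b) p, (∀ (r : ℕ) (s : (Λ[m + 2, i] : SSet.{u}).obj (op ⦋r⦌))
        (a' : Fin (r + 1)) (l' : List (Fin (r + 1))) (b' : Fin (r + 1))
        (h' : IsMonotoneSeq a' l' b'), (fullSeq a' l' b').map (hornMap s) = fullSeq a l b →
          (hornPre g s).tot a' l' b' h' = ⟨o a, o b, p, x⟩) ∧
        ((∀ j, j ≠ i → j ∈ fullSeq a l b) → x = 0) := by
    intro a l b h p hp
    -- A sequence coming from some simplex of the horn takes the value found there, independent of
    -- the choice; any other takes the value 0. A sequence containing every j ≠ i is never of the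
    -- first kind.
    by_cases H : ∃ (r : ℕ) (s : (Λ[m + 2, i] : SSet.{u}).obj (op ⦋r⦌))
        (a' : Fin (r + 1)) (l' : List (Fin (r + 1))) (b' : Fin (r + 1)),
        IsMonotoneSeq a' l' b' ∧ (fullSeq a' l' b').map (hornMap s) = fullSeq a l b
    · obtain ⟨r, s, a', l', b', h', e⟩ := H
      have e' := e
      rw [← fullSeq_map, fullSeq_inj] at e'
      obtain ⟨x, hx⟩ : ∃ x : A.Hom (o a) (o b) p,
          (hornPre g s).tot a' l' b' h' = ⟨o a, o b, p, x⟩ := by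
        obtain rfl : p = -(l'.length : ℤ) := by rw [hp, ← e'.2.1, List.length_map]
        rw [← ho a r s a' e'.1, ← ho b r s b' e'.2.2]
        exact ⟨_, rfl⟩
      refine ⟨x, fun r₁ s₁ a₁ l₁ b₁ h₁ e₁ => ?_, fun hj => ?_⟩
      · rw [← hx]
        exact tot_hornPre_congr g _ _ _ _ (e₁.trans e.symm)
      · obtain ⟨j, hji, hj'⟩ := exists_notMem_range_hornMap s
        have := hj j hji
        rw [← e, List.mem_map] at this
        obtain ⟨c, -, hc⟩ := this
        exact absurd ⟨c, hc⟩ hj'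
    · exact ⟨0, fun r s a' l' b' h' e => absurd ⟨r, s, a', l', b', h', e⟩ H, fun _ => rfl⟩
  choose f hf hf' using harr
  refine ⟨⟨o, f⟩, fun r s => PreSimplex.ext_tot fun a l b h => ?_, hf'⟩
  rw [PreSimplex.tot_pullback]
  exact hf _ _ _ (h.map _) _ _ r s a l b h (fullSeq_map _ _ _ _).symm

end

section

variable {B : Type u} [CommRing B] {A : DGCategory.{u} B} {m : ℕ} {i : Fin (m + 3)}
  {a₁ b₁ : Fin (m + 3)} {l₁ : List (Fin (m + 3))}

theorem exists_face_lift {n : ℕ} {i j : Fin (n + 2)} (hj : j ≠ i) {a b : Fin (n + 2)}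
    {l : List (Fin (n + 2))} (h : IsMonotoneSeq a l b) (hl : j ∉ fullSeq a l b) :
    ∃ (s : (Λ[n + 1, i] : SSet.{u}).obj (op ⦋n⦌)) (a' : Fin (n + 1)) (l' : List (Fin (n + 1)))
      (b' : Fin (n + 1)), StrictMono (hornMap s) ∧ IsMonotoneSeq a' l' b' ∧ hornMap s a' = a ∧
        l'.map (hornMap s) = l ∧ hornMap s b' = b := by
  obtain ⟨s, hs⟩ := exists_hornMap_eq.{u} hj j.succAboveOrderEmb.toOrderHom
    (by rintro ⟨x, hx⟩; exact Fin.succAbove_ne j x hx)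
  have hm : StrictMono (hornMap s) := by
    rw [hs]
    exact Fin.strictMono_succAbove j
  obtain ⟨a', l', b', h'⟩ := exists_lift h (hornMap s) hm (fun x hx => by
    rw [hs]
    exact Fin.exists_succAbove_eq (by rintro rfl; exact hl hx))
  exact ⟨s, a', l', b', hm, h'⟩

/-- Each condition other than the two vanishing ones concerns a sequence avoiding some j ≠ i, except
for degenerate sequences containing all such j, where `S` is zero. Such a sequence lifts to the j-th
face, an actual simplex of the nerve, where the condition holds. -/
theorem isHornFamily_of_pullback (h₁ : fullSeq a₁ l₁ b₁ = (List.finRange (m + 3)).eraseIdx i)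
    (g : (Λ[m + 2, i] : SSet.{u}) ⟶ (equivNerve A : SSet.{u})) {S : PreSimplex A (m + 2)}
    (hS : ∀ (r : ℕ) (s : (Λ[m + 2, i] : SSet.{u}).obj (op ⦋r⦌)),
      hornPre g s = S.pullback (hornMap s))
    (hS' : ∀ a l b h p hp, (∀ j, j ≠ i → j ∈ fullSeq a l b) → S.arrow a l b h p hp = 0) :
    S.IsHornFamily 0 (innerSeq (m + 1)) (Fin.last (m + 2)) a₁ l₁ b₁ where
  unit a := by
    obtain ⟨j, hj, hja⟩ := exists_ne_ne a i
    obtain ⟨s, a', l', b', -, -, rfl, -, -⟩ := exists_face_lift.{u} hj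
      (isMonotoneSeq_pair (le_refl a)) (by simpa [fullSeq] using hja)
    -- Generalizing over T transports a statement with dependent types along the equality `hS`; the
    -- other fields do the same.
    have key : ∀ T : PreSimplex A (m + 1), hornPre g s = T →
        T.arrow a' [] a' (isMonotoneSeq_pair le_rfl) 0 (by simp) = A.id (T.obj a') := by
      rintro _ rfl
      exact (g.app _ s).1.unit a'
    exact key _ (hS _ s)
  degenerate a l b h p hp hl hd := by
    by_cases H : ∀ j, j ≠ i → j ∈ fullSeq a l b
    · exact hS' _ _ _ _ _ _ H
    push Not at H
    obtain ⟨j, hj, hja⟩ := H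
    obtain ⟨s, a', l', b', hs, h', rfl, rfl, rfl⟩ := exists_face_lift.{u} hj h hja
    have hd' : IsDegenerateSeq a' l' b' := by
      by_contra hd'
      refine not_isDegenerateSeq_of_pairwise_lt ?_ hd
      rw [fullSeq_map, List.pairwise_map]
      exact (pairwise_lt_of_not_isDegenerateSeq h' hd').imp fun h => hs h
    have hp' : p = -(l'.length : ℤ) := by simpa using hp
    have key : ∀ T : PreSimplex A (m + 1), hornPre g s = T → T.arrow a' l' b' h' p hp' = 0 := by
      rintro _ rfl
      exact (g.app _ s).1.degenerate a' l' b' h' p hp' (by simpa using hl) hd'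
    exact key _ (hS _ s)
  arrow_full h p hp := hS' _ _ _ _ _ _ fun j _ => by
    rw [fullSeq_innerSeq]
    exact List.mem_finRange j
  arrow_omit h p hp := hS' _ _ _ _ _ _ fun j hj => by
    rw [h₁, mem_eraseIdx_finRange]
    exact hj
  coherence a l b h p q hp hpq hlt ne₀ ne₁ := by
    obtain h₂ | h₂ | ⟨j, hj, hja⟩ := eq_or_eq_or_exists_notMem h₁ hlt
    · exact absurd h₂ ne₀
    · exact absurd h₂ ne₁
    obtain ⟨s, a', l', b', hs, h', rfl, rfl, rfl⟩ := exists_face_lift.{u} hj h hja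
    have hp' : p = -(l'.length : ℤ) := by simpa using hp
    have key : ∀ T : PreSimplex A (m + 1), hornPre g s = T →
        A.d p q hpq (T.arrow a' l' b' h' p hp') =
          T.bdry a' l' b' h' q (by rw [← hp', hpq]) := by
      rintro _ rfl
      exact (g.app _ s).1.coherence a' l' b' h' p q hp' hpq
    exact (key _ (hS _ s)).trans (S.bdry_pullback _ _ _ _)
  isEquivalence a b hab ne₀ ne₁ := by
    obtain h₂ | h₂ | ⟨j, hj, hja⟩ := eq_or_eq_or_exists_notMem h₁
      (a := a) (b := b) (l := []) (by simpa [fullSeq] using hab)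
    · exact absurd h₂ ne₀
    · exact absurd h₂ ne₁
    obtain ⟨s, a', l', b', hs, h', rfl, hl', rfl⟩ :=
      exists_face_lift.{u} hj (isMonotoneSeq_pair hab.le) hja
    have hab' : a' ≤ b' := hs.le_iff_le.1 hab.le
    have key : ∀ T : PreSimplex A (m + 1), hornPre g s = T →
        A.IsEquivalence (T.arrow a' [] b' (isMonotoneSeq_pair hab') 0 (by simp)) := by
      rintro _ rfl
      exact (g.app _ s).2 a' b' hab'
    exact key _ (hS _ s)

end

/-! ### Simplices over a horn are exactly the solutions of the system -/

namespace HornSystem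

variable {n : ℕ} {a₀ : Fin (n + 1)} {l₀ : List (Fin (n + 1))} {b₀ : Fin (n + 1)}
  {a₁ : Fin (n + 1)} {l₁ : List (Fin (n + 1))} {b₁ : Fin (n + 1)}

theorem map_fill {k : Type u} [Field k] {B B' : CommAlgCat.{u} k} {φ : B ⟶ B'}
    {A : DGCategory.{u} B} {A' : DGCategory.{u} B'} (F : DGFunctor φ A A') (S : PreSimplex A n)
    (x : Pair (a₀ := a₀) (l₀ := l₀) (b₀ := b₀) (a₁ := a₁) (l₁ := l₁) (b₁ := b₁) S) :
    F.mapPre (fill S x) = fill (F.mapPre S) (mapPair F S x) := by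
  unfold DGFunctor.mapPre fill PreSimplex.update
  congr 1
  funext a l b h p hp
  simp only
  split_ifs with e e'
  · obtain ⟨rfl, rfl, rfl⟩ := e
    subst hp
    rfl
  · obtain ⟨rfl, rfl, rfl⟩ := e'
    subst hp
    rfl
  · rfl

variable (hP : IsHornPair a₀ l₀ b₀ a₁ l₁ b₁) (H : HornSystem.{u} hP.mono₀ hP.mono₁)
  {B : Type u} [CommRing B] {A : DGCategory.{u} B} {S : PreSimplex A n}
  (hS : S.IsHornFamily a₀ l₀ b₀ a₁ l₁ b₁)

include hP in
theorem fill_injective : Function.Injective (fill (a₀ := a₀) (l₀ := l₀) (b₀ := b₀) (a₁ := a₁)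
    (l₁ := l₁) (b₁ := b₁) S) := by
  intro x y e
  have e₁ := congr_arg_heq (fun T : PreSimplex A n => T.arrow a₁ l₁ b₁ hP.mono₁ _ rfl) e
  have e₀ := congr_arg_heq (fun T : PreSimplex A n => T.arrow a₀ l₀ b₀ hP.mono₀ _ rfl) e
  have e₁' := eq_of_heq e₁
  have e₀' := eq_of_heq e₀
  rw [fill_arrow_omit hP, fill_arrow_omit hP] at e₁'
  rw [fill_arrow_full, fill_arrow_full] at e₀'
  exact Prod.ext e₁' e₀'

include hS in
-- This is the converse of `fillSimplex`: the equations of the system are the coherence equations of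
-- the two missing sequences.
theorem D_eq_rhs (σ : CoherentSimplex A n)
    (x : Pair (a₀ := a₀) (l₀ := l₀) (b₀ := b₀) (a₁ := a₁) (l₁ := l₁) (b₁ := b₁) S)
    (hx : σ.toPre = fill S x) : D hP H S x = rhs hP S := by
  have hlen := hP.length_eq
  have key : ∀ T : PreSimplex A n, σ.toPre = T → ∀ a l b (h : IsMonotoneSeq a l b) (p q : ℤ)
      (hp : p = -(l.length : ℤ)) (hpq : p + 1 = q),
      A.d p q hpq (T.arrow a l b h p hp) = T.bdry a l b h q (by rw [← hp, hpq]) := by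
    rintro _ rfl
    exact σ.coherence
  have k₁ := key _ hx a₁ l₁ b₁ hP.mono₁ _ _ rfl rfl
  have k₀ := key _ hx a₀ l₀ b₀ hP.mono₀ _ (-(l₁.length : ℤ)) rfl (by omega)
  rw [fill_arrow_omit hP, PreSimplex.bdry_update_of_length_le _ _ (by omega),
    PreSimplex.bdry_update_of_length_le _ _ le_rfl] at k₁
  rw [fill_arrow_full, PreSimplex.bdry_update_of_length_le _ _ le_rfl,
    H.bdry_update _ _ hS] at k₀
  exact Prod.ext k₁ (sub_eq_iff_eq_add.2 k₀)

include hP hS in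
-- The pair consists of the two arrows of the simplex at the missing sequences. Degenerate arrows
-- agree automatically, since strict unitarity prescribes them on both sides.
theorem exists_fill_eq (σ : CoherentSimplex A n) (ho : σ.obj = S.obj)
    (h : ∀ a l b h, (fullSeq a l b).Pairwise (· < ·) → ¬ (a₀ = a ∧ l₀ = l ∧ b₀ = b) →
      ¬ (a₁ = a ∧ l₁ = l ∧ b₁ = b) → σ.toPre.tot a l b h = S.tot a l b h) :
    ∃ x : Pair (a₀ := a₀) (l₀ := l₀) (b₀ := b₀) (a₁ := a₁) (l₁ := l₁) (b₁ := b₁) S,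
      σ.toPre = fill S x := by
  obtain ⟨o, f, hu, hd, hc⟩ := σ
  obtain ⟨o', f'⟩ := S
  obtain rfl : o = o' := ho
  refine ⟨(f a₁ l₁ b₁ hP.mono₁ _ rfl, f a₀ l₀ b₀ hP.mono₀ _ rfl), ?_⟩
  have key : ∀ a l b hs, f a l b hs _ rfl = (fill ⟨o, f'⟩
      (f a₁ l₁ b₁ hP.mono₁ _ rfl, f a₀ l₀ b₀ hP.mono₀ _ rfl)).arrow a l b hs _ rfl := by
    intro a l b hs
    by_cases h₀ : a₀ = a ∧ l₀ = l ∧ b₀ = b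
    · obtain ⟨rfl, rfl, rfl⟩ := h₀
      rw [fill_arrow_full]
    by_cases h₁ : a₁ = a ∧ l₁ = l ∧ b₁ = b
    · obtain ⟨rfl, rfl, rfl⟩ := h₁
      rw [fill_arrow_omit hP]
    rw [fill_arrow_of_ne _ h₀ h₁]
    by_cases hdeg : IsDegenerateSeq a l b
    · by_cases hl : l = []
      · subst hl
        obtain rfl : a = b := by simpa [IsDegenerateSeq, fullSeq] using hdeg
        exact (hu a).trans (hS.unit a).symm
      · exact (hd _ _ _ _ _ _ hl hdeg).trans (hS.degenerate _ _ _ _ _ _ hl hdeg).symm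
    · simpa [PreSimplex.tot] using
        h a l b hs (pairwise_lt_of_not_isDegenerateSeq hs hdeg) h₀ h₁
  refine PreSimplex.ext_tot fun a l b hs => ?_
  exact congrArg (fun t => (⟨o a, o b, _, t⟩ : (x : A.Obj) × (y : A.Obj) × (p : ℤ) × A.Hom x y p))
    (key a l b hs)

end HornSystem

section

variable {k : Type u} [Field k] {B : CommAlgCat.{u} k} {A : DGCategory.{u} B} {m : ℕ}
  {i : Fin (m + 3)} {a₁ b₁ : Fin (m + 3)} {l₁ : List (Fin (m + 3))}
  {g : (Λ[m + 2, i] : SSet.{u}) ⟶ (equivNerve A : SSet.{u})} {S : PreSimplex A (m + 2)}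
  (hS : ∀ (r : ℕ) (s : (Λ[m + 2, i] : SSet.{u}).obj (op ⦋r⦌)),
    hornPre g s = S.pullback (hornMap s))

include hS

/-- A simplex restricts to a given horn if and only if its arrows in the horn are the given
ones. -/
theorem horn_ι_comp_eq_iff {B' : CommAlgCat.{u} k} {φ : B ⟶ B'} {A' : DGCategory.{u} B'}
    (F : DGFunctor φ A A') (x : (equivNerve A' : SSet.{u}).obj (op ⦋m + 2⦌)) :
    Λ[m + 2, i].ι ≫ SSet.yonedaEquiv.symm x = g ≫ F.mapEquivNerve ↔
      ∀ a l b h, (∃ j, j ≠ i ∧ j ∉ fullSeq a l b) →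
        (CoherentSimplex.toPre x.1).tot a l b h = (F.mapPre S).tot a l b h := by
  have e₁ : ∀ (r : ℕ) (s : (Λ[m + 2, i] : SSet.{u}).obj (op ⦋r⦌)),
      CoherentSimplex.toPre ((Λ[m + 2, i].ι ≫ SSet.yonedaEquiv.symm x).app _ s).1 =
        (CoherentSimplex.toPre x.1).pullback (hornMap s) := fun r s => rfl
  have e₂ : ∀ (r : ℕ) (s : (Λ[m + 2, i] : SSet.{u}).obj (op ⦋r⦌)),
      CoherentSimplex.toPre ((g ≫ F.mapEquivNerve).app _ s).1 =
        (F.mapPre S).pullback (hornMap s) := fun r s => congrArg F.mapPre (hS r s)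
  constructor
  · rintro h a l b hs ⟨j, hj, hja⟩
    obtain ⟨s, a', l', b', -, h', rfl, rfl, rfl⟩ := exists_face_lift.{u} hj hs hja
    rw [← PreSimplex.tot_pullback (hornMap s) _ _ _ _ h',
      ← PreSimplex.tot_pullback (hornMap s) _ _ _ _ h', ← e₁, ← e₂, h]
  · intro h
    refine SSet.horn.hom_ext _ _ fun j hj => ?_
    refine Subtype.ext (CoherentSimplex.toPre_injective ?_)
    refine (e₁ _ _).trans (Eq.trans ?_ (e₂ _ _).symm)
    refine PreSimplex.ext_tot fun a l b hs => ?_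
    rw [PreSimplex.tot_pullback, PreSimplex.tot_pullback]
    refine h _ _ _ _ ?_
    obtain ⟨j', hj', hn⟩ := exists_notMem_range_hornMap (SSet.horn.face.{u} i j hj)
    refine ⟨j', hj', fun hm => ?_⟩
    rw [fullSeq_map, List.mem_map] at hm
    obtain ⟨c, -, hc⟩ := hm
    exact hn ⟨c, hc⟩

end

/-- The morphisms of a dg-category are obtained from those of another one by extension of
scalars. -/
def DGFunctor.IsExtension {k : Type u} [Field k] {B B' : CommAlgCat.{u} k} {φ : B ⟶ B'}
    {A : DGCategory.{u} B} {A' : DGCategory.{u} B'} (F : DGFunctor φ A A') : Prop :=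
  ∀ x y i, IsScalarExtension φ.hom.toRingHom (F.map (x := x) (y := y) (i := i)) F.map_smul

open HornSystem in
/-- The fillers of a horn in the nerve are parametrized, compatibly with base change, by the fixed
vectors of an idempotent matrix. -/
theorem exists_fillers {k : Type u} [Field k] {B : CommAlgCat.{u} k} {A : DGCategory.{u} B}
    (hfin : ∀ x y i, Module.Finite B (A.Hom x y i))
    (hproj : ∀ x y i, Module.Projective B (A.Hom x y i)) {m : ℕ} {i : Fin (m + 3)}
    (g : (Λ[m + 2, i] : SSet.{u}) ⟶ (equivNerve A : SSet.{u})) :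
    ∃ (r : ℕ) (P : Matrix (Fin r) (Fin r) B)
      (E : ∀ {B' : CommAlgCat.{u} k} {φ : B ⟶ B'} {A' : DGCategory.{u} B'}
        (F : DGFunctor φ A A'), F.IsExtension → (Fin r → B') →
          (equivNerve A' : SSet.{u}).obj (op ⦋m + 2⦌)), P * P = P ∧
      (∀ {B' : CommAlgCat.{u} k} {φ : B ⟶ B'} {A' : DGCategory.{u} B'} (F : DGFunctor φ A A')
        (hF : F.IsExtension) (v : Fin r → B'),
        Λ[m + 2, i].ι ≫ SSet.yonedaEquiv.symm (E F hF v) = g ≫ F.mapEquivNerve) ∧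
      (∀ {B' : CommAlgCat.{u} k} {φ : B ⟶ B'} {A' : DGCategory.{u} B'} (F : DGFunctor φ A A')
        (hF : F.IsExtension) (x : (equivNerve A' : SSet.{u}).obj (op ⦋m + 2⦌)),
        Λ[m + 2, i].ι ≫ SSet.yonedaEquiv.symm x = g ≫ F.mapEquivNerve →
        ∃! v : Fin r → B', (P.map φ.hom.toRingHom).mulVec v = v ∧ E F hF v = x) ∧
      ∀ {B' B'' : CommAlgCat.{u} k} {φ : B ⟶ B'} {ψ : B' ⟶ B''} {A' : DGCategory.{u} B'}
        {A'' : DGCategory.{u} B''} (F : DGFunctor φ A A') (G : DGFunctor ψ A' A'')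
        (hF : F.IsExtension) (hFG : (F.trans G).IsExtension) (v : Fin r → B'),
        G.mapEquivNerve.app _ (E F hF v) = E (F.trans G) hFG (fun j => ψ.hom (v j)) := by
  obtain ⟨a₁, b₁, l₁, h₁, ⟨H⟩⟩ := exists_hornSystem.{u} i
  have hP := isHornPair_of_fullSeq_eq h₁
  obtain ⟨S, hS, hS'⟩ := exists_preSimplex g
  have hf := isHornFamily_of_pullback h₁ g hS hS'
  obtain ⟨r, P, c, z, hPP, key⟩ := exists_parametrization hP H hf hfin hproj
  -- Every vector v gives a filler, namely the particular solution plus a combination of the z_j;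
  -- restricting to P-fixed vectors makes the parametrization injective.
  refine ⟨r, P, fun {B' φ A'} F hF v =>
    ⟨fillSimplex hP H (hf.map F) (mapPair F S c + ∑ j, v j • mapPair F S (z j))
      ((key B' φ A' F hF).1 v), isEquivalence_fillSimplex hP H (hf.map F) _ _⟩, hPP, ?_, ?_, ?_⟩
  · intro B' φ A' F hF v
    refine (horn_ι_comp_eq_iff hS F _).2 ?_
    rintro a l b h ⟨j, hj, hja⟩
    change (fill (F.mapPre S) _).tot a l b h = _
    have ne₀ : ¬ (0 = a ∧ innerSeq (m + 1) = l ∧ Fin.last (m + 2) = b) := by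
      rw [← fullSeq_inj, fullSeq_innerSeq]
      intro e
      exact hja (e ▸ List.mem_finRange j)
    have ne₁ : ¬ (a₁ = a ∧ l₁ = l ∧ b₁ = b) := by
      rw [← fullSeq_inj, h₁]
      intro e
      exact hja (e ▸ (mem_eraseIdx_finRange i j).2 hj)
    exact congrArg (fun t => (⟨(F.mapPre S).obj a, (F.mapPre S).obj b, _, t⟩ :
      (x : A'.Obj) × (y : A'.Obj) × (p : ℤ) × A'.Hom x y p))
      (fill_arrow_of_ne (S := F.mapPre S) _ ne₀ ne₁ h _ rfl)
  · intro B' φ A' F hF x hx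
    replace hx := (horn_ι_comp_eq_iff hS F x).1 hx
    obtain ⟨y, hy⟩ := exists_fill_eq hP (hf.map F) x.1
      (by
        funext a
        obtain ⟨j, hj, hja⟩ := exists_ne_ne a i
        exact congrArg Sigma.fst (hx a [] a (isMonotoneSeq_pair le_rfl)
          ⟨j, hj, by simpa [fullSeq] using hja⟩))
      (fun a l b h hlt ne₀ ne₁ => hx a l b h (by
        obtain h₂ | h₂ | h₂ := eq_or_eq_or_exists_notMem h₁ hlt
        · exact absurd h₂ ne₀
        · exact absurd h₂ ne₁
        · exact h₂))
    have hy' := D_eq_rhs hP H (hf.map F) x.1 y hy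
    obtain ⟨v, ⟨hv, hvy⟩, huniq⟩ := (key B' φ A' F hF).2 y hy'
    refine ⟨v, ⟨hv, ?_⟩, fun w hw => huniq w ⟨hw.1, ?_⟩⟩
    · refine Subtype.ext (CoherentSimplex.toPre_injective ?_)
      exact (congrArg _ hvy).trans hy.symm
    · refine fill_injective hP ?_
      exact (congrArg (fun t => CoherentSimplex.toPre (Subtype.val t)) hw.2).trans hy
  · intro B' B'' φ ψ A' A'' F G hF hFG v
    refine Subtype.ext (CoherentSimplex.toPre_injective ?_)
    refine (map_fill G (F.mapPre S) _).trans ?_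
    refine congrArg (fill ((F.trans G).mapPre S)) ?_
    rw [map_add, map_sum]
    refine congrArg₂ _ rfl (Finset.sum_congr rfl fun j _ => ?_)
    exact Prod.ext (G.map_smul _ _) (G.map_smul _ _)

/-! ### The Grothendieck–Pridham condition -/

theorem mainTheorem2 {k : Type u} [Field k] (R : DGFamily.{u} k) (hR : R.IsRepresentable)
    (n : ℕ) (hn : 2 ≤ n) (i : Fin (n + 1)) :
    GrothendieckPridham R.nerve n i := by
  obtain ⟨m, rfl⟩ : ∃ m, n = m + 2 := ⟨n - 2, by omega⟩
  intro B g
  obtain ⟨r, P, E, hP, hE, hE', hE''⟩ := exists_fillers (hR.finite B) (hR.projective B) g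
  obtain ⟨T, π, hsm, hsurj, e, he⟩ := exists_scheme_of_idempotent B P hP
  have hF : ∀ {B' : CommAlgCat.{u} k} (φ : B ⟶ B'), (R.map φ).IsExtension :=
    fun φ => hR.baseChange _ _ φ
  have hb : ∀ (B' : CommAlgCat.{u} k) (φ : B ⟶ B'), Function.Bijective
      (fun v : {v : Fin r → B' // (P.map φ.hom.toRingHom).mulVec v = v} =>
        (⟨E (R.map φ) (hF φ) v.1, hE _ _ _⟩ :
          {x : (simplices R.nerve (m + 2)).obj B' // (toMatching R.nerve (m + 2) i).app B' x =
            (matching R.nerve (m + 2) i).map φ g})) := by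
    intro B' φ
    constructor
    · intro v w hvw
      exact Subtype.ext ((hE' (R.map φ) (hF φ) _ (hE _ (hF φ) v.1)).unique ⟨v.2, rfl⟩
        ⟨w.2, (congrArg Subtype.val hvw).symm⟩)
    · intro x
      obtain ⟨v, ⟨hv, hvx⟩, -⟩ := hE' (R.map φ) (hF φ) x.1 x.2
      exact ⟨⟨v, hv⟩, Subtype.ext hvx⟩
  refine ⟨T, π, hsm, hsurj,
    fun B' φ => (Equiv.ofBijective _ (hb B' φ)).symm.trans (e B' φ), ?_⟩
  intro B' B'' φ ψ x y hxy
  obtain ⟨v, rfl⟩ := (Equiv.ofBijective _ (hb B' φ)).surjective x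
  obtain ⟨w, rfl⟩ := (Equiv.ofBijective _ (hb B'' (φ ≫ ψ))).surjective y
  rw [Equiv.trans_apply, Equiv.trans_apply, Equiv.symm_apply_apply, Equiv.symm_apply_apply]
  refine he _ _ _ _ _ _ fun j => ?_
  have hv : (P.map (φ ≫ ψ).hom.toRingHom).mulVec (fun j => ψ.hom (v.1 j)) =
      fun j => ψ.hom (v.1 j) := by
    funext j
    conv_rhs => rw [← v.2]
    simp [Matrix.mulVec, dotProduct]
  -- The functor attached to `φ ≫ ψ` equals the composite only propositionally, so the naturality of
  -- E is stated for any F equal to it. Uniqueness of parameters then identifies w with the image of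
  -- v under ψ.
  have key : ∀ (F : DGFunctor (φ ≫ ψ) (R.cat B) (R.cat B'')) (hF' : F.IsExtension),
      F = (R.map φ).trans (R.map ψ) →
      (R.map ψ).mapEquivNerve.app _ (E (R.map φ) (hF φ) v.1) =
        E F hF' (fun j => ψ.hom (v.1 j)) := by
    rintro _ hF' rfl
    exact hE'' _ _ _ _ _
  have hw := (hE' (R.map (φ ≫ ψ)) (hF _) _ (hE _ (hF _) w.1)).unique ⟨w.2, rfl⟩
    ⟨hv, ((hxy.trans (key _ (hF _) (R.map_comp φ ψ)))).symm⟩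
  exact congrFun hw j
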